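/- **Background.** Let $M\ge 0$, $a_*>0$, and put $\beta=\frac{2\rho}{(1+\rho M/2)^3}$, $\Theta=\frac{\rho}{(1+\rho M/2)^3}(1-\tau^2)$. The Schwarzschild spacetime of mass $M$ near spatial infinity, in the F-gauge (conformal Gaussian gauge) with $\kappa=\omega=\rho(1+\rho M/2)$ and conformal metric $g=\Theta^2\tilde g$, is given on $[-1,1]\times[0,a_*)\ni(\tau,\rho)$ by the analytic functions $c^0,c^1,c^\pm,f,\xi,\chi_r,\chi_t,L_r,L_t,L_x,w$ that solve the spherically symmetric conformal propagation equations $$\partial_\tau c^0=-\chi_rc^0-f,\quad \partial_\tau c^1=-\chi_rc^1,\quad \partial_\tau c^\pm=-\chi_tc^\pm,\quad \partial_\tau f=-\chi_rf+L_x,\quad \partial_\tau\xi=-\chi_t\xi,$$ $$\partial_\tau\chi_r=-\chi_r^2-L_r+2\Theta w,\quad \partial_\tau\chi_t=-\chi_t^2-L_t-\Theta w,$$ $$\partial_\tau L_r=-\chi_rL_r-2(\partial_\tau\Theta)w,\quad \partial_\tau L_t=-\chi_tL_t+(\partial_\tau\Theta)w,\quad \partial_\tau L_x=-\chi_rL_x+2\beta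 w,\quad \partial_\tau w=-3\chi_tw$$ with data $c^0=\chi_r=\chi_t=L_x=0$, $c^1=\omega$, $c^\pm=\xi=1+\rho M/2$, $f=1+\rho M$, $L_r=-2\rho M$, $L_t=\rho M$, $w=M(1+\rho M/2)^3$ at $\tau=0$ (it is assumed that $a_*$ is so small that this solution exists). Here $e_0=\partial_\tau$ and $e_1=c^0\partial_\tau+c^1\partial_\rho$ are $g$-orthonormal and $1/c^\pm$ is the area radius of the spheres with respect to $g$. Write $c^0=-\tau-a$, $c^1=\rho+b$, $c^\pm=1+c$, and $1+f_0=\chi_t-(\xi-f)+f+\chi_r$, $f_1=2(\chi_t-(\xi-f))$, $g_0=2(\chi_t+(\xi-f))$, $-(1-g_1)=\chi_t+(\xi-f)-f+\chi_r$. **Equations.** Let $Z_1,Z_2,Z_3$ be the left invariant vector fields on $SU(2)$ generated by $u_1=\frac12\begin{pmatrix}0&i\\i&0\end{pmatrix}$, $u_2=\frac12\begin{pmatrix}0&-1\\1&0\end{pmatrix}$, $u_3=\frac12\begin{pmatrix}i&0\\0&-i\end{pmatrix}$, let $X_\pm=-Z_2\mp iZ_1$, let $d\mu$ be the normalised Haar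 measure of $SU(2)$, and $D^{q,j,\alpha}=\partial_\tau^q\partial_\rho^jZ_1^{\alpha_1}Z_2^{\alpha_2}Z_3^{\alpha_3}$, $|\alpha|=\alpha_1+\alpha_2+\alpha_3$. In this gauge null infinity is $\{\tau=1\}$, and the Maxwell equations for complex functions $\phi_0,\phi_1,\phi_2$ of $(\tau,\rho,\varsigma)\in[0,1)\times[0,a_*)\times SU(2)$ are, for $k=0,1$, $$A_k\equiv(1+\tau+a)\partial_\tau\phi_k-(\rho+b)\partial_\rho\phi_k+(1+c)X_+\phi_{k+1}+((1-k)+f_k)\phi_k=0,$$ $$B_{k+1}\equiv(1-\tau-a)\partial_\tau\phi_{k+1}+(\rho+b)\partial_\rho\phi_{k+1}+(1+c)X_-\phi_k+(-k+g_k)\phi_{k+1}=0.$$ **Domains.** For $0<\rho_*<a_*$ let $(\check\tau,\check\rho)(s)$ solve $\check\tau'=1+\check\tau+a(\check\tau,\check\rho)$, $\check\rho'=-(\check\rho+b(\check\tau,\check\rho))$, $\check\tau(0)=0$, $\check\rho(0)=\rho_*$ (the outgoing characteristic). For $t\in[0,1]$ let $\mathcal N_t$ be the set of $(\tau,\rho,\varsigma)$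 with $0\le\tau\le t$ and $0\le\rho\le\check\rho(s)$, where $\check\tau(s)=\tau$; let $\mathcal S_0=\{\tau=0,\ 0\le\rho\le\rho_*\}$. **Theorem 1.** Let $m>0$ and $p>m+2$ be integers and $0<\rho_1<a_*$. Then there is $0<\rho_*<a_*$ such that the outgoing characteristic from $(0,\rho_*)$ stays in $0<\rho<a_*$ and reaches null infinity $\tau=1$, and there is a constant $C_1=C_1(\rho_*)$ with the following property. Let $\phi_0,\phi_1,\phi_2$ be a solution of $A_0=A_1=B_1=B_2=0$ that is smooth on $[0,1)\times[0,a_*)\times SU(2)$ (no regularity at $\tau=1$ is assumed) and of the form $$\phi_k=\sum_{l=|1-k|}^{p-1}\frac1{l!}\phi_k^{(l)}\rho^l+J^p(\partial_\rho^p\phi_k),\qquad \phi_k^{(l)}=\partial_\rho^l\phi_k|_{\rho=0},\qquad J(h)(\rho)=\int_0^\rho h(s)\,ds$$ (the coefficients $\phi_k^{(l)}$ then solve the transport equations that the Maxwell equations imply on $\{\rho=0\}$). Assume that the data are such that the coefficients are suitably smooth, in the sense that the source terms $\hat F_k^{(q,j,\alpha)}$, $\hat G_k^{(q,j,\alpha)}$,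 $k=0,1$, $q+j+|\alpha|\le m$, are bounded on $[0,1)\times[0,\rho_1]\times SU(2)$, where $\hat F_k^{(q,j,\alpha)}$ and $\hat G_k^{(q,j,\alpha)}$ are $D^{q,p+j,\alpha}A_k$ and $D^{q,p+j,\alpha}B_{k+1}$ with each $\phi_i$ replaced by $\sum_{l=|1-i|}^{p-1}\frac1{l!}\phi_i^{(l)}\rho^l$. Then there is a constant $C_2$ (depending on $\rho_*$ and on the solution) such that for all $t\in[0,1]$ and $k=0,1,2$ $$\int_{\mathcal N_t}\sum_{q+j+|\alpha|\le m}|D^{q,j,\alpha}(\partial_\rho^p\phi_k)|^2\,d\tau\,d\rho\,d\mu\le C_1\sum_{k'=0}^2\int_{\mathcal S_0}\sum_{q+j+|\alpha|\le m}|D^{q,j,\alpha}(\partial_\rho^p\phi_{k'})|^2\,d\rho\,d\mu+C_2 .$$ -/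

import Mathlib

open Set MeasureTheory
open scoped ContDiff ENNReal NNReal

noncomputable section

namespace FGauge

/-! ### The Schwarzschild background in the F-gauge -/

/-- The scalar functions of `(τ, ρ)` that describe a spherically symmetric conformal geometry in
conformal Gaussian coordinates. The `g`-orthonormal frame is
`e₀ = ∂_τ`, `e₁ = c0 ∂_τ + c1 ∂_ρ`, and two vectors tangent to the spheres, whose area radius with
respect to `g` is `1 / c`. The frame is parallel along `∂_τ` for the Weyl connection of the gauge.
* `f`, `ξ`, `χr`, `χt`: components of the Weyl connection (`f = f₁`; `ξ` is the angular
  coefficient along `e₁`; `χr`, `χt` are the radial and the tangential part of `χ`);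
* `Lr`, `Lt`, `Lx`: the radial, the tangential and the `(1,0)` component of the Schouten tensor of
  the Weyl connection;
* `w`: the component of the rescaled Weyl tensor. -/
structure Background where
  c0 : ℝ → ℝ → ℝ
  c1 : ℝ → ℝ → ℝ
  c : ℝ → ℝ → ℝ
  f : ℝ → ℝ → ℝ
  ξ : ℝ → ℝ → ℝ
  χr : ℝ → ℝ → ℝ
  χt : ℝ → ℝ → ℝ
  Lr : ℝ → ℝ → ℝ
  Lt : ℝ → ℝ → ℝ
  Lx : ℝ → ℝ → ℝ
  w : ℝ → ℝ → ℝ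

/-- `ω = 2 Ω / |dΩ| = ρ (1 + ρ M / 2)`, where `Ω = ρ² / (1 + ρ M / 2)²` is the conformal factor of the
initial hypersurface; the gauge is `κ = ω`. -/
def omegaS (M ρ : ℝ) : ℝ := ρ * (1 + ρ * M / 2)

/-- The spacetime conformal factor `Θ = (Ω / κ) (1 - τ² κ² / ω²)` for `κ = ω`, with the removable
singularity of `Ω / ω` at `ρ = 0` removed. -/
def Θ (M τ ρ : ℝ) : ℝ := ρ / (1 + ρ * M / 2) ^ 3 * (1 - τ ^ 2)

/-- `∂_τ Θ`. -/
def dΘ (M τ ρ : ℝ) : ℝ := ρ / (1 + ρ * M / 2) ^ 3 * (-2 * τ)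

/-- The only non-zero spatial component of the `1`-form `d` of the gauge (the component along `e₁`,
constant along the conformal geodesics). -/
def dOne (M ρ : ℝ) : ℝ := 2 * ρ / (1 + ρ * M / 2) ^ 3

/-- `u` is the Schwarzschild solution of mass `M` in the F-gauge with `κ = ω`, on
`[-1, 1] × [0, a)`: it is analytic there, and it solves the spherically symmetric conformal
propagation equations (first structure equations, curvature equations, equations for the Schouten
tensor, Bianchi equation) with the initial data induced on the time-symmetric hypersurface by the
conformal metric `-(dρ² + ρ² dσ²)` and `κ = ω`. -/
structure Background.IsSchwarzschild (u : Background) (M a : ℝ) : Prop where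
  analytic : ∀ h ∈ ({u.c0, u.c1, u.c, u.f, u.ξ, u.χr, u.χt, u.Lr, u.Lt, u.Lx, u.w} :
      Set (ℝ → ℝ → ℝ)),
    AnalyticOnNhd ℝ (fun x : ℝ × ℝ => h x.1 x.2) (Icc (-1) 1 ×ˢ Ico 0 a)
  eq_c0 : ∀ τ ∈ Icc (-1 : ℝ) 1, ∀ ρ ∈ Ico 0 a,
    HasDerivAt (fun x => u.c0 x ρ) (-u.χr τ ρ * u.c0 τ ρ - u.f τ ρ) τ
  eq_c1 : ∀ τ ∈ Icc (-1 : ℝ) 1, ∀ ρ ∈ Ico 0 a,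
    HasDerivAt (fun x => u.c1 x ρ) (-u.χr τ ρ * u.c1 τ ρ) τ
  eq_c : ∀ τ ∈ Icc (-1 : ℝ) 1, ∀ ρ ∈ Ico 0 a,
    HasDerivAt (fun x => u.c x ρ) (-u.χt τ ρ * u.c τ ρ) τ
  eq_f : ∀ τ ∈ Icc (-1 : ℝ) 1, ∀ ρ ∈ Ico 0 a,
    HasDerivAt (fun x => u.f x ρ) (-u.χr τ ρ * u.f τ ρ + u.Lx τ ρ) τ
  eq_ξ : ∀ τ ∈ Icc (-1 : ℝ) 1, ∀ ρ ∈ Ico 0 a,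
    HasDerivAt (fun x => u.ξ x ρ) (-u.χt τ ρ * u.ξ τ ρ) τ
  eq_χr : ∀ τ ∈ Icc (-1 : ℝ) 1, ∀ ρ ∈ Ico 0 a,
    HasDerivAt (fun x => u.χr x ρ) (-u.χr τ ρ ^ 2 - u.Lr τ ρ + 2 * Θ M τ ρ * u.w τ ρ) τ
  eq_χt : ∀ τ ∈ Icc (-1 : ℝ) 1, ∀ ρ ∈ Ico 0 a,
    HasDerivAt (fun x => u.χt x ρ) (-u.χt τ ρ ^ 2 - u.Lt τ ρ - Θ M τ ρ * u.w τ ρ) τ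
  eq_Lr : ∀ τ ∈ Icc (-1 : ℝ) 1, ∀ ρ ∈ Ico 0 a,
    HasDerivAt (fun x => u.Lr x ρ) (-u.χr τ ρ * u.Lr τ ρ - 2 * dΘ M τ ρ * u.w τ ρ) τ
  eq_Lt : ∀ τ ∈ Icc (-1 : ℝ) 1, ∀ ρ ∈ Ico 0 a,
    HasDerivAt (fun x => u.Lt x ρ) (-u.χt τ ρ * u.Lt τ ρ + dΘ M τ ρ * u.w τ ρ) τ
  eq_Lx : ∀ τ ∈ Icc (-1 : ℝ) 1, ∀ ρ ∈ Ico 0 a,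
    HasDerivAt (fun x => u.Lx x ρ) (-u.χr τ ρ * u.Lx τ ρ + 2 * dOne M ρ * u.w τ ρ) τ
  eq_w : ∀ τ ∈ Icc (-1 : ℝ) 1, ∀ ρ ∈ Ico 0 a,
    HasDerivAt (fun x => u.w x ρ) (-3 * u.χt τ ρ * u.w τ ρ) τ
  init_c0 : ∀ ρ ∈ Ico 0 a, u.c0 0 ρ = 0
  init_c1 : ∀ ρ ∈ Ico 0 a, u.c1 0 ρ = omegaS M ρ
  init_c : ∀ ρ ∈ Ico 0 a, u.c 0 ρ = 1 + ρ * M / 2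
  init_f : ∀ ρ ∈ Ico 0 a, u.f 0 ρ = 1 + ρ * M
  init_ξ : ∀ ρ ∈ Ico 0 a, u.ξ 0 ρ = 1 + ρ * M / 2
  init_χr : ∀ ρ ∈ Ico 0 a, u.χr 0 ρ = 0
  init_χt : ∀ ρ ∈ Ico 0 a, u.χt 0 ρ = 0
  init_Lr : ∀ ρ ∈ Ico 0 a, u.Lr 0 ρ = -2 * (ρ * M)
  init_Lt : ∀ ρ ∈ Ico 0 a, u.Lt 0 ρ = ρ * M
  init_Lx : ∀ ρ ∈ Ico 0 a, u.Lx 0 ρ = 0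
  init_w : ∀ ρ ∈ Ico 0 a, u.w 0 ρ = M * (1 + ρ * M / 2) ^ 3

namespace Background

variable (u : Background) (τ ρ : ℝ)

/-- `c⁰ = -τ - a`. -/
def a : ℝ := -τ - u.c0 τ ρ

/-- `c¹ = ρ + b`. -/
def b : ℝ := u.c1 τ ρ - ρ

/-- `c^± = 1 + c`. -/
def cc : ℝ := u.c τ ρ - 1

/-- The lower order coefficients `f₀`, `f₁` of the equations `A₀`, `A₁`. They come from the
Levi-Civita connection of `g`: with `n = e₀ - e₁`, `R = 1 / c`, one has `e₀ (log R) = χt`,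
`e₁ (log R) = ξ - f`, `[e₀, e₁] = -f e₀ - χr e₁`, and `1 + f₀ = n (log R) + f + χr`,
`f₁ = 2 n (log R)`. -/
def fk (k : Fin 2) : ℝ :=
  ![u.χt τ ρ - (u.ξ τ ρ - u.f τ ρ) + u.f τ ρ + u.χr τ ρ - 1,
    2 * (u.χt τ ρ - (u.ξ τ ρ - u.f τ ρ))] k

/-- The lower order coefficients `g₀`, `g₁` of the equations `B₁`, `B₂`. With `l = e₀ + e₁`,
`g₀ = 2 l (log R)` and `-(1 - g₁) = l (log R) - f + χr`. -/
def gk (k : Fin 2) : ℝ :=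
  ![2 * (u.χt τ ρ + (u.ξ τ ρ - u.f τ ρ)),
    u.χt τ ρ + (u.ξ τ ρ - u.f τ ρ) - u.f τ ρ + u.χr τ ρ + 1] k

end Background

/-! ### Differential operators on `ℝ × ℝ × SU(2)` -/

/-- The group `SU(2)`. -/
abbrev SU2 : Type := Matrix.specialUnitaryGroup (Fin 2) ℂ

instance : MeasurableSpace SU2 := borel SU2

instance : BorelSpace SU2 := ⟨rfl⟩

theorem mem_SU2 (z v : ℂ) (h : z * star z + v * star v = 1) :
    !![z, -star v; v, star z] ∈ Matrix.specialUnitaryGroup (Fin 2) ℂ := by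
  rw [Matrix.mem_specialUnitaryGroup_iff, Matrix.mem_unitaryGroup_iff]
  constructor
  · ext i j
    fin_cases i <;> fin_cases j <;>
      simp [Matrix.mul_apply, Fin.sum_univ_two, Matrix.star_apply] at h ⊢ <;>
      first
        | linear_combination h
        | ring
  · rw [Matrix.det_fin_two_of]
    linear_combination h

/-- The first column of `exp (s uᵢ)`, where `u₁ = ½ (0 i; i 0)`, `u₂ = ½ (0 -1; 1 0)`,
`u₃ = ½ (i 0; 0 -i)`. -/
def expCol (i : Fin 3) (s : ℝ) : ℂ × ℂ :=
  ![((Real.cos (s / 2) : ℂ), Complex.I * (Real.sin (s / 2) : ℂ)),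
    ((Real.cos (s / 2) : ℂ), (Real.sin (s / 2) : ℂ)),
    ((Real.cos (s / 2) : ℂ) + Complex.I * (Real.sin (s / 2) : ℂ), 0)] i

theorem expCol_norm (i : Fin 3) (s : ℝ) :
    (expCol i s).1 * star (expCol i s).1 + (expCol i s).2 * star (expCol i s).2 = 1 := by
  have h : (Real.cos (s / 2) : ℂ) ^ 2 + (Real.sin (s / 2) : ℂ) ^ 2 = 1 := by
    exact_mod_cast Real.cos_sq_add_sin_sq (s / 2)
  have hI : Complex.I ^ 2 = -1 := Complex.I_sq
  fin_cases i
  all_goals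
    simp only [expCol, Fin.zero_eta, Fin.mk_one, Fin.reduceFinMk, Fin.isValue, Matrix.cons_val_zero,
      Matrix.cons_val_one, Matrix.cons_val, star_mul', star_add, star_zero, Complex.star_def,
      Complex.conj_I, Complex.conj_ofReal]
  · linear_combination h - (Real.sin (s / 2) : ℂ) ^ 2 * hI
  · linear_combination h
  · linear_combination h - (Real.sin (s / 2) : ℂ) ^ 2 * hI

/-- The one-parameter subgroup `s ↦ exp (s uᵢ)` of `SU(2)`. -/
def expSU2 (i : Fin 3) (s : ℝ) : SU2 :=
  ⟨!![(expCol i s).1, -star (expCol i s).2; (expCol i s).2, star (expCol i s).1],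
    mem_SU2 _ _ (expCol_norm i s)⟩

/-- Complex functions of `(τ, ρ, ς) ∈ ℝ × ℝ × SU(2)`; only their values for `τ, ρ ≥ 0` matter. -/
abbrev Field : Type := ℝ → ℝ → SU2 → ℂ

/-- `∂_τ`, one-sided at `τ = 0`. -/
def dTau (φ : Field) : Field := fun τ ρ g => derivWithin (fun x => φ x ρ g) (Ici 0) τ

/-- `∂_ρ`, one-sided at `ρ = 0`. -/
def dRho (φ : Field) : Field := fun τ ρ g => derivWithin (fun y => φ τ y g) (Ici 0) ρ

/-- The left invariant vector field generated by `uᵢ` (`Z 0, Z 1, Z 2` are `Z₁, Z₂, Z₃`). -/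
def Z (i : Fin 3) (φ : Field) : Field := fun τ ρ g => deriv (fun s : ℝ => φ τ ρ (g * expSU2 i s)) 0

/-- `X₊ = -Z₂ - i Z₁`. -/
def Xplus (φ : Field) : Field := fun τ ρ g => -Z 1 φ τ ρ g - Complex.I * Z 0 φ τ ρ g

/-- `X₋ = -Z₂ + i Z₁`. -/
def Xminus (φ : Field) : Field := fun τ ρ g => -Z 1 φ τ ρ g + Complex.I * Z 0 φ τ ρ g

/-- `D^{q,j,α} = ∂_τ^q ∂_ρ^j Z₁^{α₁} Z₂^{α₂} Z₃^{α₃}`. -/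
def D (q j : ℕ) (α : Fin 3 → ℕ) (φ : Field) : Field :=
  dTau^[q] (dRho^[j] ((Z 0)^[α 0] ((Z 1)^[α 1] ((Z 2)^[α 2] φ))))

/-- The indices `(q, j, α)` with `q + j + |α| ≤ m`. -/
def indices (m : ℕ) : Finset (ℕ × ℕ × (Fin 3 → ℕ)) :=
  (Finset.range (m + 1) ×ˢ Finset.range (m + 1) ×ˢ
    Fintype.piFinset fun _ => Finset.range (m + 1)).filter
    fun x => x.1 + x.2.1 + ∑ i, x.2.2 i ≤ m

/-- Smoothness on `[0, 1) × [0, a) × SU(2)`, up to `τ = 0` and `ρ = 0` but not up to `τ = 1`: the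
function extends to a smooth function of `(τ, ρ)` and of the matrix entries. -/
def SmoothOnSlab (a : ℝ) (φ : Field) : Prop :=
  ∃ F : ℝ × ℝ × (Fin 2 → Fin 2 → ℂ) → ℂ,
    ContDiffOn ℝ ∞ F (Ico 0 1 ×ˢ Ico 0 a ×ˢ univ) ∧
    ∀ τ ∈ Ico (0 : ℝ) 1, ∀ ρ ∈ Ico 0 a, ∀ g : SU2, φ τ ρ g = F (τ, ρ, fun i j => g.1 i j)

/-! ### The Maxwell equations -/

/-- `A_k`, `k = 0, 1`:
`(1+τ+a) ∂_τ φ_k - (ρ+b) ∂_ρ φ_k + (1+c) X₊ φ_{k+1} + ((1-k) + f_k) φ_k`. -/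
def maxwellA (u : Background) (k : Fin 2) (φ : Fin 3 → Field) : Field := fun τ ρ g =>
  ((1 + τ + u.a τ ρ : ℝ) : ℂ) * dTau (φ k.castSucc) τ ρ g
    - ((ρ + u.b τ ρ : ℝ) : ℂ) * dRho (φ k.castSucc) τ ρ g
    + ((1 + u.cc τ ρ : ℝ) : ℂ) * Xplus (φ k.succ) τ ρ g
    + (((1 - (k : ℕ)) + u.fk τ ρ k : ℝ) : ℂ) * φ k.castSucc τ ρ g

/-- `B_{k+1}`, `k = 0, 1`:
`(1-τ-a) ∂_τ φ_{k+1} + (ρ+b) ∂_ρ φ_{k+1} + (1+c) X₋ φ_k + (-k + g_k) φ_{k+1}`. -/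
def maxwellB (u : Background) (k : Fin 2) (φ : Fin 3 → Field) : Field := fun τ ρ g =>
  ((1 - τ - u.a τ ρ : ℝ) : ℂ) * dTau (φ k.succ) τ ρ g
    + ((ρ + u.b τ ρ : ℝ) : ℂ) * dRho (φ k.succ) τ ρ g
    + ((1 + u.cc τ ρ : ℝ) : ℂ) * Xminus (φ k.castSucc) τ ρ g
    + ((-(k : ℕ) + u.gk τ ρ k : ℝ) : ℂ) * φ k.succ τ ρ g

/-- `φ` solves `A₀ = A₁ = B₁ = B₂ = 0` for `0 ≤ τ < 1`, `0 ≤ ρ < a`. -/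
def IsMaxwellSolution (u : Background) (a : ℝ) (φ : Fin 3 → Field) : Prop :=
  ∀ k : Fin 2, ∀ τ ∈ Ico (0 : ℝ) 1, ∀ ρ ∈ Ico 0 a, ∀ g : SU2,
    maxwellA u k φ τ ρ g = 0 ∧ maxwellB u k φ τ ρ g = 0

/-- The coefficient `φ^{(l)} = ∂_ρ^l φ |_{ρ = 0}`, a function on the cylinder `𝓘`. -/
def coeff (l : ℕ) (φ : Field) (τ : ℝ) (g : SU2) : ℂ := (dRho^[l] φ) τ 0 g

/-- `∑_{l = |1-k|}^{p-1} (1 / l!) φ_k^{(l)} ρ^l`. -/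
def taylorPart (p : ℕ) (φ : Fin 3 → Field) : Fin 3 → Field := fun k τ ρ g =>
  ∑ l ∈ Finset.Ico (1 - ((k : ℕ) : ℤ)).natAbs p,
    (1 / (l.factorial : ℂ)) * coeff l (φ k) τ g * (ρ : ℂ) ^ l

/-- `J (h) (ρ) = ∫_0^ρ h (s) ds`. -/
def J (h : ℝ → ℂ) : ℝ → ℂ := fun ρ => ∫ s in (0 : ℝ)..ρ, h s

/-- `φ_k = ∑_{l = |1-k|}^{p-1} (1 / l!) φ_k^{(l)} ρ^l + J^p (∂_ρ^p φ_k)`. -/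
def HasExpansion (a : ℝ) (p : ℕ) (φ : Fin 3 → Field) : Prop :=
  ∀ k : Fin 3, ∀ τ ∈ Ico (0 : ℝ) 1, ∀ ρ ∈ Ico 0 a, ∀ g : SU2,
    φ k τ ρ g = taylorPart p φ k τ ρ g + (J^[p] fun r => (dRho^[p] (φ k)) τ r g) ρ

/-- The source term `F̂_k^{(q,j,α)}`: the contribution of the coefficients `φ^{(l)}`, `l < p`, to
`D^{q,p+j,α} A_k`. All terms of the Leibniz expansion with `p` or more `ρ`-derivatives on the field
annihilate the Taylor part, so that this is the sum of the terms with at most `p - 1` of them. -/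
def sourceF (u : Background) (p : ℕ) (φ : Fin 3 → Field) (k : Fin 2) (q j : ℕ) (α : Fin 3 → ℕ) :
    Field :=
  D q (p + j) α (maxwellA u k (taylorPart p φ))

/-- The source term `Ĝ_k^{(q,j,α)}`: the contribution of the coefficients `φ^{(l)}`, `l < p`, to
`D^{q,p+j,α} B_{k+1}`. -/
def sourceG (u : Background) (p : ℕ) (φ : Fin 3 → Field) (k : Fin 2) (q j : ℕ) (α : Fin 3 → ℕ) :
    Field :=
  D q (p + j) α (maxwellB u k (taylorPart p φ))

/-- The source terms with `q + j + |α| ≤ m` are bounded for `0 ≤ τ < 1`, `0 ≤ ρ ≤ ρ₁`. -/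
def SourcesBounded (u : Background) (ρ₁ : ℝ) (m p : ℕ) (φ : Fin 3 → Field) : Prop :=
  ∀ (k : Fin 2) (q j : ℕ) (α : Fin 3 → ℕ), q + j + ∑ i, α i ≤ m →
    ∃ B : ℝ, ∀ τ ∈ Ico (0 : ℝ) 1, ∀ ρ ∈ Icc 0 ρ₁, ∀ g : SU2,
      ‖sourceF u p φ k q j α τ ρ g‖ ≤ B ∧ ‖sourceG u p φ k q j α τ ρ g‖ ≤ B

/-! ### The domains -/

/-- `s ↦ (τc s, ρc s)`, `s ∈ [0, S]`, is the outgoing characteristic that starts at `(0, ρs)`; it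
stays in the region `0 < ρ < a` and meets null infinity `τ = 1` at `s = S`. -/
structure IsOutgoingCharacteristic (u : Background) (a ρs S : ℝ) (τc ρc : ℝ → ℝ) : Prop where
  pos : 0 < S
  init_τ : τc 0 = 0
  init_ρ : ρc 0 = ρs
  end_τ : τc S = 1
  mem : ∀ s ∈ Icc 0 S, τc s ∈ Icc (0 : ℝ) 1 ∧ ρc s ∈ Ioo 0 a
  eq_τ : ∀ s ∈ Icc 0 S,
    HasDerivWithinAt τc (1 + τc s + u.a (τc s) (ρc s)) (Icc 0 S) s
  eq_ρ : ∀ s ∈ Icc 0 S,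
    HasDerivWithinAt ρc (-(ρc s + u.b (τc s) (ρc s))) (Icc 0 S) s

/-- `𝒩_t`: the points with `0 ≤ τ ≤ t` between `ρ = 0` and the outgoing characteristic. -/
def regionN (S : ℝ) (τc ρc : ℝ → ℝ) (t : ℝ) : Set (ℝ × ℝ × SU2) :=
  {z | 0 ≤ z.1 ∧ z.1 ≤ t ∧ 0 ≤ z.2.1 ∧ ∃ s ∈ Icc 0 S, τc s = z.1 ∧ z.2.1 ≤ ρc s}

/-- `∑_{q+j+|α| ≤ m} |D^{q,j,α} (∂_ρ^p φ)|²` at a point. -/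
def density (m p : ℕ) (φ : Field) (τ ρ : ℝ) (g : SU2) : ℝ≥0∞ :=
  ∑ i ∈ indices m, ‖D i.1 i.2.1 i.2.2 (dRho^[p] φ) τ ρ g‖ₑ ^ 2

end FGauge

end

/-!
Since `C₂` may depend on the solution, the claim is that every derivative
`D^{q,j,α} ∂_ρ^p φ_k` with `q + j + |α| ≤ m` is square integrable over `𝒩_1`. It is enough that its
squared norm on the slices of constant `τ` is `O((1 - τ)^(-1/2))`, which is integrable
(`mem_Bd_half`, `lintegral_density_lt_top`).

A direct energy estimate for `∂_ρ^p φ_k` does not close on this background: the coefficient of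
`∂_τ` depends on `ρ`, so that a commutator contains the derivative with one more `∂_τ` and one
less `∂_ρ`. The proof is based instead on the equations `A₀`, `A₁`, `B₂`, divided by the regular
factors of their leading coefficients (`Sys`), and the following four observations.

* *Crude bounds.* By energy estimates for the pair `(φ₁, φ₂)` and for the pairs of derivatives,
  and by transport estimates for `φ₀`, every derivative of a solution is bounded by some power `(1 - τ)^(-l)`. Because the Casimir
  operator `Z₁² + Z₂² + Z₃²` commutes with the system and controls all angular derivatives, `l` does
  not depend on the number of angular derivatives (`Slice.poly_of_solves`). These bounds pass to the
  restriction to `ρ = 0`, to the Taylor part of the solution, and to the source terms.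
* *Interpolation.* Partial integration on `SU(2)` shows that a bounded function whose angular
  derivatives are all `O((1 - τ)^(-l))` has angular derivatives `O((1 - τ)^(-ε))` for every `ε > 0`
  (`Slice.mem_Bw_of_bounded`). So the boundedness of the source terms without angular derivatives
  already yields all of them up to an arbitrarily small power.
* *Gain of powers.* Let `R_k` be the difference of `φ_k` and its Taylor part, which vanishes to
  order `p` at `ρ = 0`. If all its derivatives under consideration are `O((1 - τ)^(-l-1))`, with any
  number of angular derivatives, then the equations `A₀`, `A₁`, integrated in `τ`, give
  `O((1 - τ)^(-l))` for `R₀`, `R₁`; and the equation `B₂`, singular at `τ = 1`, gives the same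
  for `R₂`. The loss of an angular derivative is harmless. In the equation that `B₂` implies for
  `∂_τ^q ∂_ρ^n R₂`, `n ≥ p`, the undifferentiated term has the coefficient `1 + q - n` on `ρ = 0`,
  which is so negative for `q ≤ m`, `p > m + 2` that it damps the singularity: this is where the
  hypothesis on `p` enters. Derivatives of order less than `p` in `ρ` are recovered by Hardy's
  inequality, with a small constant on short slices (`Slice.exists_short`). Iteration leads from
  the crude bounds down to any positive power (`Slice.reg_remainder`).
* *Background.* The values of the background functions at `ρ = 0` follow from uniqueness for
  ordinary differential equations. That the coefficient `1 + c⁰` of `∂_τ φ₂` vanishes on `τ = 1` is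
  due to combinations of the background functions that vanish at `τ = 0` and satisfy homogeneous
  linear equations, hence vanish identically (`Background.IsSchwarzschild.c0_one`); so `1 + c⁰ = (1 - τ) h` with a regular factor `h`, which is
  close to `1` near `ρ = 0`.

The slices carry a cut-off that is transported so that it produces terms of one sign only, and is `1`
below the outgoing characteristic; so no boundary terms occur.
-/

namespace FGauge

noncomputable section

/-! ### The algebra of smooth functions on the slab -/

/-- The matrix entries. -/
abbrev Mat2 : Type := Fin 2 → Fin 2 → ℂ

/-- The linear space in which the slab is embedded: `τ`, `ρ` and the matrix entries. -/
abbrev Amb : Type := ℝ × ℝ × Mat2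

/-- The domain of the smooth extensions in `SmoothOnSlab`. -/
def slab (a : ℝ) : Set Amb := Ico 0 1 ×ˢ Ico 0 a ×ˢ univ

/-- The entries of a matrix in `SU(2)`. -/
def entries (g : SU2) : Mat2 := fun i j => g.1 i j

/-- The points `(τ, ρ, ς)` with `0 ≤ τ < 1` and `0 ≤ ρ < a`. -/
@[ext] structure Pt (a : ℝ) : Type where
  τ : ℝ
  ρ : ℝ
  g : SU2
  hτ : τ ∈ Ico (0 : ℝ) 1
  hρ : ρ ∈ Ico 0 a

variable {a : ℝ}

/-- The embedding of the points into the ambient linear space. -/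
def Pt.emb (x : Pt a) : Amb := (x.τ, x.ρ, entries x.g)

theorem Pt.emb_mem (x : Pt a) : x.emb ∈ slab a := ⟨x.hτ, x.hρ, mem_univ _⟩

/-- `F` is a smooth extension of `f` to the ambient space. -/
def Rep (F : Amb → ℂ) (f : Pt a → ℂ) : Prop :=
  ContDiffOn ℝ ∞ F (slab a) ∧ ∀ x, f x = F x.emb

/-- The `*`-algebra of smooth complex functions on the slab. -/
def SF (a : ℝ) : StarSubalgebra ℂ (Pt a → ℂ) where
  carrier := {f | ∃ F, Rep F f}
  mul_mem' := by
    rintro f g ⟨F, hF, hf⟩ ⟨G, hG, hg⟩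
    exact ⟨fun z => F z * G z, hF.mul hG, fun x => by simp [hf x, hg x]⟩
  add_mem' := by
    rintro f g ⟨F, hF, hf⟩ ⟨G, hG, hg⟩
    exact ⟨fun z => F z + G z, hF.add hG, fun x => by simp [hf x, hg x]⟩
  algebraMap_mem' c := ⟨fun _ => c, contDiffOn_const, fun x => rfl⟩
  star_mem' := by
    rintro f ⟨F, hF, hf⟩
    exact ⟨fun z => star (F z), Complex.conjCLE.contDiff.comp_contDiffOn hF,
      fun x => by simp [hf x]⟩

theorem exists_rep (f : SF a) : ∃ F, Rep F f.1 := f.2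

@[ext] theorem SF.ext {f g : SF a} (h : ∀ x, f.1 x = g.1 x) : f = g := Subtype.ext (funext h)

@[simp] theorem SF.add_apply (f g : SF a) (x : Pt a) : (f + g).1 x = f.1 x + g.1 x := rfl
@[simp] theorem SF.sub_apply (f g : SF a) (x : Pt a) : (f - g).1 x = f.1 x - g.1 x := rfl
@[simp] theorem SF.neg_apply (f : SF a) (x : Pt a) : (-f).1 x = -f.1 x := rfl
@[simp] theorem SF.mul_apply (f g : SF a) (x : Pt a) : (f * g).1 x = f.1 x * g.1 x := rfl
@[simp] theorem SF.smul_apply (c : ℂ) (f : SF a) (x : Pt a) : (c • f).1 x = c * f.1 x := rfl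
@[simp] theorem SF.star_apply (f : SF a) (x : Pt a) : (star f).1 x = star (f.1 x) := rfl
@[simp] theorem SF.one_apply (x : Pt a) : (1 : SF a).1 x = 1 := rfl
theorem interior_slab : interior (slab a) = Ioo 0 1 ×ˢ Ioo 0 a ×ˢ univ := by
  simp [slab, interior_prod_eq]

theorem slab_subset_closure : slab a ⊆ closure (interior (slab a)) := by
  rintro ⟨t, r, z⟩ ⟨ht, hr, -⟩
  have ha : (0 : ℝ) < a := hr.1.trans_lt hr.2
  rw [interior_slab, closure_prod_eq, closure_prod_eq, closure_Ioo zero_ne_one, closure_Ioo ha.ne]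
  exact ⟨⟨ht.1, ht.2.le⟩, ⟨hr.1, hr.2.le⟩, subset_closure (mem_univ _)⟩

theorem uniqueDiffOn_slab : UniqueDiffOn ℝ (slab a) :=
  (uniqueDiffOn_Ico 0 1).prod ((uniqueDiffOn_Ico 0 a).prod uniqueDiffOn_univ)

/-- An affine vector field `z ↦ L z + c` on the ambient space. -/
structure AffField where
  lin : Amb →L[ℝ] Amb
  const : Amb

/-- The value of an affine vector field. -/
def AffField.val (V : AffField) (z : Amb) : Amb := V.lin z + V.const

/-- The derivative of `F` along the vector field `V`, within the slab. -/
def lieD (a : ℝ) (V : AffField) (F : Amb → ℂ) (z : Amb) : ℂ :=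
  fderivWithin ℝ F (slab a) z (V.val z)

theorem AffField.contDiff_val (V : AffField) : ContDiff ℝ ∞ V.val :=
  V.lin.contDiff.add contDiff_const

theorem contDiffOn_lieD (V : AffField) {F : Amb → ℂ} (hF : ContDiffOn ℝ ∞ F (slab a)) :
    ContDiffOn ℝ ∞ (lieD a V F) (slab a) := by
  have h := hF.fderivWithin uniqueDiffOn_slab (m := ∞) (by simp)
  exact h.clm_apply V.contDiff_val.contDiffOn

theorem lieD_lieD (V W : AffField) {F : Amb → ℂ} (hF : ContDiffOn ℝ ∞ F (slab a)) {z : Amb}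
    (hz : z ∈ slab a) :
    lieD a V (lieD a W F) z =
      fderivWithin ℝ (fderivWithin ℝ F (slab a)) (slab a) z (V.val z) (W.val z) +
        fderivWithin ℝ F (slab a) z (W.lin (V.val z)) := by
  have h := (hF.fderivWithin uniqueDiffOn_slab (m := ∞) (by simp)).differentiableOn
    (by simp) z hz
  have h2 : HasFDerivWithinAt W.val W.lin (slab a) z :=
    (W.lin.hasFDerivAt.add_const W.const).hasFDerivWithinAt
  have h3 := (h.hasFDerivWithinAt.clm_apply h2).fderivWithin (uniqueDiffOn_slab z hz)
  have h4 : lieD a W F = fun y => (fderivWithin ℝ F (slab a) y) (W.val y) := rfl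
  rw [lieD, h4, h3]
  simp [add_comm]

theorem lieD_comm (V W : AffField) {F : Amb → ℂ} (hF : ContDiffOn ℝ ∞ F (slab a)) {z : Amb}
    (hz : z ∈ slab a) :
    lieD a V (lieD a W F) z - lieD a W (lieD a V F) z =
      fderivWithin ℝ F (slab a) z (W.lin (V.val z) - V.lin (W.val z)) := by
  rw [lieD_lieD V W hF hz, lieD_lieD W V hF hz]
  have h := (hF z hz).isSymmSndFDerivWithinAt (n := ∞) (by
      rw [minSmoothness_of_isRCLikeNormedField]; exact WithTop.coe_le_coe.2 (le_top : (2 : ℕ∞) ≤ ⊤)) uniqueDiffOn_slab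
    (slab_subset_closure hz) hz
  rw [h (V.val z) (W.val z), map_sub]
  ring

theorem Rep.differentiableWithinAt {F : Amb → ℂ} {f : Pt a → ℂ} (h : Rep F f) (x : Pt a) :
    DifferentiableWithinAt ℝ F (slab a) x.emb :=
  h.1.differentiableOn (by simp) _ x.emb_mem

/-- A first order operator on functions on the slab that is the derivative along an affine vector
field, whatever the extension, is a derivation of the algebra of smooth functions. -/
def derOf (op : (Pt a → ℂ) → Pt a → ℂ) (V : AffField)
    (hop : ∀ F f, Rep F f → ∀ x, op f x = lieD a V F x.emb) : Derivation ℂ (SF a) (SF a) :=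
  Derivation.mk'
    { toFun := fun f => ⟨op f.1, by
        obtain ⟨F, hF⟩ := exists_rep f
        exact ⟨lieD a V F, contDiffOn_lieD V hF.1, hop F _ hF⟩⟩
      map_add' := by
        intro f g
        obtain ⟨F, hF⟩ := exists_rep f
        obtain ⟨G, hG⟩ := exists_rep g
        have hFG : Rep (fun z => F z + G z) (f + g).1 :=
          ⟨hF.1.add hG.1, fun x => by simp [hF.2 x, hG.2 x]⟩
        ext x
        change op (f + g).1 x = op f.1 x + op g.1 x
        rw [hop _ _ hFG, hop _ _ hF, hop _ _ hG, lieD, lieD, lieD,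
          fderivWithin_fun_add (uniqueDiffOn_slab _ x.emb_mem) (hF.differentiableWithinAt x)
            (hG.differentiableWithinAt x)]
        rfl
      map_smul' := by
        intro c f
        obtain ⟨F, hF⟩ := exists_rep f
        have hFG : Rep (fun z => c * F z) (c • f).1 :=
          ⟨contDiffOn_const.mul hF.1, fun x => by simp [hF.2 x]⟩
        ext x
        change op (c • f).1 x = c * op f.1 x
        rw [hop _ _ hFG, hop _ _ hF, lieD, lieD,
          fderivWithin_const_mul (uniqueDiffOn_slab _ x.emb_mem) (hF.differentiableWithinAt x)]
        rfl }
    (by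
        intro f g
        obtain ⟨F, hF⟩ := exists_rep f
        obtain ⟨G, hG⟩ := exists_rep g
        have hFG : Rep (fun z => F z * G z) (f * g).1 :=
          ⟨hF.1.mul hG.1, fun x => by simp [hF.2 x, hG.2 x]⟩
        ext x
        change op (f * g).1 x = f.1 x * op g.1 x + g.1 x * op f.1 x
        rw [hop _ _ hFG, hop _ _ hF, hop _ _ hG, lieD, lieD, lieD,
          fderivWithin_fun_mul (uniqueDiffOn_slab _ x.emb_mem) (hF.differentiableWithinAt x)
            (hG.differentiableWithinAt x), hF.2, hG.2]
        rfl)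

/-- The extension by zero of a function on the slab. -/
def zeroExt (f : Pt a → ℂ) : Field := fun τ ρ g =>
  open Classical in if h : τ ∈ Ico (0 : ℝ) 1 ∧ ρ ∈ Ico 0 a then f ⟨τ, ρ, g, h.1, h.2⟩ else 0

/-- The restriction of a field to the slab. -/
def restr (a : ℝ) (φ : Field) : Pt a → ℂ := fun x => φ x.τ x.ρ x.g

theorem zeroExt_of_mem (f : Pt a → ℂ) {τ ρ : ℝ} (hτ : τ ∈ Ico (0 : ℝ) 1) (hρ : ρ ∈ Ico 0 a)
    (g : SU2) : zeroExt f τ ρ g = f ⟨τ, ρ, g, hτ, hρ⟩ := dif_pos ⟨hτ, hρ⟩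

theorem restr_zeroExt (f : Pt a → ℂ) : restr a (zeroExt f) = f := by
  funext x
  exact zeroExt_of_mem f x.hτ x.hρ _

/-! ### The derivations `∂_τ`, `∂_ρ`, `Zᵢ` -/

/-- The vector field `∂_τ`. -/
def vTau : AffField := ⟨0, (1, 0, 0)⟩
/-- The vector field `∂_ρ`. -/
def vRho : AffField := ⟨0, (0, 1, 0)⟩

/-- Right multiplication by a matrix, acting on the matrix entries. -/
def mulRightL (A : Mat2) : Mat2 →L[ℝ] Mat2 :=
  LinearMap.toContinuousLinearMap
    { toFun := fun x i j => ∑ k, x i k * A k j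
      map_add' := fun x y => by ext i j; simp [add_mul, Finset.sum_add_distrib]
      map_smul' := fun c x => by ext i j; simp [mul_assoc] }

@[simp] theorem mulRightL_apply (A x : Mat2) (i j : Fin 2) :
    mulRightL A x i j = ∑ k, x i k * A k j := rfl

/-- The left invariant vector field `(τ, ρ, x) ↦ (0, 0, x A)`. -/
def vLeft (A : Mat2) : AffField :=
  ⟨((0 : Amb →L[ℝ] ℝ)).prod ((0 : Amb →L[ℝ] ℝ).prod
    ((mulRightL A).comp ((ContinuousLinearMap.snd ℝ ℝ Mat2).comp
      (ContinuousLinearMap.snd ℝ ℝ (ℝ × Mat2))))), 0⟩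

theorem vTau_val (z : Amb) : vTau.val z = (1, 0, 0) := by simp [AffField.val, vTau]
theorem vRho_val (z : Amb) : vRho.val z = (0, 1, 0) := by simp [AffField.val, vRho]
theorem vLeft_val (A : Mat2) (z : Amb) : (vLeft A).val z = (0, 0, mulRightL A z.2.2) := by
  simp [AffField.val, vLeft]

theorem hasDerivWithinAt_tau {F : Amb → ℂ} {φ : Field} (h : Rep F (restr a φ)) (x : Pt a) :
    HasDerivWithinAt (fun t => φ t x.ρ x.g) (lieD a vTau F x.emb) (Ici 0) x.τ := by
  have hF := (h.differentiableWithinAt x).hasFDerivWithinAt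
  have hγ : HasDerivWithinAt (fun t : ℝ => ((t, x.ρ, entries x.g) : Amb)) (1, 0, 0)
      (Ico 0 1) x.τ :=
    (hasDerivWithinAt_id _ _).prodMk (hasDerivWithinAt_const _ _ _)
  have hm : MapsTo (fun t : ℝ => ((t, x.ρ, entries x.g) : Amb)) (Ico 0 1) (slab a) :=
    fun t ht => ⟨ht, x.hρ, mem_univ _⟩
  have h1 : HasDerivWithinAt (fun t => F (t, x.ρ, entries x.g)) (lieD a vTau F x.emb)
      (Ico 0 1) x.τ := by
    have := HasFDerivWithinAt.comp_hasDerivWithinAt x.τ (l := F)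
      (f := fun t : ℝ => ((t, x.ρ, entries x.g) : Amb)) hF hγ hm
    rwa [lieD, vTau_val]
  have h2 : HasDerivWithinAt (fun t => φ t x.ρ x.g) (lieD a vTau F x.emb)
      (Ico 0 1) x.τ :=
    h1.congr (fun t ht => h.2 ⟨t, x.ρ, x.g, ht, x.hρ⟩) (h.2 x)
  refine h2.mono_of_mem_nhdsWithin ?_
  rw [← Ici_inter_Iio]
  exact Filter.inter_mem self_mem_nhdsWithin (mem_nhdsWithin_of_mem_nhds (Iio_mem_nhds x.hτ.2))

theorem hasDerivWithinAt_rho {F : Amb → ℂ} {φ : Field} (h : Rep F (restr a φ)) (x : Pt a) :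
    HasDerivWithinAt (fun r => φ x.τ r x.g) (lieD a vRho F x.emb) (Ici 0) x.ρ := by
  have hF := (h.differentiableWithinAt x).hasFDerivWithinAt
  have hγ : HasDerivWithinAt (fun r : ℝ => ((x.τ, r, entries x.g) : Amb)) (0, 1, 0)
      (Ico 0 a) x.ρ :=
    (hasDerivWithinAt_const _ _ _).prodMk
      ((hasDerivWithinAt_id _ _).prodMk (hasDerivWithinAt_const _ _ _))
  have hm : MapsTo (fun r : ℝ => ((x.τ, r, entries x.g) : Amb)) (Ico 0 a) (slab a) :=
    fun t ht => ⟨x.hτ, ht, mem_univ _⟩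
  have h1 : HasDerivWithinAt (fun r => F (x.τ, r, entries x.g)) (lieD a vRho F x.emb)
      (Ico 0 a) x.ρ := by
    have := HasFDerivWithinAt.comp_hasDerivWithinAt x.ρ (l := F)
      (f := fun r : ℝ => ((x.τ, r, entries x.g) : Amb)) hF hγ hm
    rwa [lieD, vRho_val]
  have h2 : HasDerivWithinAt (fun r => φ x.τ r x.g) (lieD a vRho F x.emb)
      (Ico 0 a) x.ρ :=
    h1.congr (fun t ht => h.2 ⟨x.τ, t, x.g, x.hτ, ht⟩) (h.2 x)
  refine h2.mono_of_mem_nhdsWithin ?_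
  rw [← Ici_inter_Iio]
  exact Filter.inter_mem self_mem_nhdsWithin (mem_nhdsWithin_of_mem_nhds (Iio_mem_nhds x.hρ.2))

/-- The generators `u₁, u₂, u₃` of `SU(2)`. -/
def gen (i : Fin 3) : Mat2 :=
  ![![![0, Complex.I / 2], ![Complex.I / 2, 0]], ![![0, -1 / 2], ![1 / 2, 0]],
    ![![Complex.I / 2, 0], ![0, -Complex.I / 2]]] i

theorem hasDerivAt_expSU2 (i : Fin 3) : HasDerivAt (fun s => entries (expSU2 i s)) (gen i) 0 := by
  have hc : HasDerivAt (fun s : ℝ => ((Real.cos (s / 2) : ℝ) : ℂ)) 0 0 := by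
    have := (((hasDerivAt_id (0 : ℝ)).div_const 2).cos).ofReal_comp
    simpa using this
  have hs : HasDerivAt (fun s : ℝ => ((Real.sin (s / 2) : ℝ) : ℂ)) (1 / 2) 0 := by
    have := (((hasDerivAt_id (0 : ℝ)).div_const 2).sin).ofReal_comp
    simpa using this
  have hIs : HasDerivAt (fun s : ℝ => Complex.I * ((Real.sin (s / 2) : ℝ) : ℂ))
      (Complex.I / 2) 0 := by
    have := hs.const_mul Complex.I
    rwa [mul_one_div] at this
  rw [hasDerivAt_pi]
  intro j
  rw [hasDerivAt_pi]
  intro k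
  fin_cases i <;> fin_cases j <;> fin_cases k <;>
    simp only [entries, expSU2, expCol, gen, Fin.zero_eta, Fin.mk_one, Fin.reduceFinMk,
      Fin.isValue, Matrix.of_apply, Matrix.cons_val_zero, Matrix.cons_val_one, Matrix.cons_val,
      Matrix.cons_val', Matrix.cons_val_fin_one, star_mul', star_add, star_zero, neg_zero,
      Complex.star_def, Complex.conj_I, Complex.conj_ofReal]
  · exact hc
  · exact hIs.congr_of_eventuallyEq (Filter.Eventually.of_forall fun s => by simp)
  · exact hIs
  · exact hc
  · exact hc
  · simpa [neg_div] using hs.fun_neg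
  · exact hs
  · exact hc
  · simpa using hc.fun_add hIs
  · exact hasDerivAt_const _ _
  · exact hasDerivAt_const _ _
  · simpa [neg_div, sub_eq_add_neg] using hc.fun_sub hIs

theorem expSU2_zero (i : Fin 3) : expSU2 i 0 = 1 := by
  apply Subtype.ext
  ext j k
  fin_cases i <;> fin_cases j <;> fin_cases k <;> simp [expSU2, expCol]

theorem entries_mul (g h : SU2) : entries (g * h) = mulRightL (entries h) (entries g) := by
  ext i j
  simp [entries, Matrix.mul_apply]

theorem hasDerivAt_entries_mul_exp (i : Fin 3) (g : SU2) :
    HasDerivAt (fun s => entries (g * expSU2 i s)) (mulRightL (gen i) (entries g)) 0 := by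
  rw [hasDerivAt_pi]
  intro j
  rw [hasDerivAt_pi]
  intro k
  simp only [entries_mul, mulRightL_apply]
  have h := hasDerivAt_expSU2 i
  rw [hasDerivAt_pi] at h
  refine HasDerivAt.fun_sum fun l _ => ?_
  have h' := h l
  rw [hasDerivAt_pi] at h'
  exact (h' k).const_mul _

theorem hasDerivAt_left {F : Amb → ℂ} {φ : Field} (h : Rep F (restr a φ)) (i : Fin 3) (x : Pt a) :
    HasDerivAt (fun s => φ x.τ x.ρ (x.g * expSU2 i s))
      (lieD a (vLeft (gen i)) F x.emb) 0 := by
  have hF := (h.differentiableWithinAt x).hasFDerivWithinAt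
  set γ : ℝ → Amb := fun s => (x.τ, x.ρ, entries (x.g * expSU2 i s)) with hγd
  have hγ : HasDerivWithinAt γ (0, 0, mulRightL (gen i) (entries x.g)) univ 0 :=
    (hasDerivWithinAt_const _ _ _).prodMk ((hasDerivWithinAt_const _ _ _).prodMk
      (hasDerivAt_entries_mul_exp i x.g).hasDerivWithinAt)
  have hm : MapsTo γ univ (slab a) := fun t ht => ⟨x.hτ, x.hρ, mem_univ _⟩
  have h0 : γ 0 = x.emb := by simp [hγd, expSU2_zero, Pt.emb]
  rw [← h0] at hF
  have := HasFDerivWithinAt.comp_hasDerivWithinAt 0 hF hγ hm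
  rw [hasDerivWithinAt_univ, h0] at this
  have e : (F ∘ γ) = fun s => φ x.τ x.ρ (x.g * expSU2 i s) := by
    funext s
    exact (h.2 ⟨x.τ, x.ρ, x.g * expSU2 i s, x.hτ, x.hρ⟩).symm
  rw [e] at this
  rwa [lieD, vLeft_val]

theorem restr_dTau {F : Amb → ℂ} {φ : Field} (h : Rep F (restr a φ)) (x : Pt a) :
    restr a (dTau φ) x = lieD a vTau F x.emb :=
  (hasDerivWithinAt_tau h x).derivWithin (uniqueDiffOn_Ici 0 _ x.hτ.1)

theorem restr_dRho {F : Amb → ℂ} {φ : Field} (h : Rep F (restr a φ)) (x : Pt a) :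
    restr a (dRho φ) x = lieD a vRho F x.emb :=
  (hasDerivWithinAt_rho h x).derivWithin (uniqueDiffOn_Ici 0 _ x.hρ.1)

theorem restr_Z {F : Amb → ℂ} {φ : Field} (h : Rep F (restr a φ)) (i : Fin 3) (x : Pt a) :
    restr a (Z i φ) x = lieD a (vLeft (gen i)) F x.emb :=
  (hasDerivAt_left h i x).deriv

/-- `∂_τ` on smooth functions. -/
def dt : Derivation ℂ (SF a) (SF a) :=
  derOf (fun f => restr a (dTau (zeroExt f))) vTau fun F f h x =>
    restr_dTau (by rwa [restr_zeroExt]) x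

/-- `∂_ρ` on smooth functions. -/
def dr : Derivation ℂ (SF a) (SF a) :=
  derOf (fun f => restr a (dRho (zeroExt f))) vRho fun F f h x =>
    restr_dRho (by rwa [restr_zeroExt]) x

/-- The left invariant vector field generated by `uᵢ` on smooth functions. -/
def dz (i : Fin 3) : Derivation ℂ (SF a) (SF a) :=
  derOf (fun f => restr a (Z i (zeroExt f))) (vLeft (gen i)) fun F f h x =>
    restr_Z (by rwa [restr_zeroExt]) i x

theorem rep_dt {F : Amb → ℂ} {f : SF a} (h : Rep F f.1) : Rep (lieD a vTau F) (dt f).1 :=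
  ⟨contDiffOn_lieD _ h.1, fun x => restr_dTau (by rwa [restr_zeroExt]) x⟩

theorem rep_dr {F : Amb → ℂ} {f : SF a} (h : Rep F f.1) : Rep (lieD a vRho F) (dr f).1 :=
  ⟨contDiffOn_lieD _ h.1, fun x => restr_dRho (by rwa [restr_zeroExt]) x⟩

theorem rep_dz (i : Fin 3) {F : Amb → ℂ} {f : SF a} (h : Rep F f.1) :
    Rep (lieD a (vLeft (gen i)) F) (dz i f).1 :=
  ⟨contDiffOn_lieD _ h.1, fun x => restr_Z (by rwa [restr_zeroExt]) i x⟩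

theorem dt_dr (f : SF a) : dt (dr f) = dr (dt f) := by
  obtain ⟨F, hF⟩ := exists_rep f
  ext x
  rw [(rep_dt (rep_dr hF)).2, (rep_dr (rep_dt hF)).2, ← sub_eq_zero,
    lieD_comm _ _ hF.1 x.emb_mem]
  simp [vTau, vRho]

theorem dt_dz (i : Fin 3) (f : SF a) : dt (dz i f) = dz i (dt f) := by
  obtain ⟨F, hF⟩ := exists_rep f
  ext x
  rw [(rep_dt (rep_dz i hF)).2, (rep_dz i (rep_dt hF)).2, ← sub_eq_zero,
    lieD_comm _ _ hF.1 x.emb_mem, vTau_val]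
  simp only [vTau, vLeft]
  simp
  exact map_zero _

theorem dr_dz (i : Fin 3) (f : SF a) : dr (dz i f) = dz i (dr f) := by
  obtain ⟨F, hF⟩ := exists_rep f
  ext x
  rw [(rep_dr (rep_dz i hF)).2, (rep_dz i (rep_dr hF)).2, ← sub_eq_zero,
    lieD_comm _ _ hF.1 x.emb_mem, vRho_val]
  simp only [vRho, vLeft]
  simp
  exact map_zero _

theorem gen_bracket (i : Fin 3) (x : Mat2) :
    mulRightL (gen (i + 1)) (mulRightL (gen i) x) - mulRightL (gen i) (mulRightL (gen (i + 1)) x) =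
      mulRightL (gen (i + 2)) x := by
  have hI : Complex.I ^ 2 = -1 := Complex.I_sq
  ext j k
  fin_cases i <;> fin_cases k <;>
    simp [gen, Fin.sum_univ_two] <;> ring_nf <;> (try rw [hI]) <;> ring_nf

/-- The commutation relations `[Z₁, Z₂] = Z₃` and cyclic. -/
theorem dz_bracket (i : Fin 3) (f : SF a) :
    dz i (dz (i + 1) f) - dz (i + 1) (dz i f) = dz (i + 2) f := by
  obtain ⟨F, hF⟩ := exists_rep f
  ext x
  rw [SF.sub_apply, (rep_dz _ (rep_dz _ hF)).2, (rep_dz _ (rep_dz _ hF)).2,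
    lieD_comm _ _ hF.1 x.emb_mem, (rep_dz _ hF).2, lieD, vLeft_val, vLeft_val, vLeft_val]
  congr 1
  simp only [vLeft, ContinuousLinearMap.prod_apply, Prod.mk_sub_mk]
  simp [gen_bracket]

/-! ### The group `SU(2)` and integrals over the slices -/

theorem isInducing_entries : Topology.IsInducing entries := Topology.IsInducing.subtypeVal

theorem continuous_entries : Continuous entries := isInducing_entries.continuous

instance : SecondCountableTopology SU2 := isInducing_entries.secondCountableTopology

instance : CompactSpace SU2 := by
  have hr : range entries = {A : Mat2 | (Matrix.of A) ∈ Matrix.specialUnitaryGroup (Fin 2) ℂ} := by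
    ext A
    constructor
    · rintro ⟨g, rfl⟩
      exact g.2
    · intro h
      exact ⟨⟨Matrix.of A, h⟩, rfl⟩
  have hc : IsClosed (range entries) := by
    rw [hr]
    simp only [Matrix.mem_specialUnitaryGroup_iff, Matrix.mem_unitaryGroup_iff, ofPred_and]
    have h1 : Continuous fun A : Mat2 => (Matrix.of A : Matrix (Fin 2) (Fin 2) ℂ) := continuous_id
    exact (isClosed_eq (h1.mul h1.star) continuous_const).inter
      (isClosed_eq h1.matrix_det continuous_const)
  have hb : range entries ⊆ Metric.closedBall 0 1 := by
    rintro _ ⟨g, rfl⟩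
    rw [mem_closedBall_zero_iff, pi_norm_le_iff_of_nonneg zero_le_one]
    intro i
    rw [pi_norm_le_iff_of_nonneg zero_le_one]
    intro j
    exact entry_norm_bound_of_unitary (Matrix.mem_specialUnitaryGroup_iff.1 g.2).1 i j
  have hk : IsCompact (range entries) := (isCompact_closedBall 0 1).of_isClosed_subset hc hb
  rw [← isCompact_univ_iff, isInducing_entries.isCompact_iff, image_univ]
  exact hk

instance : IsTopologicalGroup SU2 where
  continuous_mul := by
    refine continuous_induced_rng.2 ?_
    exact (continuous_subtype_val.comp continuous_fst).mul (continuous_subtype_val.comp continuous_snd)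
  continuous_inv := by
    refine continuous_induced_rng.2 ?_
    exact continuous_subtype_val.star

theorem isMulRightInvariant_of_isHaarMeasure (μ : Measure SU2) [μ.IsHaarMeasure]
    [IsProbabilityMeasure μ] : μ.IsMulRightInvariant where
  map_mul_right_eq_self g := by
    have : IsProbabilityMeasure (Measure.map (· * g) μ) :=
      Measure.isProbabilityMeasure_map (measurable_mul_const g).aemeasurable
    exact Measure.isHaarMeasure_eq_of_isProbabilityMeasure _ _

theorem expSU2_add (i : Fin 3) (s t : ℝ) : expSU2 i (s + t) = expSU2 i s * expSU2 i t := by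
  have hI : Complex.I ^ 2 = -1 := Complex.I_sq
  have hc : Complex.cos ((s + t : ℂ) / 2) = Complex.cos (s / 2) * Complex.cos (t / 2)
      - Complex.sin (s / 2) * Complex.sin (t / 2) := by rw [add_div, Complex.cos_add]
  have hs : Complex.sin ((s + t : ℂ) / 2) = Complex.sin (s / 2) * Complex.cos (t / 2)
      + Complex.cos (s / 2) * Complex.sin (t / 2) := by rw [add_div, Complex.sin_add]
  have e1 : ∀ r : ℝ, (starRingEnd ℂ) (Complex.cos (r / 2)) = Complex.cos (r / 2) := fun r => by
    rw [← Complex.cos_conj, map_div₀, Complex.conj_ofReal, map_ofNat]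
  have e2 : ∀ r : ℝ, (starRingEnd ℂ) (Complex.sin (r / 2)) = Complex.sin (r / 2) := fun r => by
    rw [← Complex.sin_conj, map_div₀, Complex.conj_ofReal, map_ofNat]
  apply Subtype.ext
  ext j k
  fin_cases i <;> fin_cases j <;> fin_cases k <;>
    simp [expSU2, expCol, hc, hs, e1, e2] <;> ring_nf <;>
    (try rw [hI]) <;> ring_nf

theorem continuousOn_zeroExt (f : SF a) :
    ContinuousOn (fun z : ℝ × ℝ × SU2 => zeroExt f.1 z.1 z.2.1 z.2.2)
      (Ico 0 1 ×ˢ Ico 0 a ×ˢ univ) := by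
  obtain ⟨F, hF⟩ := exists_rep f
  have h : ContinuousOn (fun z : ℝ × ℝ × SU2 => F (z.1, z.2.1, entries z.2.2))
      (Ico 0 1 ×ˢ Ico 0 a ×ˢ univ) := by
    refine hF.1.continuousOn.comp (Continuous.continuousOn ?_) fun z hz => ⟨hz.1, hz.2.1, mem_univ _⟩
    exact continuous_fst.prodMk ((continuous_fst.comp continuous_snd).prodMk
      (continuous_entries.comp (continuous_snd.comp continuous_snd)))
  refine h.congr fun z hz => ?_
  rw [zeroExt_of_mem _ hz.1 hz.2.1, hF.2]
  rfl

theorem exists_bound_zeroExt (f : SF a) {b t : ℝ} (hb : b < a) (ht : t < 1) :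
    ∃ K : ℝ, ∀ τ ∈ Icc 0 t, ∀ ρ ∈ Icc 0 b, ∀ g, ‖zeroExt f.1 τ ρ g‖ ≤ K := by
  have hk : IsCompact (Icc (0 : ℝ) t ×ˢ Icc (0 : ℝ) b ×ˢ (univ : Set SU2)) :=
    isCompact_Icc.prod (isCompact_Icc.prod isCompact_univ)
  obtain ⟨K, hK⟩ := hk.exists_bound_of_continuousOn ((continuousOn_zeroExt f).mono fun z hz =>
    ⟨⟨hz.1.1, hz.1.2.trans_lt ht⟩, ⟨hz.2.1.1, hz.2.1.2.trans_lt hb⟩, hz.2.2⟩)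
  exact ⟨K, fun τ hτ ρ hρ g => hK (τ, ρ, g) ⟨hτ, hρ, mem_univ _⟩⟩

variable (μ : Measure SU2) [IsProbabilityMeasure μ]

/-- The measure `dρ dμ` on `0 ≤ ρ ≤ b`. -/
def sliceMeasure (b : ℝ) : Measure (ℝ × SU2) := (volume.restrict (Icc 0 b)).prod μ

instance (b : ℝ) : IsFiniteMeasure (sliceMeasure μ b) := by
  unfold sliceMeasure
  infer_instance

theorem sliceMeasure_eq (b : ℝ) :
    sliceMeasure μ b = (volume.prod μ).restrict (Icc 0 b ×ˢ univ) := by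
  rw [sliceMeasure, ← Measure.prod_restrict, Measure.restrict_univ]

theorem ae_sliceMeasure (b : ℝ) : ∀ᵐ y ∂(sliceMeasure μ b), y.1 ∈ Icc 0 b := by
  rw [sliceMeasure_eq]
  filter_upwards [ae_restrict_mem (measurableSet_Icc.prod MeasurableSet.univ)] with y hy
  exact hy.1

/-- The integral of `f` over the slice `0 ≤ ρ ≤ b` at time `τ`. -/
def sliceInt (b τ : ℝ) (f : SF a) : ℂ := ∫ y, zeroExt f.1 τ y.1 y.2 ∂(sliceMeasure μ b)

variable {b : ℝ}

theorem aestronglyMeasurable_slice (hb : b < a) {τ : ℝ} (hτ : τ ∈ Ico (0 : ℝ) 1) (f : SF a) :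
    AEStronglyMeasurable (fun y : ℝ × SU2 => zeroExt f.1 τ y.1 y.2) (sliceMeasure μ b) := by
  rw [sliceMeasure_eq]
  refine ContinuousOn.aestronglyMeasurable ?_ (measurableSet_Icc.prod MeasurableSet.univ)
  exact (continuousOn_zeroExt f).comp
    (f := fun y : ℝ × SU2 => ((τ, y.1, y.2) : ℝ × ℝ × SU2)) (by fun_prop)
    fun y hy => ⟨hτ, ⟨hy.1.1, hy.1.2.trans_lt hb⟩, mem_univ _⟩

theorem integrable_slice (hb : b < a) {τ : ℝ} (hτ : τ ∈ Ico (0 : ℝ) 1) (f : SF a) :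
    Integrable (fun y : ℝ × SU2 => zeroExt f.1 τ y.1 y.2) (sliceMeasure μ b) := by
  obtain ⟨K, hK⟩ := exists_bound_zeroExt f hb hτ.2
  refine Integrable.of_bound (aestronglyMeasurable_slice μ hb hτ f) K ?_
  filter_upwards [ae_sliceMeasure μ b] with y hy
  exact hK τ ⟨hτ.1, le_rfl⟩ _ hy _

theorem sliceInt_add (hb : b < a) {τ : ℝ} (hτ : τ ∈ Ico (0 : ℝ) 1) (f g : SF a) :
    sliceInt μ b τ (f + g) = sliceInt μ b τ f + sliceInt μ b τ g := by
  unfold sliceInt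
  rw [← integral_add (integrable_slice μ hb hτ f) (integrable_slice μ hb hτ g)]
  refine integral_congr_ae ?_
  filter_upwards [ae_sliceMeasure μ b] with y hy
  have hy' : y.1 ∈ Ico 0 a := ⟨hy.1, hy.2.trans_lt hb⟩
  simp [zeroExt_of_mem _ hτ hy']

theorem sliceInt_smul (hb : b < a) {τ : ℝ} (hτ : τ ∈ Ico (0 : ℝ) 1) (c : ℂ) (f : SF a) :
    sliceInt μ b τ (c • f) = c * sliceInt μ b τ f := by
  unfold sliceInt
  rw [← integral_const_mul]
  refine integral_congr_ae ?_
  filter_upwards [ae_sliceMeasure μ b] with y hy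
  have hy' : y.1 ∈ Ico 0 a := ⟨hy.1, hy.2.trans_lt hb⟩
  simp [zeroExt_of_mem _ hτ hy']

theorem sliceInt_re_mono (hb : b < a) {τ : ℝ} (hτ : τ ∈ Ico (0 : ℝ) 1) {f g : SF a}
    (h : ∀ x : Pt a, x.τ = τ → x.ρ ≤ b → (f.1 x).re ≤ (g.1 x).re) :
    (sliceInt μ b τ f).re ≤ (sliceInt μ b τ g).re := by
  unfold sliceInt
  have e := fun f : SF a => integral_re (integrable_slice μ hb hτ f)
  simp only [RCLike.re_to_complex] at e
  rw [← e, ← e]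
  refine integral_mono_ae (integrable_slice μ hb hτ f).re (integrable_slice μ hb hτ g).re ?_
  filter_upwards [ae_sliceMeasure μ b] with y hy
  have hy' : y.1 ∈ Ico 0 a := ⟨hy.1, hy.2.trans_lt hb⟩
  simpa [zeroExt_of_mem _ hτ hy'] using h ⟨τ, y.1, y.2, hτ, hy'⟩ rfl hy.2

theorem hasDerivWithinAt_zeroExt_tau (f : SF a) (x : Pt a) :
    HasDerivWithinAt (fun t => zeroExt f.1 t x.ρ x.g) ((dt f).1 x) (Ici 0) x.τ := by
  obtain ⟨F, hF⟩ := exists_rep f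
  rw [(rep_dt hF).2]
  exact hasDerivWithinAt_tau (by rwa [restr_zeroExt]) x

theorem hasDerivWithinAt_zeroExt_rho (f : SF a) (x : Pt a) :
    HasDerivWithinAt (fun r => zeroExt f.1 x.τ r x.g) ((dr f).1 x) (Ici 0) x.ρ := by
  obtain ⟨F, hF⟩ := exists_rep f
  rw [(rep_dr hF).2]
  exact hasDerivWithinAt_rho (by rwa [restr_zeroExt]) x

theorem hasDerivAt_zeroExt_left (f : SF a) (i : Fin 3) (x : Pt a) :
    HasDerivAt (fun s => zeroExt f.1 x.τ x.ρ (x.g * expSU2 i s)) ((dz i f).1 x) 0 := by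
  obtain ⟨F, hF⟩ := exists_rep f
  rw [(rep_dz i hF).2]
  exact hasDerivAt_left (by rwa [restr_zeroExt]) i x

theorem hasDerivAt_sliceInt (hb : b < a) {τ : ℝ} (hτ : τ ∈ Ioo (0 : ℝ) 1) (f : SF a) :
    HasDerivAt (fun t => sliceInt μ b t f) (sliceInt μ b τ (dt f)) τ := by
  obtain ⟨t1, h1, h2⟩ := exists_between hτ.2
  obtain ⟨K, hK⟩ := exists_bound_zeroExt (dt f) hb h2
  have hs : Ioo 0 t1 ∈ nhds τ := Ioo_mem_nhds hτ.1 h1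
  have hI : ∀ t ∈ Ioo 0 t1, t ∈ Ico (0 : ℝ) 1 := fun t ht => ⟨ht.1.le, ht.2.trans h2⟩
  refine (hasDerivAt_integral_of_dominated_loc_of_deriv_le (bound := fun _ => K) hs ?_
    (integrable_slice μ hb ⟨hτ.1.le, hτ.2⟩ f)
    (F' := fun t (y : ℝ × SU2) => zeroExt (dt f).1 t y.1 y.2)
    (aestronglyMeasurable_slice μ hb ⟨hτ.1.le, hτ.2⟩ _) ?_ (integrable_const K) ?_).2
  · filter_upwards [hs] with t ht
    exact aestronglyMeasurable_slice μ hb (hI t ht) f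
  · filter_upwards [ae_sliceMeasure μ b] with y hy t ht
    exact hK t ⟨ht.1.le, ht.2.le⟩ _ hy _
  · filter_upwards [ae_sliceMeasure μ b] with y hy t ht
    have hy' : y.1 ∈ Ico 0 a := ⟨hy.1, hy.2.trans_lt hb⟩
    rw [zeroExt_of_mem _ (hI t ht) hy']
    exact (hasDerivWithinAt_zeroExt_tau f ⟨t, y.1, y.2, hI t ht, hy'⟩).hasDerivAt
      (Ici_mem_nhds ht.1)

theorem continuousOn_sliceInt (hb : b < a) (f : SF a) :
    ContinuousOn (fun t => sliceInt μ b t f) (Ico 0 1) := by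
  intro τ hτ
  obtain ⟨t1, h1, h2⟩ := exists_between hτ.2
  obtain ⟨K, hK⟩ := exists_bound_zeroExt f hb h2
  refine continuousWithinAt_of_dominated (bound := fun _ => K) ?_ ?_ (integrable_const K) ?_
  · filter_upwards [self_mem_nhdsWithin] with t ht
    exact aestronglyMeasurable_slice μ hb ht f
  · filter_upwards [self_mem_nhdsWithin, mem_nhdsWithin_of_mem_nhds (Iio_mem_nhds h1)] with t ht ht1
    filter_upwards [ae_sliceMeasure μ b] with y hy
    exact hK t ⟨ht.1, le_of_lt ht1⟩ _ hy _
  · filter_upwards [ae_sliceMeasure μ b] with y hy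
    have hy' : y.1 ∈ Ico 0 a := ⟨hy.1, hy.2.trans_lt hb⟩
    exact (hasDerivWithinAt_zeroExt_tau f ⟨τ, y.1, y.2, hτ, hy'⟩).continuousWithinAt.mono
      fun t ht => ht.1

theorem sliceInt_dr (hb0 : 0 ≤ b) (hb : b < a) {τ : ℝ} (hτ : τ ∈ Ico (0 : ℝ) 1) (f : SF a)
    (h0 : ∀ x : Pt a, x.ρ = 0 → f.1 x = 0) (h1 : ∀ x : Pt a, x.ρ = b → f.1 x = 0) :
    sliceInt μ b τ (dr f) = 0 := by
  have hi := integrable_slice μ hb hτ (dr f)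
  unfold sliceInt
  unfold sliceMeasure at hi ⊢
  rw [integral_prod_symm _ hi]
  refine integral_eq_zero_of_ae (Filter.Eventually.of_forall fun g => ?_)
  have hI : ∀ r ∈ Icc 0 b, r ∈ Ico 0 a := fun r hr => ⟨hr.1, hr.2.trans_lt hb⟩
  have hc : ContinuousOn (fun r => zeroExt (dr f).1 τ r g) (Icc 0 b) :=
    (continuousOn_zeroExt (dr f)).comp (f := fun r : ℝ => ((τ, r, g) : ℝ × ℝ × SU2))
      (by fun_prop) fun r hr => ⟨hτ, hI r hr, mem_univ _⟩
  have key := intervalIntegral.integral_eq_sub_of_hasDerivAt_of_le hb0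
    (f := fun r => zeroExt f.1 τ r g) (f' := fun r => zeroExt (dr f).1 τ r g)
    (fun r hr => ((hasDerivWithinAt_zeroExt_rho f ⟨τ, r, g, hτ, hI r hr⟩).continuousWithinAt).mono
      fun s hs => hs.1)
    (fun r hr => by
      rw [zeroExt_of_mem _ hτ (hI r ⟨hr.1.le, hr.2.le⟩)]
      exact (hasDerivWithinAt_zeroExt_rho f ⟨τ, r, g, hτ, hI r ⟨hr.1.le, hr.2.le⟩⟩).hasDerivAt
        (Ici_mem_nhds hr.1))
    (hc.intervalIntegrable_of_Icc hb0)
  rw [intervalIntegral.integral_of_le hb0, ← integral_Icc_eq_integral_Ioc] at key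
  change ∫ r in Icc 0 b, zeroExt (dr f).1 τ r g = 0
  rw [key, zeroExt_of_mem _ hτ (hI b ⟨hb0, le_rfl⟩), zeroExt_of_mem _ hτ (hI 0 ⟨le_rfl, hb0⟩),
    h0 ⟨τ, 0, g, hτ, _⟩ rfl, h1 ⟨τ, b, g, hτ, _⟩ rfl, sub_zero]

/-- A left invariant vector field integrates to zero, since the flow is by right translations and
Haar measure on the compact group is right invariant. -/
theorem sliceInt_dz [μ.IsHaarMeasure] (hb : b < a) {τ : ℝ} (hτ : τ ∈ Ico (0 : ℝ) 1) (i : Fin 3) (f : SF a) :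
    sliceInt μ b τ (dz i f) = 0 := by
  have := isMulRightInvariant_of_isHaarMeasure μ
  have hi := integrable_slice μ hb hτ (dz i f)
  unfold sliceInt
  unfold sliceMeasure at hi ⊢
  rw [integral_prod _ hi]
  refine integral_eq_zero_of_ae ?_
  filter_upwards [ae_restrict_mem measurableSet_Icc] with r hr
  have hr' : r ∈ Ico 0 a := ⟨hr.1, hr.2.trans_lt hb⟩
  have hcont : ∀ f : SF a, Continuous fun g => zeroExt f.1 τ r g := fun f => by
    rw [← continuousOn_univ]
    exact (continuousOn_zeroExt f).comp (f := fun g : SU2 => ((τ, r, g) : ℝ × ℝ × SU2))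
      (by fun_prop) fun g _ => ⟨hτ, hr', mem_univ _⟩
  obtain ⟨K, hK⟩ := exists_bound_zeroExt (dz i f) hb hτ.2
  obtain ⟨K', hK'⟩ := exists_bound_zeroExt f hb hτ.2
  have key := (hasDerivAt_integral_of_dominated_loc_of_deriv_le (μ := μ) (bound := fun _ => K)
    (F := fun s g => zeroExt f.1 τ r (g * expSU2 i s)) (x₀ := 0) Filter.univ_mem
    (F' := fun s g => zeroExt (dz i f).1 τ r (g * expSU2 i s)) ?_ ?_ ?_ ?_ (integrable_const K)
    ?_).2
  · have e1 : (fun s => ∫ g, zeroExt f.1 τ r (g * expSU2 i s) ∂μ) =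
        fun _ => ∫ g, zeroExt f.1 τ r g ∂μ := by
      funext s
      exact integral_mul_right_eq_self (fun g => zeroExt f.1 τ r g) (expSU2 i s)
    have e2 := integral_mul_right_eq_self (μ := μ) (fun g => zeroExt (dz i f).1 τ r g)
      (expSU2 i 0)
    rw [e1, e2] at key
    exact key.unique (hasDerivAt_const _ _)
  · exact Filter.Eventually.of_forall fun s =>
      ((hcont f).comp (continuous_mul_const _)).aestronglyMeasurable
  · refine Integrable.of_bound ((hcont f).comp (continuous_mul_const _)).aestronglyMeasurable K' ?_
    exact Filter.Eventually.of_forall fun g => hK' τ ⟨hτ.1, le_rfl⟩ r hr _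
  · exact ((hcont (dz i f)).comp (continuous_mul_const _)).aestronglyMeasurable
  · exact Filter.Eventually.of_forall fun g s _ => hK τ ⟨hτ.1, le_rfl⟩ r hr _
  · refine Filter.Eventually.of_forall fun g s _ => ?_
    have h := hasDerivAt_zeroExt_left f i ⟨τ, r, g * expSU2 i s, hτ, hr'⟩
    rw [← zeroExt_of_mem (dz i f).1 hτ hr', ← sub_self s] at h
    have h2 := h.comp_sub_const s s
    refine h2.congr_of_eventuallyEq (Filter.Eventually.of_forall fun s' => ?_)
    simp only [mul_assoc, ← expSU2_add, add_sub_cancel]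

/-! ### Radial functions, restriction to `ρ = 0`, iterated derivatives -/

theorem lieD_conj (V : AffField) {F : Amb → ℂ} {z : Amb} (hz : z ∈ slab a) :
    lieD a V (fun y => star (F y)) z = star (lieD a V F z) := by
  have h := Complex.conjCLE.comp_fderivWithin (f := F) (uniqueDiffOn_slab z hz)
  have e : (fun y => star (F y)) = Complex.conjCLE ∘ F := rfl
  rw [lieD, e, h]
  rfl

theorem Rep.star {F : Amb → ℂ} {f : SF a} (h : Rep F f.1) :
    Rep (fun z => star (F z)) (star f).1 :=
  ⟨Complex.conjCLE.contDiff.comp_contDiffOn h.1, fun x => by simp [h.2 x]⟩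

theorem dt_star (f : SF a) : dt (star f) = star (dt f) := by
  obtain ⟨F, hF⟩ := exists_rep f
  ext x
  rw [(rep_dt hF.star).2, lieD_conj _ x.emb_mem, SF.star_apply, (rep_dt hF).2]

theorem dr_star (f : SF a) : dr (star f) = star (dr f) := by
  obtain ⟨F, hF⟩ := exists_rep f
  ext x
  rw [(rep_dr hF.star).2, lieD_conj _ x.emb_mem, SF.star_apply, (rep_dr hF).2]

theorem dz_star (i : Fin 3) (f : SF a) : dz i (star f) = star (dz i f) := by
  obtain ⟨F, hF⟩ := exists_rep f
  ext x
  rw [(rep_dz i hF.star).2, lieD_conj _ x.emb_mem, SF.star_apply, (rep_dz i hF).2]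

theorem dt_apply_eq {f : SF a} {x : Pt a} {d : ℂ} {φ : ℝ → ℂ}
    (h : HasDerivWithinAt φ d (Ici 0) x.τ)
    (e : ∀ (t : ℝ) (ht : t ∈ Ico (0 : ℝ) 1), f.1 ⟨t, x.ρ, x.g, ht, x.hρ⟩ = φ t) :
    (dt f).1 x = d := by
  have hs : Ico (0 : ℝ) 1 ⊆ Ici 0 := fun t ht => ht.1
  have h1 := (hasDerivWithinAt_zeroExt_tau f x).mono hs
  have h2 : HasDerivWithinAt (fun t => zeroExt f.1 t x.ρ x.g) d (Ico 0 1) x.τ :=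
    (h.mono hs).congr (fun t ht => (zeroExt_of_mem _ ht x.hρ x.g).trans (e t ht))
      ((zeroExt_of_mem _ x.hτ x.hρ x.g).trans (e x.τ x.hτ))
  exact (uniqueDiffOn_Ico (0 : ℝ) 1 _ x.hτ).eq_deriv _ h1 h2

theorem dr_apply_eq {f : SF a} {x : Pt a} {d : ℂ} {φ : ℝ → ℂ}
    (h : HasDerivWithinAt φ d (Ici 0) x.ρ)
    (e : ∀ (r : ℝ) (hr : r ∈ Ico (0 : ℝ) a), f.1 ⟨x.τ, r, x.g, x.hτ, hr⟩ = φ r) :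
    (dr f).1 x = d := by
  have hs : Ico (0 : ℝ) a ⊆ Ici 0 := fun t ht => ht.1
  have h1 := (hasDerivWithinAt_zeroExt_rho f x).mono hs
  have h2 : HasDerivWithinAt (fun r => zeroExt f.1 x.τ r x.g) d (Ico 0 a) x.ρ :=
    (h.mono hs).congr (fun t ht => (zeroExt_of_mem _ x.hτ ht x.g).trans (e t ht))
      ((zeroExt_of_mem _ x.hτ x.hρ x.g).trans (e x.ρ x.hρ))
  exact (uniqueDiffOn_Ico (0 : ℝ) a _ x.hρ).eq_deriv _ h1 h2

/-- A smooth real function of `(τ, ρ)` as a function on the slab. -/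
def rad (f : ℝ × ℝ → ℝ) (hf : ContDiffOn ℝ ∞ f (Ico 0 1 ×ˢ Ico 0 a)) : SF a :=
  ⟨fun x => (f (x.τ, x.ρ) : ℂ), fun z => (f (z.1, z.2.1) : ℂ), by
    refine Complex.ofRealCLM.contDiff.comp_contDiffOn
      (hf.comp (s := slab a) (g := f) (f := fun z : Amb => (z.1, z.2.1)) ?_ ?_)
    · exact (contDiff_fst.prodMk (contDiff_fst.comp contDiff_snd)).contDiffOn
    · exact fun z hz => ⟨hz.1, hz.2.1⟩, fun x => rfl⟩

@[simp] theorem rad_apply {f : ℝ × ℝ → ℝ} (hf : ContDiffOn ℝ ∞ f (Ico 0 1 ×ˢ Ico 0 a)) (x : Pt a) :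
    (rad f hf).1 x = f (x.τ, x.ρ) := rfl

theorem dz_eq_zero {f : SF a} (φ : ℝ → ℝ → ℂ) (h : ∀ x, f.1 x = φ x.τ x.ρ) (i : Fin 3) :
    dz i f = 0 := by
  ext x
  have h1 := hasDerivAt_zeroExt_left f i x
  have e : (fun s => zeroExt f.1 x.τ x.ρ (x.g * expSU2 i s)) = fun _ => φ x.τ x.ρ := by
    funext s
    rw [zeroExt_of_mem _ x.hτ x.hρ, h]
  rw [e] at h1
  exact h1.unique (hasDerivAt_const _ _)

theorem dz_rad {f : ℝ × ℝ → ℝ} (hf : ContDiffOn ℝ ∞ f (Ico 0 1 ×ˢ Ico 0 a)) (i : Fin 3) :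
    dz i (rad f hf) = 0 := dz_eq_zero (fun τ ρ => f (τ, ρ)) (fun _ => rfl) i

theorem star_rad {f : ℝ × ℝ → ℝ} (hf : ContDiffOn ℝ ∞ f (Ico 0 1 ×ˢ Ico 0 a)) :
    star (rad f hf) = rad f hf := by
  ext x
  simp

/-- The coordinate `ρ`. -/
def rho : SF a := rad (fun y => y.2) contDiff_snd.contDiffOn

/-- The function `1 - τ`. -/
def oneSubTau : SF a := rad (fun y => 1 - y.1) (contDiff_const.sub contDiff_fst).contDiffOn

@[simp] theorem rho_apply (x : Pt a) : (rho : SF a).1 x = x.ρ := rfl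
@[simp] theorem oneSubTau_apply (x : Pt a) : (oneSubTau : SF a).1 x = ((1 - x.τ : ℝ) : ℂ) := rfl

theorem dt_rad_apply {f : ℝ × ℝ → ℝ} (hf : ContDiffOn ℝ ∞ f (Ico 0 1 ×ˢ Ico 0 a)) {x : Pt a}
    {d : ℝ} (h : HasDerivWithinAt (fun t => f (t, x.ρ)) d (Ici 0) x.τ) :
    (dt (rad f hf)).1 x = d :=
  dt_apply_eq (φ := fun t => (f (t, x.ρ) : ℂ)) h.ofReal_comp fun _ _ => rfl

theorem dr_rad_apply {f : ℝ × ℝ → ℝ} (hf : ContDiffOn ℝ ∞ f (Ico 0 1 ×ˢ Ico 0 a)) {x : Pt a}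
    {d : ℝ} (h : HasDerivWithinAt (fun r => f (x.τ, r)) d (Ici 0) x.ρ) :
    (dr (rad f hf)).1 x = d :=
  dr_apply_eq (φ := fun r => (f (x.τ, r) : ℂ)) h.ofReal_comp fun _ _ => rfl

theorem dt_rho : dt (rho : SF a) = 0 := by
  ext x
  exact (dt_rad_apply _ (hasDerivWithinAt_const _ _ _)).trans (by simp)

theorem dr_rho : dr (rho : SF a) = 1 := by
  ext x
  exact (dr_rad_apply _ (hasDerivWithinAt_id _ _)).trans (by simp)

theorem dt_oneSubTau : dt (oneSubTau : SF a) = -1 := by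
  ext x
  exact (dt_rad_apply _ ((hasDerivWithinAt_id _ _).const_sub 1)).trans (by simp)

theorem dr_oneSubTau : dr (oneSubTau : SF a) = 0 := by
  ext x
  exact (dr_rad_apply _ (hasDerivWithinAt_const _ _ (1 - x.τ))).trans (by simp)

theorem star_rho : star (rho : SF a) = rho := star_rad _
theorem star_oneSubTau : star (oneSubTau : SF a) = oneSubTau := star_rad _
theorem dz_rho (i : Fin 3) : dz i (rho : SF a) = 0 := dz_rad _ i
theorem dz_oneSubTau (i : Fin 3) : dz i (oneSubTau : SF a) = 0 := dz_rad _ i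

/-- The point with the same `τ` and `ς` on `ρ = 0`. -/
def Pt.base (x : Pt a) : Pt a := ⟨x.τ, 0, x.g, x.hτ, le_rfl, x.hρ.1.trans_lt x.hρ.2⟩

/-- The projection of the ambient space onto `ρ = 0`. -/
def projBase : Amb →L[ℝ] Amb :=
  (ContinuousLinearMap.fst ℝ ℝ (ℝ × Mat2)).prod ((0 : Amb →L[ℝ] ℝ).prod
    ((ContinuousLinearMap.snd ℝ ℝ Mat2).comp (ContinuousLinearMap.snd ℝ ℝ (ℝ × Mat2))))

theorem mapsTo_projBase : MapsTo projBase (slab a) (slab a) :=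
  fun _ hz => ⟨hz.1, ⟨le_rfl, hz.2.1.1.trans_lt hz.2.1.2⟩, mem_univ _⟩

/-- The restriction of a function to `ρ = 0`, extended to the slab independently of `ρ`. -/
def Tr : SF a →ₐ[ℂ] SF a where
  toFun f := ⟨fun x => f.1 x.base, by
    obtain ⟨F, hF⟩ := exists_rep f
    exact ⟨F ∘ projBase, hF.1.comp projBase.contDiff.contDiffOn mapsTo_projBase,
      fun x => hF.2 x.base⟩⟩
  map_one' := rfl
  map_mul' _ _ := rfl
  map_zero' := rfl
  map_add' _ _ := rfl
  commutes' _ := rfl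

@[simp] theorem Tr_apply (f : SF a) (x : Pt a) : (Tr f).1 x = f.1 x.base := rfl

theorem Rep.trace {F : Amb → ℂ} {f : SF a} (h : Rep F f.1) : Rep (F ∘ projBase) (Tr f).1 :=
  ⟨h.1.comp projBase.contDiff.contDiffOn mapsTo_projBase, fun x => h.2 x.base⟩

theorem lieD_projBase (V : AffField) {F : Amb → ℂ} (hF : ContDiffOn ℝ ∞ F (slab a)) {z : Amb}
    (hz : z ∈ slab a) :
    lieD a V (F ∘ projBase) z = fderivWithin ℝ F (slab a) (projBase z) (projBase (V.val z)) := by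
  rw [lieD, fderivWithin_comp z (hF.differentiableOn (by simp) _ (mapsTo_projBase hz))
    projBase.differentiableWithinAt mapsTo_projBase (uniqueDiffOn_slab z hz),
    projBase.fderivWithin (uniqueDiffOn_slab z hz)]
  rfl

theorem Tr_dt (f : SF a) : Tr (dt f) = dt (Tr f) := by
  obtain ⟨F, hF⟩ := exists_rep f
  ext x
  rw [(rep_dt hF.trace).2, lieD_projBase _ hF.1 x.emb_mem, Tr_apply, (rep_dt hF).2, lieD, vTau_val,
    vTau_val]
  rfl

theorem Tr_dz (i : Fin 3) (f : SF a) : Tr (dz i f) = dz i (Tr f) := by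
  obtain ⟨F, hF⟩ := exists_rep f
  ext x
  rw [(rep_dz i hF.trace).2, lieD_projBase _ hF.1 x.emb_mem, Tr_apply, (rep_dz i hF).2, lieD,
    vLeft_val, vLeft_val]
  rfl

theorem dr_Tr (f : SF a) : dr (Tr f) = 0 := by
  obtain ⟨F, hF⟩ := exists_rep f
  ext x
  rw [(rep_dr hF.trace).2, lieD_projBase _ hF.1 x.emb_mem, vRho_val]
  exact map_zero _

theorem Tr_Tr (f : SF a) : Tr (Tr f) = Tr f := rfl

theorem Tr_rho : Tr (rho : SF a) = 0 := by
  ext x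
  simp [Pt.base]

/-- `∂_τ` as a linear endomorphism. -/
abbrev tL : Module.End ℂ (SF a) := (dt : Derivation ℂ (SF a) (SF a)).toLinearMap
/-- `∂_ρ` as a linear endomorphism. -/
abbrev rL : Module.End ℂ (SF a) := (dr : Derivation ℂ (SF a) (SF a)).toLinearMap
/-- `Zᵢ` as a linear endomorphism. -/
abbrev zL (i : Fin 3) : Module.End ℂ (SF a) := (dz i : Derivation ℂ (SF a) (SF a)).toLinearMap

/-- `∂_τ^q ∂_ρ^n`. -/
def DD (q n : ℕ) : Module.End ℂ (SF a) := tL ^ q * rL ^ n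

/-- The composition of the fields `Zᵢ` along a word. -/
def ZZ (w : List (Fin 3)) : Module.End ℂ (SF a) := (w.map zL).prod

theorem commute_tL_rL : Commute (tL : Module.End ℂ (SF a)) rL := LinearMap.ext dt_dr
theorem commute_tL_zL (i : Fin 3) : Commute (tL : Module.End ℂ (SF a)) (zL i) :=
  LinearMap.ext (dt_dz i)
theorem commute_rL_zL (i : Fin 3) : Commute (rL : Module.End ℂ (SF a)) (zL i) :=
  LinearMap.ext (dr_dz i)

theorem commute_ZZ {A : Module.End ℂ (SF a)} (h : ∀ i, Commute A (zL i)) (w : List (Fin 3)) :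
    Commute A (ZZ w) := by
  induction w with
  | nil => exact Commute.one_right A
  | cons i w ih =>
    rw [ZZ, List.map_cons, List.prod_cons]
    exact (h i).mul_right ih

@[simp] theorem DD_zero (f : SF a) : DD 0 0 f = f := rfl

theorem DD_dt (q n : ℕ) (f : SF a) : DD q n (dt f) = DD (q + 1) n f := by
  have h : (DD q n * tL : Module.End ℂ (SF a)) = DD (q + 1) n := by
    rw [DD, DD, mul_assoc, ← (commute_tL_rL.pow_right n).eq, ← mul_assoc, ← pow_succ]
  exact LinearMap.congr_fun h f

theorem dt_DD (q n : ℕ) (f : SF a) : dt (DD q n f) = DD (q + 1) n f := by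
  have h : (tL * DD q n : Module.End ℂ (SF a)) = DD (q + 1) n := by
    rw [DD, DD, ← mul_assoc, ← pow_succ']
  exact LinearMap.congr_fun h f

theorem DD_dr (q n : ℕ) (f : SF a) : DD q n (dr f) = DD q (n + 1) f := by
  have h : (DD q n * rL : Module.End ℂ (SF a)) = DD q (n + 1) := by
    rw [DD, DD, mul_assoc, ← pow_succ]
  exact LinearMap.congr_fun h f

theorem dr_DD (q n : ℕ) (f : SF a) : dr (DD q n f) = DD q (n + 1) f := by
  have h : (rL * DD q n : Module.End ℂ (SF a)) = DD q (n + 1) := by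
    rw [DD, DD, ← mul_assoc, ← (commute_tL_rL.pow_left q).eq, mul_assoc, ← pow_succ']
  exact LinearMap.congr_fun h f

theorem DD_split (q n : ℕ) (f : SF a) : DD q n f = DD q 0 (DD 0 n f) := by
  have h : (DD q 0 * DD 0 n : Module.End ℂ (SF a)) = DD q n := by simp [DD]
  exact (LinearMap.congr_fun h f).symm

theorem commute_DD_zL (q n : ℕ) (i : Fin 3) : Commute (DD q n : Module.End ℂ (SF a)) (zL i) :=
  ((commute_tL_zL i).pow_left q).mul_left ((commute_rL_zL i).pow_left n)

theorem DD_dz (q n : ℕ) (i : Fin 3) (f : SF a) : DD q n (dz i f) = dz i (DD q n f) :=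
  LinearMap.congr_fun (commute_DD_zL q n i).eq f

theorem DD_ZZ (q n : ℕ) (w : List (Fin 3)) (f : SF a) : DD q n (ZZ w f) = ZZ w (DD q n f) :=
  LinearMap.congr_fun (commute_ZZ (commute_DD_zL q n) w).eq f

theorem dt_ZZ (w : List (Fin 3)) (f : SF a) : dt (ZZ w f) = ZZ w (dt f) :=
  LinearMap.congr_fun (commute_ZZ commute_tL_zL w).eq f

theorem dr_ZZ (w : List (Fin 3)) (f : SF a) : dr (ZZ w f) = ZZ w (dr f) :=
  LinearMap.congr_fun (commute_ZZ commute_rL_zL w).eq f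

@[simp] theorem ZZ_nil (f : SF a) : ZZ [] f = f := rfl

theorem ZZ_cons (i : Fin 3) (w : List (Fin 3)) (f : SF a) : ZZ (i :: w) f = dz i (ZZ w f) := by
  simp [ZZ]

theorem ZZ_append (v w : List (Fin 3)) (f : SF a) : ZZ (v ++ w) f = ZZ v (ZZ w f) := by
  simp [ZZ]

theorem ZZ_dz (i : Fin 3) (w : List (Fin 3)) (f : SF a) : ZZ w (dz i f) = ZZ (w ++ [i]) f := by
  simp [ZZ]

theorem Tr_DD (q : ℕ) (f : SF a) : Tr (DD q 0 f) = DD q 0 (Tr f) := by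
  induction q with
  | zero => rfl
  | succ q ih => rw [← dt_DD, Tr_dt, ih, dt_DD]

theorem Tr_ZZ (w : List (Fin 3)) (f : SF a) : Tr (ZZ w f) = ZZ w (Tr f) := by
  induction w with
  | nil => rfl
  | cons i w ih => rw [ZZ_cons, Tr_dz, ih, ZZ_cons]

theorem DD_Tr (q n : ℕ) (f : SF a) : DD q (n + 1) (Tr f) = 0 := by
  rw [← DD_dr, dr_Tr, map_zero]

/-! ### The ring of coefficients -/

/-- All derivatives of order at most `n` in `(τ, ρ)` are bounded. -/
def BddTo : ℕ → SF a → Prop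
  | 0, c => ∃ K : ℝ, ∀ x, ‖c.1 x‖ ≤ K
  | n + 1, c => (∃ K : ℝ, ∀ x, ‖c.1 x‖ ≤ K) ∧ BddTo n (dt c) ∧ BddTo n (dr c)

theorem BddTo.bound {n : ℕ} {c : SF a} (h : BddTo n c) : ∃ K : ℝ, ∀ x, ‖c.1 x‖ ≤ K := by
  cases n with
  | zero => exact h
  | succ n => exact h.1

theorem BddTo.of_succ {n : ℕ} {c : SF a} (h : BddTo (n + 1) c) : BddTo n c := by
  induction n generalizing c with
  | zero => exact h.1
  | succ n ih => exact ⟨h.1, ih h.2.1, ih h.2.2⟩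

theorem BddTo.add {n : ℕ} {c d : SF a} (hc : BddTo n c) (hd : BddTo n d) : BddTo n (c + d) := by
  have h0 : ∃ K : ℝ, ∀ x, ‖(c + d).1 x‖ ≤ K := by
    obtain ⟨K, hK⟩ := hc.bound
    obtain ⟨L, hL⟩ := hd.bound
    exact ⟨K + L, fun x => (norm_add_le _ _).trans (add_le_add (hK x) (hL x))⟩
  induction n generalizing c d with
  | zero => exact h0
  | succ n ih =>
    refine ⟨h0, ?_, ?_⟩
    · rw [map_add]
      have := ih hc.2.1 hd.2.1
      exact this (by
        obtain ⟨K, hK⟩ := hc.2.1.bound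
        obtain ⟨L, hL⟩ := hd.2.1.bound
        exact ⟨K + L, fun x => (norm_add_le _ _).trans (add_le_add (hK x) (hL x))⟩)
    · rw [map_add]
      have := ih hc.2.2 hd.2.2
      exact this (by
        obtain ⟨K, hK⟩ := hc.2.2.bound
        obtain ⟨L, hL⟩ := hd.2.2.bound
        exact ⟨K + L, fun x => (norm_add_le _ _).trans (add_le_add (hK x) (hL x))⟩)

theorem BddTo.mul {n : ℕ} {c d : SF a} (hc : BddTo n c) (hd : BddTo n d) : BddTo n (c * d) := by
  induction n generalizing c d with
  | zero =>
    obtain ⟨K, hK⟩ := hc.bound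
    obtain ⟨L, hL⟩ := hd.bound
    exact ⟨K * L, fun x => by
      rw [SF.mul_apply, norm_mul]
      exact mul_le_mul (hK x) (hL x) (norm_nonneg _) ((norm_nonneg _).trans (hK x))⟩
  | succ n ih =>
    refine ⟨(ih hc.of_succ hd.of_succ).bound, ?_, ?_⟩
    · rw [Derivation.leibniz, smul_eq_mul, smul_eq_mul]
      exact (ih hc.of_succ hd.2.1).add (ih hd.of_succ hc.2.1)
    · rw [Derivation.leibniz, smul_eq_mul, smul_eq_mul]
      exact (ih hc.of_succ hd.2.2).add (ih hd.of_succ hc.2.2)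

theorem BddTo.zero (n : ℕ) : BddTo n (0 : SF a) := by
  induction n with
  | zero => exact ⟨0, fun x => by simp⟩
  | succ n ih => exact ⟨⟨0, fun x => by simp⟩, by rwa [map_zero], by rwa [map_zero]⟩

theorem BddTo.algebraMap (n : ℕ) (c : ℂ) : BddTo n (algebraMap ℂ (SF a) c) := by
  cases n with
  | zero => exact ⟨‖c‖, fun x => by simp⟩
  | succ n => exact ⟨⟨‖c‖, fun x => by simp⟩, by rw [Derivation.map_algebraMap]; exact .zero n,
      by rw [Derivation.map_algebraMap]; exact .zero n⟩

/-- The coefficients: functions of `(τ, ρ)` all of whose derivatives are bounded on the slab, in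
particular up to `τ = 1`. -/
def CC (a : ℝ) : Subalgebra ℂ (SF a) where
  carrier := {c | (∀ i, dz i c = 0) ∧ ∀ n, BddTo n c}
  mul_mem' := fun {c d} hc hd => ⟨fun i => by
    rw [Derivation.leibniz, hc.1, hd.1]; simp, fun n => (hc.2 n).mul (hd.2 n)⟩
  add_mem' := fun {c d} hc hd => ⟨fun i => by rw [map_add, hc.1, hd.1, add_zero],
    fun n => (hc.2 n).add (hd.2 n)⟩
  algebraMap_mem' c := ⟨fun i => Derivation.map_algebraMap _ _, fun n => .algebraMap n c⟩

theorem CC.dt_mem {c : SF a} (h : c ∈ CC a) : dt c ∈ CC a :=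
  ⟨fun i => by rw [← dt_dz, h.1, map_zero], fun n => (h.2 (n + 1)).2.1⟩

theorem CC.dr_mem {c : SF a} (h : c ∈ CC a) : dr c ∈ CC a :=
  ⟨fun i => by rw [← dr_dz, h.1, map_zero], fun n => (h.2 (n + 1)).2.2⟩

theorem CC.bound {c : SF a} (h : c ∈ CC a) : ∃ K : ℝ, 0 ≤ K ∧ ∀ x, ‖c.1 x‖ ≤ K := by
  obtain ⟨K, hK⟩ := (h.2 0).bound
  exact ⟨|K|, abs_nonneg K, fun x => (hK x).trans (le_abs_self K)⟩

/-- A bounded reciprocal of a coefficient is a coefficient. -/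
theorem CC.inv_mem {c d : SF a} (hc : c ∈ CC a) (h : c * d = 1) (hz : ∀ i, dz i d = 0)
    (hd : ∃ K : ℝ, ∀ x, ‖d.1 x‖ ≤ K) : d ∈ CC a := by
  have e : ∀ δ : Derivation ℂ (SF a) (SF a), δ d = -1 * (d * d * δ c) := fun δ => by
    have h1 : δ (c * d) = 0 := by rw [h, Derivation.map_one_eq_zero]
    rw [Derivation.leibniz, smul_eq_mul, smul_eq_mul] at h1
    linear_combination d * h1 - δ d * h
  have hm : ∀ n, BddTo n (-1 : SF a) := fun n => by
    have := BddTo.algebraMap (a := a) n (-1)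
    simpa using this
  refine ⟨hz, fun n => ?_⟩
  induction n with
  | zero => exact hd
  | succ n ih =>
    refine ⟨hd, ?_, ?_⟩
    · rw [e]
      exact (hm n).mul ((ih.mul ih).mul (hc.2 (n + 1)).2.1)
    · rw [e]
      exact (hm n).mul ((ih.mul ih).mul (hc.2 (n + 1)).2.2)

theorem oneSubTau_mem : (oneSubTau : SF a) ∈ CC a := by
  refine ⟨dz_oneSubTau, fun n => ?_⟩
  have h0 : ∃ K : ℝ, ∀ x : Pt a, ‖(oneSubTau : SF a).1 x‖ ≤ K := ⟨1, fun x => by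
    rw [oneSubTau_apply, Complex.norm_real, Real.norm_eq_abs, abs_le]
    constructor <;> linarith [x.hτ.1, x.hτ.2]⟩
  cases n with
  | zero => exact h0
  | succ n =>
    refine ⟨h0, ?_, ?_⟩
    · rw [dt_oneSubTau]
      simpa using BddTo.algebraMap (a := a) n (-1)
    · rw [dr_oneSubTau]
      exact .zero n

theorem rho_mem : (rho : SF a) ∈ CC a := by
  refine ⟨dz_rho, fun n => ?_⟩
  have h0 : ∃ K : ℝ, ∀ x : Pt a, ‖(rho : SF a).1 x‖ ≤ K := ⟨a, fun x => by
    rw [rho_apply, Complex.norm_real, Real.norm_eq_abs, abs_le]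
    constructor <;> linarith [x.hρ.1, x.hρ.2]⟩
  cases n with
  | zero => exact h0
  | succ n =>
    refine ⟨h0, ?_, ?_⟩
    · rw [dt_rho]
      exact .zero n
    · rw [dr_rho]
      simpa using BddTo.algebraMap (a := a) n 1

theorem ZZ_mul {c : SF a} (hc : ∀ i, dz i c = 0) (w : List (Fin 3)) (f : SF a) :
    ZZ w (c * f) = c * ZZ w f := by
  induction w with
  | nil => rfl
  | cons i w ih => rw [ZZ_cons, ih, Derivation.leibniz, hc, ZZ_cons]; simp

/-- A submodule over the coefficients that contains the lower derivatives of `u` contains the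
derivatives of `c u`. -/
theorem DD_mul_mem (N : Submodule (CC a) (SF a)) {q n : ℕ} {c u : SF a} (hc : c ∈ CC a)
    (h : ∀ q' ≤ q, ∀ n' ≤ n, DD q' n' u ∈ N) : DD q n (c * u) ∈ N := by
  induction q generalizing c u with
  | succ q ih =>
    rw [← DD_dt, Derivation.leibniz, map_add, smul_eq_mul, smul_eq_mul, mul_comm u]
    refine N.add_mem (ih hc fun q' hq' n' hn' => ?_) (ih (CC.dt_mem hc) fun q' hq' n' hn' => ?_)
    · rw [DD_dt]
      exact h _ (by omega) _ hn'
    · exact h _ (by omega) _ hn'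
  | zero =>
    induction n generalizing c u with
    | zero => exact N.smul_mem ⟨c, hc⟩ (h 0 le_rfl 0 le_rfl)
    | succ n ih =>
      rw [← DD_dr, Derivation.leibniz, map_add, smul_eq_mul, smul_eq_mul, mul_comm u]
      refine N.add_mem (ih hc fun q' hq' n' hn' => ?_) (ih (CC.dr_mem hc) fun q' hq' n' hn' => ?_)
      · rw [DD_dr]
        exact h _ hq' _ (by omega)
      · exact h _ hq' _ (by omega)

/-- Commuting `∂_τ^q` with a coefficient produces terms with fewer `τ`-derivatives. -/
theorem DD_mul_sub_mem_tau (N : Submodule (CC a) (SF a)) {q : ℕ} {c u : SF a} (hc : c ∈ CC a)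
    (h : ∀ q' < q, DD q' 0 u ∈ N) : DD q 0 (c * u) - c * DD q 0 u ∈ N := by
  induction q generalizing u c with
  | zero => simp
  | succ q ih =>
    have h1 := ih (c := c) (u := dt u) hc fun q' hq' => by rw [DD_dt]; exact h _ (by omega)
    have h2 := DD_mul_mem N (q := q) (n := 0) (u := u) (CC.dt_mem hc) fun q' hq' n' hn' => by
      obtain rfl : n' = 0 := by omega
      exact h _ (by omega)
    have e : DD (q + 1) 0 (c * u) - c * DD (q + 1) 0 u =
        (DD q 0 (c * dt u) - c * DD q 0 (dt u)) + DD q 0 (dt c * u) := by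
      rw [← DD_dt, Derivation.leibniz, map_add, smul_eq_mul, smul_eq_mul, mul_comm u, ← DD_dt]
      ring
    rw [e]
    exact N.add_mem h1 h2

/-- Commuting `∂_ρ^n` with a coefficient produces terms with fewer `ρ`-derivatives. -/
theorem DD_mul_eq_rho (n : ℕ) {c : SF a} (hc : c ∈ CC a) :
    ∃ k : ℕ → SF a, (∀ i, k i ∈ CC a) ∧ ∀ u : SF a,
      DD 0 n (c * u) = c * DD 0 n u + ∑ i ∈ Finset.range n, k i * DD 0 i u := by
  induction n with
  | zero => exact ⟨fun _ => 0, fun _ => zero_mem _, fun u => by simp⟩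
  | succ n ih =>
    obtain ⟨k, hk, h⟩ := ih
    refine ⟨fun i => (if i = n then dr c else 0) + (if i < n then dr (k i) else 0)
      + (if 0 < i then k (i - 1) else 0), fun i => ?_, fun u => ?_⟩
    · refine add_mem (add_mem ?_ ?_) ?_ <;> split_ifs
      exacts [CC.dr_mem hc, zero_mem _, CC.dr_mem (hk i), zero_mem _, hk _, zero_mem _]
    · rw [← dr_DD, h, map_add, map_sum, Derivation.leibniz, dr_DD, smul_eq_mul, smul_eq_mul]
      simp only [add_mul, Finset.sum_add_distrib, ite_mul, zero_mul, Derivation.leibniz, dr_DD,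
        smul_eq_mul]
      have e1 : ∑ i ∈ Finset.range (n + 1), (if i = n then dr c * DD 0 i u else 0) =
          dr c * DD 0 n u := by simp
      have e2 : ∑ i ∈ Finset.range (n + 1), (if i < n then dr (k i) * DD 0 i u else 0) =
          ∑ i ∈ Finset.range n, dr (k i) * DD 0 i u := by
        rw [Finset.sum_range_succ, if_neg (lt_irrefl n), add_zero]
        exact Finset.sum_congr rfl fun i hi => if_pos (Finset.mem_range.1 hi)
      have e3 : ∑ i ∈ Finset.range (n + 1), (if 0 < i then k (i - 1) * DD 0 i u else 0) =
          ∑ i ∈ Finset.range n, k i * DD 0 (i + 1) u := by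
        rw [Finset.sum_range_succ']
        simp
      rw [e1, e2, e3]
      have e4 : ∑ i ∈ Finset.range n, DD 0 i u * dr (k i) =
          ∑ i ∈ Finset.range n, dr (k i) * DD 0 i u := by simp only [mul_comm]
      rw [e4]
      ring

/-! ### Weighted energies on the slices -/

/-- The weight `(1 - τ)^(-l)`. -/
def wt (l τ : ℝ) : ℝ := (1 - τ) ^ (-l)

theorem wt_pos (l : ℝ) {τ : ℝ} (h : τ ∈ Ico (0 : ℝ) 1) : 0 < wt l τ :=
  Real.rpow_pos_of_pos (by linarith [h.2]) _

theorem wt_mono {l l' : ℝ} (hl : l ≤ l') {τ : ℝ} (h : τ ∈ Ico (0 : ℝ) 1) : wt l τ ≤ wt l' τ :=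
  Real.rpow_le_rpow_of_exponent_ge (by linarith [h.2]) (by linarith [h.1]) (by linarith)

theorem one_le_wt {l : ℝ} (hl : 0 ≤ l) {τ : ℝ} (h : τ ∈ Ico (0 : ℝ) 1) : 1 ≤ wt l τ := by
  have := wt_mono hl h
  rwa [wt, neg_zero, Real.rpow_zero] at this

theorem wt_add (l k : ℝ) {τ : ℝ} (h : τ ∈ Ico (0 : ℝ) 1) : wt (l + k) τ = wt l τ * wt k τ := by
  rw [wt, neg_add, Real.rpow_add (by linarith [h.2])]
  rfl

theorem one_sub_mul_wt (l : ℝ) {τ : ℝ} (h : τ ∈ Ico (0 : ℝ) 1) :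
    (1 - τ) * wt (l + 1) τ = wt l τ := by
  have : wt 1 τ = (1 - τ)⁻¹ := Real.rpow_neg_one _
  rw [wt_add l 1 h, this]
  field_simp [show (1 - τ) ≠ 0 by linarith [h.2]]

theorem continuousOn_wt (l : ℝ) : ContinuousOn (wt l) (Ico 0 1) := fun τ hτ =>
  ((continuousAt_const.sub continuousAt_id).rpow_const
    (Or.inl (by simp; linarith [hτ.2]))).continuousWithinAt

/-- A Gronwall inequality for the singular equation `(1 - τ) y' = -c y + O((1 - τ)^(-l))`. -/
theorem singular_gronwall {y : ℝ → ℝ} {c l C : ℝ} (hc : 0 < c + l) (hC : 0 ≤ C)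
    (hy : ContinuousOn y (Ico 0 1))
    (hd : ∀ τ ∈ Ioo (0 : ℝ) 1, ∃ y', HasDerivAt y y' τ ∧ (1 - τ) * y' ≤ -c * y τ + C * wt l τ) :
    ∃ C' : ℝ, 0 ≤ C' ∧ ∀ τ ∈ Ico (0 : ℝ) 1, y τ ≤ C' * wt l τ := by
  set G : ℝ → ℝ := fun τ => wt c τ * y τ - C / (c + l) * wt (c + l) τ with hG
  have hwd : ∀ k : ℝ, ∀ τ ∈ Ioo (0 : ℝ) 1, HasDerivAt (wt k) (k * wt (k + 1) τ) τ := by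
    intro k τ hτ
    have h1 : HasDerivAt (fun t : ℝ => 1 - t) (-1) τ := (hasDerivAt_id τ).const_sub 1
    have h2 := h1.rpow_const (p := -k) (Or.inl (by linarith [hτ.2]))
    exact h2.congr_deriv (by rw [wt, neg_add']; ring)
  have hanti : AntitoneOn G (Ico 0 1) := by
    refine antitoneOn_of_deriv_nonpos (convex_Ico 0 1)
      (((continuousOn_wt c).mul hy).sub (continuousOn_const.mul (continuousOn_wt _))) ?_ ?_
    · rw [interior_Ico]
      intro τ hτ
      obtain ⟨y', h1, -⟩ := hd τ hτ
      exact (((hwd c τ hτ).mul h1).sub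
        ((hwd (c + l) τ hτ).const_mul _)).differentiableAt.differentiableWithinAt
    · rw [interior_Ico]
      intro τ hτ
      have hτ' : τ ∈ Ico (0 : ℝ) 1 := ⟨hτ.1.le, hτ.2⟩
      obtain ⟨y', h1, h2⟩ := hd τ hτ
      have hGd : HasDerivAt G (c * wt (c + 1) τ * y τ + wt c τ * y' -
          C / (c + l) * ((c + l) * wt (c + l + 1) τ)) τ :=
        ((hwd c τ hτ).mul h1).sub ((hwd (c + l) τ hτ).const_mul _)
      rw [hGd.deriv]
      have e1 : wt (c + l + 1) τ = wt (c + 1) τ * wt l τ := by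
        rw [← wt_add _ _ hτ']
        congr 1
        ring
      have e2 := one_sub_mul_wt c hτ'
      have e3 : C / (c + l) * ((c + l) * wt (c + l + 1) τ) = C * (wt (c + 1) τ * wt l τ) := by
        rw [e1]
        field_simp
      rw [e3, ← e2]
      have := wt_pos (c + 1) hτ'
      nlinarith [mul_le_mul_of_nonneg_left h2 this.le]
  refine ⟨|y 0| + C / (c + l), by positivity, fun τ hτ => ?_⟩
  have h0 : (0 : ℝ) ∈ Ico (0 : ℝ) 1 := ⟨le_rfl, one_pos⟩
  have h1 := hanti h0 hτ hτ.1
  have w0 : ∀ k, wt k 0 = 1 := fun k => by simp [wt]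
  simp only [hG, w0, one_mul, mul_one] at h1
  have hK : 0 ≤ C / (c + l) := by positivity
  rw [wt_add c l hτ] at h1
  have hp := wt_pos c hτ
  have hq := wt_pos l hτ
  have hw : wt (-l) τ * wt l τ = 1 := by rw [← wt_add _ _ hτ]; simp [wt]
  have hcl : 1 ≤ wt c τ * wt l τ := by
    rw [← wt_add c l hτ]
    exact one_le_wt hc.le hτ
  have h2 : wt c τ * y τ ≤ |y 0| + C / (c + l) * (wt c τ * wt l τ) := by
    linarith [le_abs_self (y 0)]
  have h3 : wt c τ * y τ ≤ wt c τ * ((|y 0| + C / (c + l)) * wt l τ) := by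
    nlinarith [mul_le_mul_of_nonneg_left hcl (abs_nonneg (y 0))]
  exact le_of_mul_le_mul_left h3 hp

/-- A Haar measure, a width `b` and a cutoff function `χ` of `ρ e^{2τ}` that vanishes at `ρ = b`.
Its level sets are spacelike or ingoing with respect to all characteristics in question, so that
lateral boundary terms in energy estimates have a sign. -/
structure Slice (a : ℝ) where
  μ : Measure SU2
  haar : μ.IsHaarMeasure
  prob : IsProbabilityMeasure μ
  b : ℝ
  b_pos : 0 < b
  b_lt : b < a
  χ : SF a
  star_χ : star χ = χ
  dz_χ : ∀ i, dz i χ = 0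
  nonneg : ∀ x, 0 ≤ (χ.1 x).re
  le_one : ∀ x, (χ.1 x).re ≤ 1
  vanish : ∀ x, x.ρ = b → χ.1 x = 0
  dt_χ : dt χ = 2 * rho * dr χ
  dr_nonpos : ∀ x, ((dr χ).1 x).re ≤ 0

attribute [instance] Slice.haar Slice.prob

theorem re_mul_normSq (c f : SF a) (x : Pt a) :
    ((c * (f * star f)).1 x).re = (c.1 x).re * ‖f.1 x‖ ^ 2 := by
  have h : f.1 x * star (f.1 x) = ((‖f.1 x‖ ^ 2 : ℝ) : ℂ) := by
    rw [Complex.star_def, Complex.mul_conj, Complex.normSq_eq_norm_sq]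
  rw [SF.mul_apply, SF.mul_apply, SF.star_apply, h, Complex.re_mul_ofReal]

theorem re_mul_add_star (c f g : SF a) (x : Pt a) :
    ((c * (f * star g + star f * g)).1 x).re = (c.1 x).re * (2 * (f.1 x * star (g.1 x)).re) := by
  have h : f.1 x * star (g.1 x) + star (f.1 x) * g.1 x =
      ((2 * (f.1 x * star (g.1 x)).re : ℝ) : ℂ) := by
    apply Complex.ext
    · simp
      ring
    · simp
      ring
  have e : (c * (f * star g + star f * g)).1 x =
      c.1 x * (f.1 x * star (g.1 x) + star (f.1 x) * g.1 x) := rfl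
  rw [e, h, Complex.re_mul_ofReal]

theorem re_mul_star_le (z w : ℂ) : |(z * star w).re| ≤ ‖z‖ * ‖w‖ := by
  refine (Complex.abs_re_le_norm _).trans ?_
  rw [norm_mul, norm_star]

theorem im_eq_zero_of_star {c : SF a} (h : star c = c) (x : Pt a) : (c.1 x).im = 0 := by
  have h1 : star (c.1 x) = c.1 x := congrFun (congrArg Subtype.val h) x
  exact Complex.conj_eq_iff_im.1 h1

theorem re_mul_of_star {c d : SF a} (h : star c = c) (x : Pt a) :
    ((c * d).1 x).re = (c.1 x).re * (d.1 x).re := by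
  rw [SF.mul_apply, Complex.mul_re, im_eq_zero_of_star h]
  ring

theorem re_weight {χ : SF a} (h : star χ = χ) (c f : SF a) (x : Pt a) :
    ((χ * (c * (f * star f))).1 x).re = (χ.1 x).re * ((c.1 x).re * ‖f.1 x‖ ^ 2) := by
  rw [re_mul_of_star h, re_mul_normSq]

@[simp] theorem two_apply (x : Pt a) : (2 : SF a).1 x = 2 := rfl

theorem apply_eq_Tr {x : Pt a} (hx : x.ρ = 0) (f : SF a) : f.1 x = (Tr f).1 x := by
  have : x = x.base := Pt.ext rfl hx rfl
  rw [Tr_apply, ← this]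

namespace Slice

variable (s : Slice a)

/-- The real part of the integral over a slice. -/
def I (τ : ℝ) (f : SF a) : ℝ := (sliceInt s.μ s.b τ f).re

/-- The squared norm `∫ χ |f|²` on a slice. -/
def NN (τ : ℝ) (f : SF a) : ℝ := s.I τ (s.χ * (f * star f))

variable {s} {τ : ℝ}

theorem I_add (hτ : τ ∈ Ico (0 : ℝ) 1) (f g : SF a) : s.I τ (f + g) = s.I τ f + s.I τ g := by
  rw [I, sliceInt_add _ s.b_lt hτ]
  rfl

theorem I_smul (hτ : τ ∈ Ico (0 : ℝ) 1) (r : ℝ) (f : SF a) :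
    s.I τ ((r : ℂ) • f) = r * s.I τ f := by
  rw [I, sliceInt_smul _ s.b_lt hτ, Complex.re_ofReal_mul]
  rfl

theorem I_mono (hτ : τ ∈ Ico (0 : ℝ) 1) {f g : SF a}
    (h : ∀ x : Pt a, x.τ = τ → x.ρ ≤ s.b → (f.1 x).re ≤ (g.1 x).re) : s.I τ f ≤ s.I τ g :=
  sliceInt_re_mono _ s.b_lt hτ h

theorem I_zero (hτ : τ ∈ Ico (0 : ℝ) 1) : s.I τ 0 = 0 := by
  have := I_smul (s := s) hτ 0 0
  simpa using this

theorem I_nonneg (hτ : τ ∈ Ico (0 : ℝ) 1) {f : SF a}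
    (h : ∀ x : Pt a, x.τ = τ → x.ρ ≤ s.b → 0 ≤ (f.1 x).re) : 0 ≤ s.I τ f := by
  rw [← I_zero (s := s) hτ]
  exact I_mono hτ h

theorem hasDerivAt_I (hτ : τ ∈ Ioo (0 : ℝ) 1) (f : SF a) :
    HasDerivAt (fun t => s.I t f) (s.I τ (dt f)) τ :=
  Complex.reCLM.hasFDerivAt.comp_hasDerivAt τ (hasDerivAt_sliceInt s.μ s.b_lt hτ f)

theorem continuousOn_I (f : SF a) : ContinuousOn (fun t => s.I t f) (Ico 0 1) :=
  Complex.continuous_re.comp_continuousOn (continuousOn_sliceInt _ s.b_lt f)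

theorem I_dr (hτ : τ ∈ Ico (0 : ℝ) 1) {f : SF a} (h0 : ∀ x : Pt a, x.ρ = 0 → f.1 x = 0) :
    s.I τ (dr (s.χ * f)) = 0 := by
  rw [I, sliceInt_dr _ s.b_pos.le s.b_lt hτ]
  · rfl
  · intro x hx
    rw [SF.mul_apply, h0 x hx, mul_zero]
  · intro x hx
    rw [SF.mul_apply, s.vanish x hx, zero_mul]

theorem NN_nonneg (hτ : τ ∈ Ico (0 : ℝ) 1) (f : SF a) : 0 ≤ s.NN τ f :=
  I_nonneg hτ fun x _ _ => by
    rw [re_mul_normSq]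
    exact mul_nonneg (s.nonneg x) (sq_nonneg _)

theorem NN_zero (hτ : τ ∈ Ico (0 : ℝ) 1) : s.NN τ 0 = 0 := by
  rw [NN]
  simp [I_zero hτ]

/-- If `|f|² ≤ K |g|²` pointwise, then the norms satisfy the same inequality. -/
theorem NN_le_of_le (hτ : τ ∈ Ico (0 : ℝ) 1) {f g : SF a} {K : ℝ}
    (h : ∀ x : Pt a, x.τ = τ → ‖f.1 x‖ ^ 2 ≤ K * ‖g.1 x‖ ^ 2) : s.NN τ f ≤ K * s.NN τ g := by
  rw [NN, NN, ← I_smul hτ]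
  refine I_mono hτ fun x hx _ => ?_
  rw [SF.smul_apply, Complex.re_ofReal_mul, re_mul_normSq, re_mul_normSq]
  nlinarith [mul_le_mul_of_nonneg_left (h x hx) (s.nonneg x)]

theorem NN_add_le (hτ : τ ∈ Ico (0 : ℝ) 1) (f g : SF a) :
    s.NN τ (f + g) ≤ 2 * s.NN τ f + 2 * s.NN τ g := by
  rw [NN, NN, NN, ← I_smul hτ, ← I_smul hτ, ← I_add hτ]
  refine I_mono hτ fun x hx _ => ?_
  rw [SF.add_apply, Complex.add_re, SF.smul_apply, SF.smul_apply, Complex.re_ofReal_mul,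
    Complex.re_ofReal_mul, re_mul_normSq, re_mul_normSq, re_mul_normSq, SF.add_apply]
  have h := norm_add_le (f.1 x) (g.1 x)
  have h2 : ‖f.1 x + g.1 x‖ ^ 2 ≤ 2 * ‖f.1 x‖ ^ 2 + 2 * ‖g.1 x‖ ^ 2 := by
    nlinarith [norm_nonneg (f.1 x + g.1 x), sq_nonneg (‖f.1 x‖ - ‖g.1 x‖)]
  nlinarith [mul_le_mul_of_nonneg_left h2 (s.nonneg x)]

theorem NN_mul_le (hτ : τ ∈ Ico (0 : ℝ) 1) {c f : SF a} {K : ℝ} (hK : ∀ x, ‖c.1 x‖ ≤ K) :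
    s.NN τ (c * f) ≤ K ^ 2 * s.NN τ f :=
  NN_le_of_le hτ fun x _ => by
    rw [SF.mul_apply, norm_mul, mul_pow]
    have := hK x
    gcongr

variable (s) in
/-- The functions `u` with `∫ χ |u|² ≤ C (1 - τ)^(-l)`. -/
def Bd (l : ℝ) : Submodule (CC a) (SF a) where
  carrier := {u | ∃ C : ℝ, ∀ τ ∈ Ico (0 : ℝ) 1, s.NN τ u ≤ C * wt l τ}
  zero_mem' := ⟨0, fun τ hτ => by simp [NN_zero hτ]⟩
  add_mem' := by
    rintro u v ⟨C, hC⟩ ⟨C', hC'⟩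
    exact ⟨2 * C + 2 * C', fun τ hτ => by
      have := NN_add_le (s := s) hτ u v
      linarith [hC τ hτ, hC' τ hτ]⟩
  smul_mem' := by
    rintro ⟨c, hc⟩ u ⟨C, hC⟩
    obtain ⟨K, -, hK⟩ := CC.bound hc
    exact ⟨K ^ 2 * C, fun τ hτ => by
      refine (NN_mul_le (s := s) hτ hK).trans ?_
      rw [mul_assoc]
      exact mul_le_mul_of_nonneg_left (hC τ hτ) (sq_nonneg K)⟩

theorem Bd.exists_nonneg {l : ℝ} {u : SF a} (h : u ∈ s.Bd l) :
    ∃ C : ℝ, 0 ≤ C ∧ ∀ τ ∈ Ico (0 : ℝ) 1, s.NN τ u ≤ C * wt l τ := by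
  obtain ⟨C, hC⟩ := h
  exact ⟨|C|, abs_nonneg C, fun τ hτ => (hC τ hτ).trans
    (mul_le_mul_of_nonneg_right (le_abs_self C) (wt_pos l hτ).le)⟩

theorem Bd_mono {l l' : ℝ} (h : l ≤ l') : s.Bd l ≤ s.Bd l' := by
  intro u hu
  obtain ⟨C, h0, hC⟩ := Bd.exists_nonneg hu
  exact ⟨C, fun τ hτ => (hC τ hτ).trans (mul_le_mul_of_nonneg_left (wt_mono h hτ) h0)⟩

theorem _root_.FGauge.mul_mem_of_CC {N : Submodule (CC a) (SF a)} {c u : SF a} (hc : c ∈ CC a)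
    (hu : u ∈ N) : c * u ∈ N := N.smul_mem ⟨c, hc⟩ hu

theorem smul_mem_Bd {N : Submodule (CC a) (SF a)} {u : SF a} (c : ℂ) (hu : u ∈ N) :
    c • u ∈ N := by
  have : c • u = algebraMap ℂ (SF a) c * u := Algebra.smul_def c u
  rw [this]
  exact mul_mem_of_CC (Subalgebra.algebraMap_mem _ _) hu

/-- Hardy's inequality: a function that vanishes at `ρ = 0` is controlled by its `ρ`-derivative,
with a small constant if the slice is short. -/
theorem hardy (hτ : τ ∈ Ico (0 : ℝ) 1) {v : SF a} (h : Tr v = 0) :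
    s.NN τ v ≤ 4 * s.b ^ 2 * s.NN τ (dr v) := by
  set k : SF a := algebraMap ℂ (SF a) (s.b : ℂ) - rho with hk
  have h0 : s.I τ (dr (s.χ * (k * (v * star v)))) = 0 := I_dr hτ fun x hx => by
    have hv : v.1 x = 0 := by rw [apply_eq_Tr hx, h]; rfl
    simp [hv]
  have hdk : dr k = -1 := by
    rw [hk, map_sub, Derivation.map_algebraMap, dr_rho, zero_sub]
  have hsk : star k = k := by
    rw [hk, star_sub, star_rho]
    congr 1
    ext x
    simp
  have e : dr (s.χ * (k * (v * star v))) = dr s.χ * (k * (v * star v)) + -(s.χ * (v * star v)) +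
      s.χ * k * (dr v * star v + star (dr v) * v) := by
    simp only [Derivation.leibniz, smul_eq_mul, dr_star, hdk]
    ring
  have key : s.I τ (dr (s.χ * (k * (v * star v)))) ≤
      s.I τ (((-(1 / 2) : ℝ) : ℂ) • (s.χ * (v * star v)) +
        ((2 * s.b ^ 2 : ℝ) : ℂ) • (s.χ * (dr v * star (dr v)))) := by
    refine I_mono hτ fun x _ hxb => ?_
    have hkx : (k.1 x).re = s.b - x.ρ := by simp [hk]
    have hk0 : 0 ≤ s.b - x.ρ := by linarith
    have hkb : s.b - x.ρ ≤ s.b := by linarith [x.hρ.1]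
    have h1 : ((dr s.χ * (k * (v * star v))).1 x).re ≤ 0 := by
      rw [re_mul_of_star (by rw [← dr_star, s.star_χ]), re_mul_normSq, hkx]
      exact mul_nonpos_of_nonpos_of_nonneg (s.dr_nonpos x) (by positivity)
    have h2 : ((s.χ * k * (dr v * star v + star (dr v) * v)).1 x).re ≤
        (s.χ.1 x).re * (1 / 2 * ‖v.1 x‖ ^ 2 + 2 * s.b ^ 2 * ‖(dr v).1 x‖ ^ 2) := by
      rw [re_mul_add_star, re_mul_of_star s.star_χ, hkx, mul_assoc]
      refine mul_le_mul_of_nonneg_left ?_ (s.nonneg x)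
      have h3 := (le_abs_self _).trans (re_mul_star_le ((dr v).1 x) (v.1 x))
      have h4 : 0 ≤ ‖(dr v).1 x‖ * ‖v.1 x‖ := by positivity
      have h5 : (s.b - x.ρ) * (2 * ((dr v).1 x * star (v.1 x)).re) ≤
          s.b * (2 * (‖(dr v).1 x‖ * ‖v.1 x‖)) := by nlinarith [s.b_pos]
      nlinarith [sq_nonneg (‖v.1 x‖ - 2 * s.b * ‖(dr v).1 x‖)]
    have e1 := re_mul_normSq s.χ v x
    have e2 := re_mul_normSq s.χ (dr v) x
    rw [e, SF.add_apply, SF.add_apply, Complex.add_re, Complex.add_re, SF.neg_apply,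
      Complex.neg_re, SF.add_apply, SF.smul_apply, SF.smul_apply, Complex.add_re,
      Complex.re_ofReal_mul, Complex.re_ofReal_mul, e1, e2]
    linarith
  rw [h0, I_add hτ, I_smul hτ, I_smul hτ] at key
  simp only [NN]
  linarith

theorem NN_Tr_le (hτ : τ ∈ Ico (0 : ℝ) 1) (u : SF a) :
    s.NN τ (Tr u) ≤ 2 * s.NN τ u + 8 * s.b ^ 2 * s.NN τ (dr u) := by
  have h1 := NN_add_le (s := s) hτ u (-(u - Tr u))
  have h2 := hardy (s := s) hτ (v := u - Tr u) (by rw [map_sub, Tr_Tr, sub_self])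
  have e : u + -(u - Tr u) = Tr u := by ring
  have e2 : s.NN τ (-(u - Tr u)) = s.NN τ (u - Tr u) := by
    have : s.χ * (-(u - Tr u) * star (-(u - Tr u))) = s.χ * ((u - Tr u) * star (u - Tr u)) := by
      rw [star_neg]
      ring
    rw [NN, this, NN]
  rw [map_sub, dr_Tr, sub_zero] at h2
  rw [e, e2] at h1
  linarith

theorem Tr_mem_Bd {l : ℝ} {u : SF a} (h : u ∈ s.Bd l) (h' : dr u ∈ s.Bd l) : Tr u ∈ s.Bd l := by
  obtain ⟨C, hC⟩ := h
  obtain ⟨C', hC'⟩ := h'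
  refine ⟨2 * C + 8 * s.b ^ 2 * C', fun τ hτ => (NN_Tr_le hτ u).trans ?_⟩
  nlinarith [hC τ hτ, mul_le_mul_of_nonneg_left (hC' τ hτ) (by positivity : 0 ≤ 8 * s.b ^ 2)]

/-- The energy inequality for a transport equation `θ ∂_τ u = ϖ ∂_ρ u + f`. -/
theorem energy {θ ϖ u f : SF a} (hτ : τ ∈ Ioo (0 : ℝ) 1) (hθ : star θ = θ) (hϖ : star ϖ = ϖ)
    (h0 : ∀ x : Pt a, x.ρ = 0 → ϖ.1 x = 0) (heq : θ * dt u = ϖ * dr u + f)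
    (hsign : ∀ x : Pt a, x.ρ ≤ s.b → 0 ≤ ((2 * rho * θ - ϖ).1 x).re) :
    s.I τ (dt (s.χ * (θ * (u * star u)))) ≤
      s.I τ (s.χ * ((dt θ - dr ϖ) * (u * star u)) + s.χ * (f * star u + star f * u)) := by
  have hτ' : τ ∈ Ico (0 : ℝ) 1 := ⟨hτ.1.le, hτ.2⟩
  have heq' : θ * star (dt u) = ϖ * star (dr u) + star f := by
    have := congrArg star heq
    rw [star_mul', star_add, star_mul', hθ, hϖ] at this
    exact this
  have e : dt (s.χ * (θ * (u * star u))) = dr (s.χ * (ϖ * (u * star u))) +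
      (dr s.χ * ((2 * rho * θ - ϖ) * (u * star u)) +
      (s.χ * ((dt θ - dr ϖ) * (u * star u)) + s.χ * (f * star u + star f * u))) := by
    simp only [Derivation.leibniz, smul_eq_mul, dr_star, dt_star, s.dt_χ]
    linear_combination s.χ * star u * heq + s.χ * u * heq'
  rw [e, I_add hτ', I_dr hτ' fun x hx => by rw [SF.mul_apply, h0 x hx, zero_mul], zero_add,
    I_add hτ']
  have h1 : s.I τ (dr s.χ * ((2 * rho * θ - ϖ) * (u * star u))) ≤ 0 := by
    rw [← I_zero (s := s) hτ']
    refine I_mono hτ' fun x _ hx => ?_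
    rw [re_mul_of_star (by rw [← dr_star, s.star_χ]), re_mul_normSq]
    exact mul_nonpos_of_nonpos_of_nonneg (s.dr_nonpos x)
      (mul_nonneg (hsign x hx) (sq_nonneg _))
  linarith

/-- Along `∂_τ u = p ∂_ρ u + k u + f`, where `p`, `k` are regular up to `τ = 1`, one power of
`1 - τ` is gained from `f` to `u`. -/
theorem transport_regular {l : ℝ} (hl : 0 < l) {p k u f : SF a} (hp : p ∈ CC a) (hk : k ∈ CC a)
    (hps : star p = p) (h0 : Tr p = 0)
    (hsign : ∀ x : Pt a, x.ρ ≤ s.b → (p.1 x).re ≤ 2 * x.ρ)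
    (heq : dt u = p * dr u + k * u + f) (hf : f ∈ s.Bd (l + 1)) : u ∈ s.Bd l := by
  obtain ⟨C, hC0, hC⟩ := Bd.exists_nonneg hf
  obtain ⟨K1, hK1, hK1'⟩ := CC.bound (CC.dr_mem hp)
  obtain ⟨K2, hK2, hK2'⟩ := CC.bound hk
  set K := K1 + 2 * K2 + 1 with hK
  have hE : ∀ τ ∈ Ioo (0 : ℝ) 1, s.I τ (dt (s.χ * (u * star u))) ≤ K * s.NN τ u + s.NN τ f := by
    intro τ hτ
    have hτ' : τ ∈ Ico (0 : ℝ) 1 := ⟨hτ.1.le, hτ.2⟩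
    have h1 := energy (s := s) (θ := 1) (ϖ := p) (u := u) (f := k * u + f) hτ (star_one _) hps
      (fun x hx => by rw [apply_eq_Tr hx, h0]; rfl) (by rw [one_mul, heq]; ring)
      (fun x hx => by
        have := hsign x hx
        simp
        linarith)
    rw [one_mul] at h1
    refine h1.trans ?_
    rw [NN, NN, ← I_smul hτ', ← I_add hτ']
    refine I_mono hτ' fun x _ _ => ?_
    have e : s.χ * ((k * u + f) * star u + star (k * u + f) * u) =
        s.χ * ((k + star k) * (u * star u)) + s.χ * (f * star u + star f * u) := by
      rw [star_add, star_mul']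
      ring
    rw [e, SF.add_apply, SF.add_apply, SF.add_apply, Complex.add_re, Complex.add_re,
      Complex.add_re, re_weight s.star_χ, re_weight s.star_χ, re_mul_add_star, SF.smul_apply,
      Complex.re_ofReal_mul, re_mul_normSq, re_mul_normSq, Derivation.map_one_eq_zero]
    have b1 : ((0 - dr p : SF a).1 x).re ≤ K1 := by
      have h2 := (Complex.abs_re_le_norm ((dr p).1 x)).trans (hK1' x)
      have h3 := neg_abs_le ((dr p).1 x).re
      simp
      linarith
    have b2 : ((k + star k).1 x).re ≤ 2 * K2 := by
      have h2 := (le_abs_self _).trans ((Complex.abs_re_le_norm (k.1 x)).trans (hK2' x))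
      simp
      linarith
    have b3 := (le_abs_self _).trans (re_mul_star_le (f.1 x) (u.1 x))
    have hχ := s.nonneg x
    have b4 : ((0 - dr p : SF a).1 x).re * ‖u.1 x‖ ^ 2 + ((k + star k).1 x).re * ‖u.1 x‖ ^ 2 +
        2 * (f.1 x * star (u.1 x)).re ≤ K * ‖u.1 x‖ ^ 2 + ‖f.1 x‖ ^ 2 := by
      have := sq_nonneg ‖u.1 x‖
      nlinarith [sq_nonneg (‖f.1 x‖ - ‖u.1 x‖)]
    nlinarith [mul_le_mul_of_nonneg_left b4 hχ]
  obtain ⟨C', hC0', hC'⟩ := singular_gronwall (y := fun τ => Real.exp (-K * τ) * s.NN τ u) (c := 0)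
    (l := l) (C := C) (by linarith) hC0
    ((by fun_prop : Continuous fun τ => Real.exp (-K * τ)).continuousOn.mul (continuousOn_I _))
    (fun τ hτ => by
      have hτ' : τ ∈ Ico (0 : ℝ) 1 := ⟨hτ.1.le, hτ.2⟩
      have h1 : HasDerivAt (fun τ => Real.exp (-K * τ)) (Real.exp (-K * τ) * (-K)) τ := by
        have := ((hasDerivAt_id τ).const_mul (-K)).exp
        simpa using this
      refine ⟨_, h1.mul (hasDerivAt_I hτ _), ?_⟩
      have hK0 : 0 ≤ K := by positivity
      have hexp : Real.exp (-K * τ) ≤ 1 := by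
        rw [Real.exp_le_one_iff]
        nlinarith [hτ.1]
      have hexp0 := Real.exp_pos (-K * τ)
      have h2 := hE τ hτ
      have h3 := hC τ hτ'
      have h4 : Real.exp (-K * τ) * (-K) * s.NN τ u +
          Real.exp (-K * τ) * s.I τ (dt (s.χ * (u * star u))) ≤ C * wt (l + 1) τ := by
        have h5 : Real.exp (-K * τ) * (s.I τ (dt (s.χ * (u * star u))) - K * s.NN τ u) ≤
            Real.exp (-K * τ) * (C * wt (l + 1) τ) :=
          mul_le_mul_of_nonneg_left (by linarith) hexp0.le
        have h6 : Real.exp (-K * τ) * (C * wt (l + 1) τ) ≤ 1 * (C * wt (l + 1) τ) :=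
          mul_le_mul_of_nonneg_right hexp (mul_nonneg hC0 (wt_pos _ hτ').le)
        linarith
      have h7 := mul_le_mul_of_nonneg_left h4 (by linarith [hτ.2] : 0 ≤ 1 - τ)
      rw [← one_sub_mul_wt l hτ']
      simp only [NN] at h7 ⊢
      linarith)
  refine ⟨Real.exp K * C', fun τ hτ => ?_⟩
  have h1 := hC' τ hτ
  have hK0 : 0 ≤ K := by positivity
  have h2 : s.NN τ u = Real.exp (K * τ) * (Real.exp (-K * τ) * s.NN τ u) := by
    rw [← mul_assoc, ← Real.exp_add]
    simp
  rw [h2]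
  have h3 : Real.exp (K * τ) ≤ Real.exp K := Real.exp_le_exp.2 (by nlinarith [hτ.2])
  have h4 := NN_nonneg (s := s) hτ u
  calc _ ≤ Real.exp K * (Real.exp (-K * τ) * s.NN τ u) := by gcongr
    _ ≤ Real.exp K * (C' * wt l τ) := by gcongr
    _ = _ := by ring

/-- The singular transport equation `(1 - τ) ∂_τ u = -p ∂_ρ u + k u + f + g`: if `k` is sufficiently
negative, `u` is as singular as `f`; the term `g` is small with respect to `u`. -/
theorem transport_singular {l : ℝ} (hl : 0 ≤ l) {p k u f g : SF a}
    (hps : star p = p) (h0 : Tr p = 0)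
    (hsign : ∀ x : Pt a, x.ρ ≤ s.b → 0 ≤ (p.1 x).re)
    (hk : ∀ x : Pt a, x.ρ ≤ s.b → ((dr p).1 x).re + 2 * (k.1 x).re ≤ -(5 / 2))
    (heq : oneSubTau * dt u = -p * dr u + k * u + (f + g)) (hf : f ∈ s.Bd l)
    (hg : ∀ τ ∈ Ico (0 : ℝ) 1, s.NN τ g ≤ 1 / 4 * s.NN τ u) : u ∈ s.Bd l := by
  obtain ⟨C, hC0, hC⟩ := Bd.exists_nonneg hf
  have hE : ∀ τ ∈ Ioo (0 : ℝ) 1, s.I τ (dt (s.χ * (oneSubTau * (u * star u)))) ≤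
      -2 * s.NN τ u + 2 * s.NN τ f := by
    intro τ hτ
    have hτ' : τ ∈ Ico (0 : ℝ) 1 := ⟨hτ.1.le, hτ.2⟩
    have h1 := energy (s := s) (θ := oneSubTau) (ϖ := -p) (u := u) (f := k * u + (f + g)) hτ
      star_oneSubTau (by rw [star_neg, hps])
      (fun x hx => by rw [SF.neg_apply, apply_eq_Tr hx, h0]; simp) (by rw [heq]; ring)
      (fun x hx => by
        have := hsign x hx
        have h2 : 0 ≤ x.ρ * (1 - x.τ) := mul_nonneg x.hρ.1 (by linarith [x.hτ.2])
        have h3 : ((2 * rho * oneSubTau - -p : SF a).1 x) =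
            ((2 * (x.ρ * (1 - x.τ)) : ℝ) : ℂ) + p.1 x := by
          simp
          ring
        rw [h3, Complex.add_re, Complex.ofReal_re]
        linarith)
    refine h1.trans ?_
    have h2 : s.I τ (s.χ * ((dt oneSubTau - dr (-p)) * (u * star u)) +
        s.χ * ((k * u + (f + g)) * star u + star (k * u + (f + g)) * u)) ≤
        s.I τ (((-(5 / 2) : ℝ) : ℂ) • (s.χ * (u * star u)) +
          (((2 : ℝ) : ℂ) • (s.χ * (f * star f)) + ((2 : ℝ) : ℂ) • (s.χ * (g * star g)))) := by
      refine I_mono hτ' fun x _ hx => ?_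
      have e : s.χ * ((k * u + (f + g)) * star u + star (k * u + (f + g)) * u) =
          s.χ * ((k + star k) * (u * star u)) + (s.χ * (f * star u + star f * u) +
            s.χ * (g * star u + star g * u)) := by
        rw [star_add, star_mul', star_add]
        ring
      rw [e]
      simp only [SF.add_apply, Complex.add_re, SF.smul_apply, Complex.re_ofReal_mul]
      rw [re_weight s.star_χ, re_weight s.star_χ, re_mul_add_star, re_mul_add_star,
        re_mul_normSq, re_mul_normSq, re_mul_normSq, dt_oneSubTau, map_neg]
      have b1 : ((-1 - -dr p : SF a).1 x).re + ((k + star k).1 x).re ≤ -(5 / 2) - 1 := by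
        have := hk x hx
        simp
        linarith
      have b3 := (le_abs_self _).trans (re_mul_star_le (f.1 x) (u.1 x))
      have b4 := (le_abs_self _).trans (re_mul_star_le (g.1 x) (u.1 x))
      have hχ := s.nonneg x
      have b5 : (((-1 - -dr p : SF a).1 x).re + ((k + star k).1 x).re) * ‖u.1 x‖ ^ 2 +
          2 * (f.1 x * star (u.1 x)).re + 2 * (g.1 x * star (u.1 x)).re ≤
          -(5 / 2) * ‖u.1 x‖ ^ 2 + 2 * ‖f.1 x‖ ^ 2 + 2 * ‖g.1 x‖ ^ 2 := by
        have := mul_le_mul_of_nonneg_right b1 (sq_nonneg ‖u.1 x‖)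
        nlinarith [sq_nonneg (2 * ‖f.1 x‖ - ‖u.1 x‖), sq_nonneg (2 * ‖g.1 x‖ - ‖u.1 x‖)]
      nlinarith [mul_le_mul_of_nonneg_left b5 hχ]
    refine h2.trans ?_
    rw [I_add hτ', I_add hτ', I_smul hτ', I_smul hτ', I_smul hτ']
    have := hg τ hτ'
    simp only [NN] at this ⊢
    linarith
  have hEq : ∀ τ ∈ Ico (0 : ℝ) 1,
      s.I τ (s.χ * (oneSubTau * (u * star u))) = (1 - τ) * s.NN τ u := by
    intro τ hτ
    rw [NN, ← I_smul hτ]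
    refine le_antisymm (I_mono hτ fun x hx _ => ?_) (I_mono hτ fun x hx _ => ?_)
    all_goals
      rw [re_weight s.star_χ, SF.smul_apply, Complex.re_ofReal_mul, re_mul_normSq,
        oneSubTau_apply, hx, Complex.ofReal_re]
      linarith
  obtain ⟨C', hC0', hC'⟩ := singular_gronwall
    (y := fun τ => s.I τ (s.χ * (oneSubTau * (u * star u)))) (c := 2)
    (l := l - 1) (C := 2 * C) (by linarith) (by linarith) (continuousOn_I _)
    (fun τ hτ => by
      have hτ' : τ ∈ Ico (0 : ℝ) 1 := ⟨hτ.1.le, hτ.2⟩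
      refine ⟨_, hasDerivAt_I hτ _, ?_⟩
      rw [hEq τ hτ', ← one_sub_mul_wt (l - 1) hτ', sub_add_cancel]
      have h1 := hE τ hτ
      have h2 := hC τ hτ'
      have h3 : 0 ≤ 1 - τ := by linarith [hτ.2]
      nlinarith [mul_le_mul_of_nonneg_left h1 h3, mul_le_mul_of_nonneg_left h2 h3])
  refine ⟨C', fun τ hτ => ?_⟩
  have h1 := hC' τ hτ
  rw [hEq τ hτ, ← one_sub_mul_wt (l - 1) hτ, sub_add_cancel] at h1
  have h3 : 0 < 1 - τ := by linarith [hτ.2]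
  refine le_of_mul_le_mul_left ?_ h3
  linarith

end Slice

/-! ### The Casimir operator and angular regularity -/

/-- `X₊` on the smooth functions. -/
def Xp : Module.End ℂ (SF a) where
  toFun f := -dz 1 f - Complex.I • dz 0 f
  map_add' f g := by
    simp only [map_add, smul_add]
    ring
  map_smul' c f := by
    rw [Derivation.map_smul, Derivation.map_smul, RingHom.id_apply]
    simp only [Algebra.smul_def]
    ring

/-- `X₋` on the smooth functions. -/
def Xm : Module.End ℂ (SF a) where
  toFun f := -dz 1 f + Complex.I • dz 0 f
  map_add' f g := by
    simp only [map_add, smul_add]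
    ring
  map_smul' c f := by
    rw [Derivation.map_smul, Derivation.map_smul, RingHom.id_apply]
    simp only [Algebra.smul_def]
    ring

theorem Xp_eq (f : SF a) : Xp f = -dz 1 f - Complex.I • dz 0 f := rfl
theorem Xm_eq (f : SF a) : Xm f = -dz 1 f + Complex.I • dz 0 f := rfl

/-- The Casimir operator `Z₁² + Z₂² + Z₃²`. -/
def Cas : Module.End ℂ (SF a) := ∑ i, zL i * zL i

theorem Cas_eq (f : SF a) : Cas f = dz 0 (dz 0 f) + dz 1 (dz 1 f) + dz 2 (dz 2 f) := by
  rw [Cas, Fin.sum_univ_three]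
  rfl

theorem derivation_comm_casimir {A B C : Derivation ℂ (SF a) (SF a)}
    (h1 : ∀ f, A (B f) - B (A f) = C f) (h2 : ∀ f, C (A f) - A (C f) = B f) (f : SF a) :
    A (A (A f) + B (B f) + C (C f)) = A (A (A f)) + B (B (A f)) + C (C (A f)) := by
  have e1 := h1 (B f)
  have e2 := congrArg B (h1 f)
  have e3 := h2 (C f)
  have e4 := congrArg C (h2 f)
  simp only [map_sub, map_add] at e1 e2 e3 e4 ⊢
  linear_combination e1 + e2 - e3 - e4

theorem Cas_dz (i : Fin 3) (f : SF a) : Cas (dz i f) = dz i (Cas f) := by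
  have h0 := fun f : SF a => dz_bracket 0 f
  have h1 := fun f : SF a => dz_bracket 1 f
  have h2 := fun f : SF a => dz_bracket 2 f
  simp only [zero_add, Fin.reduceAdd, Fin.isValue] at h0 h1 h2
  rw [Cas_eq, Cas_eq]
  match i with
  | 0 => exact (derivation_comm_casimir h0 h2 f).symm
  | 1 =>
    have := derivation_comm_casimir h1 h0 f
    rw [show dz 0 (dz 0 f) + dz 1 (dz 1 f) + dz 2 (dz 2 f) =
      dz 1 (dz 1 f) + dz 2 (dz 2 f) + dz 0 (dz 0 f) by ring, this]
    ring
  | 2 =>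
    have := derivation_comm_casimir h2 h1 f
    rw [show dz 0 (dz 0 f) + dz 1 (dz 1 f) + dz 2 (dz 2 f) =
      dz 2 (dz 2 f) + dz 0 (dz 0 f) + dz 1 (dz 1 f) by ring, this]
    ring

theorem Cas_Xp (f : SF a) : Cas (Xp f) = Xp (Cas f) := by
  simp only [Xp_eq, map_sub, map_neg, map_smul, Cas_dz]

theorem Cas_Xm (f : SF a) : Cas (Xm f) = Xm (Cas f) := by
  simp only [Xm_eq, map_add, map_neg, map_smul, Cas_dz]

theorem Cas_dt (f : SF a) : Cas (dt f) = dt (Cas f) := by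
  simp only [Cas_eq, map_add, dt_dz]

theorem Cas_dr (f : SF a) : Cas (dr f) = dr (Cas f) := by
  simp only [Cas_eq, map_add, dr_dz]

theorem Cas_mul {c : SF a} (hc : ∀ i, dz i c = 0) (f : SF a) : Cas (c * f) = c * Cas f := by
  have h : ∀ i (g : SF a), dz i (c * g) = c * dz i g := fun i g => by
    rw [Derivation.leibniz, hc, smul_zero, add_zero, smul_eq_mul]
  simp only [Cas_eq, h]
  ring

theorem DD_Cas (q n : ℕ) (f : SF a) : DD q n (Cas f) = Cas (DD q n f) := by
  simp only [Cas_eq, map_add, DD_dz]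

theorem DD_Cas_pow (q n K : ℕ) (f : SF a) : DD q n ((Cas ^ K) f) = (Cas ^ K) (DD q n f) := by
  induction K generalizing f with
  | zero => rfl
  | succ K ih => rw [pow_succ, Module.End.mul_apply, ih, DD_Cas, Module.End.mul_apply]

theorem DD_Xp (q n : ℕ) (f : SF a) : DD q n (Xp f) = Xp (DD q n f) := by
  simp only [Xp_eq, map_sub, map_neg, map_smul, DD_dz]

theorem DD_Xm (q n : ℕ) (f : SF a) : DD q n (Xm f) = Xm (DD q n f) := by
  simp only [Xm_eq, map_add, map_neg, map_smul, DD_dz]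

theorem Tr_Xp (f : SF a) : Tr (Xp f) = Xp (Tr f) := by
  simp only [Xp_eq, map_sub, map_neg, map_smul, Tr_dz]

theorem Tr_Xm (f : SF a) : Tr (Xm f) = Xm (Tr f) := by
  simp only [Xm_eq, map_add, map_neg, map_smul, Tr_dz]

namespace Slice

variable {s : Slice a} {τ : ℝ}

theorem I_dz (hτ : τ ∈ Ico (0 : ℝ) 1) (i : Fin 3) (f : SF a) : s.I τ (dz i f) = 0 := by
  rw [I, sliceInt_dz s.μ s.b_lt hτ]
  rfl

theorem I_neg (hτ : τ ∈ Ico (0 : ℝ) 1) (f : SF a) : s.I τ (-f) = -s.I τ f := by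
  have := I_smul (s := s) hτ (-1) f
  simpa using this

variable (s) in
/-- The real inner product `Re ∫ χ f ḡ` on a slice. -/
def inn (τ : ℝ) (f g : SF a) : ℝ := s.I τ (s.χ * (f * star g))

theorem inn_add_left (hτ : τ ∈ Ico (0 : ℝ) 1) (f g k : SF a) :
    s.inn τ (f + g) k = s.inn τ f k + s.inn τ g k := by
  rw [inn, inn, inn, ← I_add hτ]
  congr 1
  ring

theorem inn_dz (hτ : τ ∈ Ico (0 : ℝ) 1) (i : Fin 3) (f g : SF a) :
    s.inn τ (dz i f) g = -s.inn τ f (dz i g) := by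
  have h := I_dz (s := s) hτ i (s.χ * (f * star g))
  have e : dz i (s.χ * (f * star g)) = s.χ * (dz i f * star g) + s.χ * (f * star (dz i g)) := by
    simp only [Derivation.leibniz, s.dz_χ, dz_star, smul_eq_mul, mul_zero, add_zero]
    ring
  rw [e, I_add hτ] at h
  simp only [inn]
  linarith

/-- The form `(-1)^k ⟨Δ^k f, f⟩` is the sum of the squared norms of all angular derivatives of `f`
of order `k`. -/
def casForm (s : Slice a) (τ : ℝ) (k : ℕ) (f : SF a) : ℝ := (-1) ^ k * s.inn τ ((Cas ^ k) f) f

theorem Cas_pow_dz (k : ℕ) (i : Fin 3) (f : SF a) : (Cas ^ k) (dz i f) = dz i ((Cas ^ k) f) := by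
  induction k generalizing f with
  | zero => rfl
  | succ k ih => rw [pow_succ, Module.End.mul_apply, Cas_dz, ih, Module.End.mul_apply]

theorem casForm_succ (hτ : τ ∈ Ico (0 : ℝ) 1) (k : ℕ) (f : SF a) :
    casForm s τ (k + 1) f =
      casForm s τ k (dz 0 f) + casForm s τ k (dz 1 f) + casForm s τ k (dz 2 f) := by
  have h : ∀ i, s.inn τ ((Cas ^ k) (dz i f)) (dz i f) =
      -s.inn τ (dz i (dz i ((Cas ^ k) f))) f := fun i => by
    rw [Cas_pow_dz, inn_dz hτ i (dz i ((Cas ^ k) f)), neg_neg]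
  simp only [casForm, h]
  rw [pow_succ' Cas, Module.End.mul_apply, Cas_eq, inn_add_left hτ, inn_add_left hτ]
  ring

theorem casForm_nonneg (hτ : τ ∈ Ico (0 : ℝ) 1) (k : ℕ) (f : SF a) : 0 ≤ casForm s τ k f := by
  induction k generalizing f with
  | zero => simpa [casForm, inn, NN] using NN_nonneg (s := s) hτ f
  | succ k ih =>
    rw [casForm_succ hτ]
    linarith [ih (dz 0 f), ih (dz 1 f), ih (dz 2 f)]

theorem NN_ZZ_le_casForm (hτ : τ ∈ Ico (0 : ℝ) 1) (w : List (Fin 3)) (f : SF a) :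
    s.NN τ (ZZ w f) ≤ casForm s τ w.length f := by
  induction w using List.reverseRecOn generalizing f with
  | nil => simp [casForm, inn, NN]
  | append_singleton w i ih =>
    rw [← ZZ_dz, List.length_append, List.length_singleton, casForm_succ hτ]
    have h0 := casForm_nonneg (s := s) hτ w.length (dz 0 f)
    have h1 := casForm_nonneg (s := s) hτ w.length (dz 1 f)
    have h2 := casForm_nonneg (s := s) hτ w.length (dz 2 f)
    have h3 := ih (dz i f)
    match i with
    | 0 => linarith
    | 1 => linarith
    | 2 => linarith

theorem abs_inn_le (hτ : τ ∈ Ico (0 : ℝ) 1) {t : ℝ} (ht : 0 < t) (f g : SF a) :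
    |s.inn τ f g| ≤ t * s.NN τ f + t⁻¹ * s.NN τ g := by
  have key : ∀ f : SF a, s.inn τ f g ≤ t * s.NN τ f + t⁻¹ * s.NN τ g := fun f => by
    rw [inn, NN, NN, ← I_smul hτ, ← I_smul hτ, ← I_add hτ]
    refine I_mono hτ fun x _ _ => ?_
    rw [SF.add_apply, SF.smul_apply, SF.smul_apply, Complex.add_re, Complex.re_ofReal_mul,
      Complex.re_ofReal_mul, re_mul_normSq, re_mul_normSq, re_mul_of_star s.star_χ]
    have h1 := (le_abs_self _).trans (re_mul_star_le (f.1 x) (g.1 x))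
    have h2 : ‖f.1 x‖ * ‖g.1 x‖ ≤ t * ‖f.1 x‖ ^ 2 + t⁻¹ * ‖g.1 x‖ ^ 2 := by
      have h3 : t * (t * ‖f.1 x‖ ^ 2 + t⁻¹ * ‖g.1 x‖ ^ 2 - ‖f.1 x‖ * ‖g.1 x‖) =
          (t * ‖f.1 x‖) ^ 2 + ‖g.1 x‖ ^ 2 - (t * ‖f.1 x‖) * ‖g.1 x‖ := by
        field_simp
      have h4 : 0 ≤ t * (t * ‖f.1 x‖ ^ 2 + t⁻¹ * ‖g.1 x‖ ^ 2 - ‖f.1 x‖ * ‖g.1 x‖) := by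
        rw [h3]
        nlinarith [sq_nonneg (t * ‖f.1 x‖ - ‖g.1 x‖), sq_nonneg (t * ‖f.1 x‖), sq_nonneg ‖g.1 x‖]
      linarith [nonneg_of_mul_nonneg_right h4 ht]
    have := mul_le_mul_of_nonneg_left (h1.trans h2) (s.nonneg x)
    rw [SF.mul_apply, SF.star_apply]
    linarith
  rw [abs_le]
  have h1 := key (-f)
  have e : s.inn τ (-f) g = -s.inn τ f g := by
    rw [inn, inn, ← I_neg hτ]
    congr 1
    ring
  have e2 : s.NN τ (-f) = s.NN τ f := by
    rw [NN, NN, star_neg]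
    congr 1
    ring
  rw [e, e2] at h1
  exact ⟨by linarith, key f⟩

theorem casForm_le (hτ : τ ∈ Ico (0 : ℝ) 1) {t : ℝ} (ht : 0 < t) (k : ℕ) (f : SF a) :
    casForm s τ k f ≤ t * s.NN τ ((Cas ^ k) f) + t⁻¹ * s.NN τ f := by
  refine le_trans ?_ (abs_inn_le hτ ht _ _)
  rw [casForm]
  refine (le_abs_self _).trans ?_
  rw [abs_mul, abs_pow, abs_neg, abs_one, one_pow, one_mul]

variable (s) in
/-- The functions all of whose angular derivatives are in `Bd l`. -/
def Bw (l : ℝ) : Submodule (CC a) (SF a) where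
  carrier := {u | ∀ w, ZZ w u ∈ s.Bd l}
  zero_mem' w := by rw [map_zero]; exact zero_mem _
  add_mem' hu hv w := by rw [map_add]; exact add_mem (hu w) (hv w)
  smul_mem' c u hu w := by
    have : ZZ w (c • u) = c • ZZ w u := ZZ_mul c.2.1 w u
    rw [this]
    exact Submodule.smul_mem _ _ (hu w)

theorem Bw_mono {l l' : ℝ} (h : l ≤ l') : s.Bw l ≤ s.Bw l' := fun _ hu w => Bd_mono h (hu w)

theorem Bw_le_Bd (l : ℝ) : s.Bw l ≤ s.Bd l := fun _ hu => hu []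

theorem dz_mem_Bw {l : ℝ} {u : SF a} (h : u ∈ s.Bw l) (i : Fin 3) : dz i u ∈ s.Bw l := fun w => by
  rw [ZZ_dz]
  exact h _

theorem _root_.FGauge.neg_mem_of_CC {N : Submodule (CC a) (SF a)} {u : SF a} (hu : u ∈ N) :
    -u ∈ N := by
  have := smul_mem_Bd (-1) hu
  rwa [neg_smul, one_smul] at this

theorem _root_.FGauge.sub_mem_of_CC {N : Submodule (CC a) (SF a)} {u v : SF a} (hu : u ∈ N)
    (hv : v ∈ N) : u - v ∈ N := by
  rw [sub_eq_add_neg]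
  exact N.add_mem hu (neg_mem_of_CC hv)

theorem Xp_mem_Bw {l : ℝ} {u : SF a} (h : u ∈ s.Bw l) : Xp u ∈ s.Bw l :=
  sub_mem_of_CC (neg_mem_of_CC (dz_mem_Bw h 1)) (smul_mem_Bd _ (dz_mem_Bw h 0))

theorem Xm_mem_Bw {l : ℝ} {u : SF a} (h : u ∈ s.Bw l) : Xm u ∈ s.Bw l :=
  (s.Bw l).add_mem (neg_mem_of_CC (dz_mem_Bw h 1)) (smul_mem_Bd _ (dz_mem_Bw h 0))

theorem Cas_pow_mem_Bw {l : ℝ} {u : SF a} (h : u ∈ s.Bw l) (K : ℕ) : (Cas ^ K) u ∈ s.Bw l := by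
  induction K with
  | zero => exact h
  | succ K ih =>
    rw [pow_succ', Module.End.mul_apply, Cas_eq]
    exact add_mem (add_mem (dz_mem_Bw (dz_mem_Bw ih 0) 0) (dz_mem_Bw (dz_mem_Bw ih 1) 1))
      (dz_mem_Bw (dz_mem_Bw ih 2) 2)

/-- Bounds for the powers of the Casimir operator bound all angular derivatives. -/
theorem mem_Bw_of_Cas {l : ℝ} {u : SF a} (h : ∀ K, (Cas ^ K) u ∈ s.Bd l) : u ∈ s.Bw l := by
  intro w
  obtain ⟨C, hC⟩ := h w.length
  obtain ⟨C', hC'⟩ := h 0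
  refine ⟨C + C', fun τ hτ => ?_⟩
  have h1 := (NN_ZZ_le_casForm (s := s) hτ w u).trans (casForm_le hτ one_pos _ u)
  have h2 := hC τ hτ
  have h3 := hC' τ hτ
  rw [pow_zero, Module.End.one_apply] at h3
  rw [inv_one] at h1
  linarith

/-- Interpolation: if `u` is bounded and all its angular derivatives blow up at a common rate, then
they blow up at half this rate. -/
theorem mem_Bw_half {l : ℝ} {u : SF a} (h0 : u ∈ s.Bd 0) (h : u ∈ s.Bw l) : u ∈ s.Bw (l / 2) := by
  intro w
  obtain ⟨C, hC⟩ := Cas_pow_mem_Bw h w.length []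
  obtain ⟨C', hC'⟩ := h0
  refine ⟨C + C', fun τ hτ => ?_⟩
  have h1 := (NN_ZZ_le_casForm (s := s) hτ w u).trans
    (casForm_le hτ (wt_pos (-(l / 2)) hτ) _ u)
  have e : wt (-(l / 2)) τ * wt (l / 2) τ = 1 := by
    rw [← wt_add _ _ hτ]
    simp [wt]
  have e' : (wt (-(l / 2)) τ)⁻¹ = wt (l / 2) τ := inv_eq_of_mul_eq_one_right e
  have e2 : wt (-(l / 2)) τ * wt l τ = wt (l / 2) τ := by
    rw [← wt_add _ _ hτ]
    congr 1
    ring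
  have e3 : wt 0 τ = 1 := by simp [wt]
  have h2 := mul_le_mul_of_nonneg_left (hC τ hτ) (wt_pos (-(l / 2)) hτ).le
  have h3 := mul_le_mul_of_nonneg_left (hC' τ hτ) (wt_pos (l / 2) hτ).le
  rw [e'] at h1
  rw [ZZ_nil] at h2
  rw [e3] at h3
  have e4 : wt (-(l / 2)) τ * (C * wt l τ) = C * wt (l / 2) τ := by rw [← e2]; ring
  linarith

theorem mem_Bw_of_bounded {l : ℝ} {u : SF a} (h0 : u ∈ s.Bd 0) (h : u ∈ s.Bw l) {ε : ℝ}
    (hε : 0 < ε) : u ∈ s.Bw ε := by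
  have key : ∀ k : ℕ, u ∈ s.Bw (l / 2 ^ k) := fun k => by
    induction k with
    | zero => simpa using h
    | succ k ih =>
      have := mem_Bw_half h0 ih
      rwa [div_div, ← pow_succ] at this
  obtain ⟨k, hk⟩ := pow_unbounded_of_one_lt (l / ε) (one_lt_two (α := ℝ))
  refine Bw_mono ?_ (key k)
  rw [div_lt_iff₀ hε] at hk
  rw [div_le_iff₀ (by positivity)]
  linarith

theorem Tr_mem_Bw {l : ℝ} {u : SF a} (h : u ∈ s.Bw l) (h' : dr u ∈ s.Bw l) : Tr u ∈ s.Bw l :=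
  fun w => by
    rw [← Tr_ZZ]
    exact Tr_mem_Bd (h w) (by rw [dr_ZZ]; exact h' w)

theorem hardy_Bw {l : ℝ} {v : SF a} (h : Tr v = 0) (h' : dr v ∈ s.Bw l) : v ∈ s.Bw l := fun w => by
  obtain ⟨C, hC⟩ := h' w
  refine ⟨4 * s.b ^ 2 * C, fun τ hτ => ?_⟩
  have h1 := hardy (s := s) hτ (v := ZZ w v) (by rw [Tr_ZZ, h, map_zero])
  rw [dr_ZZ] at h1
  have h2 := mul_le_mul_of_nonneg_left (hC τ hτ) (by positivity : 0 ≤ 4 * s.b ^ 2)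
  linarith

theorem transport_regular_Bw {l : ℝ} (hl : 0 < l) {p u f : SF a} (hp : p ∈ CC a)
    (hps : star p = p) (h0 : Tr p = 0)
    (hsign : ∀ x : Pt a, x.ρ ≤ s.b → (p.1 x).re ≤ 2 * x.ρ)
    (heq : dt u = p * dr u + f) (hf : f ∈ s.Bw (l + 1)) : u ∈ s.Bw l := fun w =>
  transport_regular hl hp (zero_mem _) hps h0 hsign
    (by rw [dt_ZZ, heq, map_add, ZZ_mul hp.1, dr_ZZ, zero_mul, add_zero]) (hf w)

theorem transport_singular_Bw {l : ℝ} (hl : 0 ≤ l) {p k u f g : SF a}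
    (hpc : p ∈ CC a) (hkc : k ∈ CC a) (hps : star p = p) (h0 : Tr p = 0)
    (hsign : ∀ x : Pt a, x.ρ ≤ s.b → 0 ≤ (p.1 x).re)
    (hk : ∀ x : Pt a, x.ρ ≤ s.b → ((dr p).1 x).re + 2 * (k.1 x).re ≤ -(5 / 2))
    (heq : oneSubTau * dt u = -p * dr u + k * u + (f + g)) (hf : f ∈ s.Bw l)
    (hg : ∀ w, ∀ τ ∈ Ico (0 : ℝ) 1, s.NN τ (ZZ w g) ≤ 1 / 4 * s.NN τ (ZZ w u)) : u ∈ s.Bw l :=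
  fun w => transport_singular hl hps h0 hsign hk
    (by
      have := congrArg (ZZ w) heq
      rwa [ZZ_mul dz_oneSubTau, map_add, map_add, map_add,
        ZZ_mul (fun i => by rw [map_neg, hpc.1, neg_zero]), ZZ_mul hkc.1, ← dt_ZZ, ← dr_ZZ] at this)
    (hf w) (hg w)

theorem mem_Bw_of_oneSubTau_mul {l : ℝ} {u : SF a} (h : oneSubTau * u ∈ s.Bw l) :
    u ∈ s.Bw (l + 2) := fun w => by
  obtain ⟨C, hC⟩ := h w
  refine ⟨C, fun τ hτ => ?_⟩
  have h1 := hC τ hτ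
  rw [ZZ_mul dz_oneSubTau] at h1
  have h2 : s.NN τ (oneSubTau * ZZ w u) = (1 - τ) ^ 2 * s.NN τ (ZZ w u) := by
    rw [NN, NN, ← I_smul hτ]
    refine le_antisymm (I_mono hτ fun x hx _ => ?_) (I_mono hτ fun x hx _ => ?_)
    all_goals
      rw [re_mul_normSq, SF.smul_apply, Complex.re_ofReal_mul, re_mul_normSq, SF.mul_apply,
        oneSubTau_apply, hx, norm_mul, mul_pow, Complex.norm_real, Real.norm_eq_abs, sq_abs]
      linarith
  have e : (1 - τ) ^ 2 * wt (l + 2) τ = wt l τ := by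
    rw [show l + 2 = l + 1 + 1 by ring, pow_two, mul_assoc, one_sub_mul_wt _ hτ,
      one_sub_mul_wt _ hτ]
  rw [h2, ← e] at h1
  have h3 : 0 < (1 - τ) ^ 2 := by
    have : 0 < 1 - τ := by linarith [hτ.2]
    positivity
  refine le_of_mul_le_mul_left ?_ h3
  linarith

end Slice

/-! ### The divided Maxwell system -/

/-- The coefficients of the Maxwell equations `A₀`, `A₁`, `B₂`, solved for `∂_τ φ₀`, `∂_τ φ₁` and
`(1 - τ) ∂_τ φ₂`. All of them are regular up to `τ = 1`. The weights `θ` and `h` restore the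
common coefficients `c¹` and `-c^±` of `∂_ρ` and `X_±` in `A₁` and `B₂`. -/
structure Sys (a : ℝ) where
  (p pt s st θ h v0 v1 v2 : SF a)
  p_mem : p ∈ CC a
  pt_mem : pt ∈ CC a
  s_mem : s ∈ CC a
  st_mem : st ∈ CC a
  θ_mem : θ ∈ CC a
  h_mem : h ∈ CC a
  v0_mem : v0 ∈ CC a
  v1_mem : v1 ∈ CC a
  v2_mem : v2 ∈ CC a
  star_p : star p = p
  star_pt : star pt = pt
  star_s : star s = s
  star_θ : star θ = θ
  star_h : star h = h
  θ_mul_p : θ * p = h * pt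
  θ_mul_s : θ * s = h * st
  Tr_p : Tr p = 0
  Tr_pt : Tr pt = 0
  Tr_dr_pt : Tr (dr pt) = 1
  Tr_v2 : Tr v2 = 1
  p_le : ∀ x, (p.1 x).re ≤ 2 * x.ρ
  pt_nonneg : ∀ x, 0 ≤ (pt.1 x).re
  θ_ge : ∀ x, 1 / 2 ≤ (θ.1 x).re
  h_ge : ∀ x, 1 / 2 ≤ (h.1 x).re

/-- The inhomogeneous divided system. -/
structure Sys.Solves (Y : Sys a) (u0 u1 u2 F0 F1 G : SF a) : Prop where
  e0 : dt u0 = Y.p * dr u0 + Y.v0 * u0 + Y.s * Xp u1 + F0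
  e1 : dt u1 = Y.p * dr u1 + Y.v1 * u1 + Y.s * Xp u2 + F1
  e2 : oneSubTau * dt u2 = -Y.pt * dr u2 + Y.v2 * u2 + Y.st * Xm u1 + G

theorem Sys.Solves.cas {Y : Sys a} {u0 u1 u2 : SF a} (h : Y.Solves u0 u1 u2 0 0 0) :
    Y.Solves (Cas u0) (Cas u1) (Cas u2) 0 0 0 := by
  constructor
  · rw [← Cas_dt, h.e0]
    simp only [map_add, Cas_mul Y.p_mem.1, Cas_mul Y.v0_mem.1, Cas_mul Y.s_mem.1, Cas_dr, Cas_Xp,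
      map_zero]
  · rw [← Cas_dt, h.e1]
    simp only [map_add, Cas_mul Y.p_mem.1, Cas_mul Y.v1_mem.1, Cas_mul Y.s_mem.1, Cas_dr, Cas_Xp,
      map_zero]
  · rw [← Cas_dt, ← Cas_mul dz_oneSubTau, h.e2]
    have hn : ∀ i, dz i (-Y.pt) = 0 := fun i => by rw [map_neg, Y.pt_mem.1, neg_zero]
    simp only [map_add, Cas_mul hn, Cas_mul Y.v2_mem.1, Cas_mul Y.st_mem.1,
      Cas_dr, Cas_Xm, map_zero]

theorem Sys.Solves.cas_pow {Y : Sys a} {u0 u1 u2 : SF a} (h : Y.Solves u0 u1 u2 0 0 0) (K : ℕ) :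
    Y.Solves ((Cas ^ K) u0) ((Cas ^ K) u1) ((Cas ^ K) u2) 0 0 0 := by
  induction K with
  | zero => exact h
  | succ K ih =>
    simp only [pow_succ', Module.End.mul_apply]
    exact ih.cas

namespace Slice

variable {s : Slice a} {τ : ℝ}

theorem exists_lower_order_bound (s : Slice a) {c k : SF a} (hc : c ∈ CC a) (hk : k ∈ CC a) :
    ∃ K : ℝ, 0 ≤ K ∧ ∀ τ ∈ Ico (0 : ℝ) 1, ∀ u ℓ : SF a,
      s.I τ (s.χ * (c * (u * star u)) + s.χ * ((k * ℓ) * star u + star (k * ℓ) * u)) ≤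
        K * s.NN τ u + K * s.NN τ ℓ := by
  obtain ⟨K1, h1, hK1⟩ := CC.bound hc
  obtain ⟨K2, h2, hK2⟩ := CC.bound hk
  refine ⟨K1 + K2, by positivity, fun τ hτ u ℓ => ?_⟩
  rw [NN, NN, ← I_smul hτ, ← I_smul hτ, ← I_add hτ]
  refine I_mono hτ fun x _ _ => ?_
  simp only [SF.add_apply, Complex.add_re, SF.smul_apply, Complex.re_ofReal_mul]
  rw [re_weight s.star_χ, re_mul_add_star, re_mul_normSq, re_mul_normSq]
  have b1 := (le_abs_self _).trans ((Complex.abs_re_le_norm (c.1 x)).trans (hK1 x))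
  have b2 := (le_abs_self _).trans (re_mul_star_le ((k * ℓ).1 x) (u.1 x))
  have b3 : ‖(k * ℓ).1 x‖ ≤ K2 * ‖ℓ.1 x‖ := by
    rw [SF.mul_apply, norm_mul]
    exact mul_le_mul_of_nonneg_right (hK2 x) (norm_nonneg _)
  have b4 : (c.1 x).re * ‖u.1 x‖ ^ 2 + 2 * ((k * ℓ).1 x * star (u.1 x)).re ≤
      (K1 + K2) * ‖u.1 x‖ ^ 2 + (K1 + K2) * ‖ℓ.1 x‖ ^ 2 := by
    have e1 := mul_le_mul_of_nonneg_right b1 (sq_nonneg ‖u.1 x‖)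
    have e2 := mul_le_mul_of_nonneg_right b3 (norm_nonneg (u.1 x))
    have e3 : 0 ≤ K2 * (‖ℓ.1 x‖ - ‖u.1 x‖) ^ 2 := by positivity
    have e4 : 0 ≤ K1 * ‖ℓ.1 x‖ ^ 2 := by positivity
    nlinarith
  nlinarith [mul_le_mul_of_nonneg_left b4 (s.nonneg x)]

/-- The angular terms of the equations for `∂_τ φ₁` and `∂_τ φ₂` cancel. -/
theorem I_angular (hτ : τ ∈ Ico (0 : ℝ) 1) {σ : SF a} (hσ : ∀ i, dz i σ = 0) (ψ1 ψ2 : SF a)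
    (hs : star σ = σ) :
    s.I τ (s.χ * ((σ * Xp ψ2) * star ψ1 + star (σ * Xp ψ2) * ψ1) +
      s.χ * ((σ * Xm ψ1) * star ψ2 + star (σ * Xm ψ1) * ψ2)) = 0 := by
  set A : SF a := algebraMap ℂ (SF a) Complex.I with hA
  have hsA : star A = -A := by
    rw [hA]
    ext x
    simp
  have hdA : ∀ i, dz i A = 0 := fun i => Derivation.map_algebraMap _ _
  have e : s.χ * ((σ * Xp ψ2) * star ψ1 + star (σ * Xp ψ2) * ψ1) +
      s.χ * ((σ * Xm ψ1) * star ψ2 + star (σ * Xm ψ1) * ψ2) =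
      dz 1 (-(s.χ * σ * (ψ2 * star ψ1 + star ψ2 * ψ1))) +
      dz 0 (-(s.χ * σ * A * (ψ2 * star ψ1 - star ψ2 * ψ1))) := by
    have e1 : ∀ f : SF a, Complex.I • f = A * f := fun f => Algebra.smul_def _ f
    simp only [Xp_eq, Xm_eq, e1, star_mul', star_sub, star_add, star_neg, hs, hsA, map_neg, map_add, map_sub, Derivation.leibniz, smul_eq_mul, hσ, hdA, s.dz_χ,
      dz_star]
    ring
  rw [e, I_add hτ, I_dz hτ, I_dz hτ, add_zero]

/-- The energy estimate for the pair of equations for `φ₁` and `φ₂`: for any coefficients of the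
zero order terms the solution grows at most polynomially in `1 / (1 - τ)`. -/
theorem pair_energy (Y : Sys a) (s : Slice a) {κ1 κ2 : SF a} (h1 : κ1 ∈ CC a) (h2 : κ2 ∈ CC a) :
    ∃ Λ : ℝ, ∀ l, Λ ≤ l → ∀ ψ1 ψ2 ℓ1 ℓ2 : SF a, ℓ1 ∈ s.Bd l → ℓ2 ∈ s.Bd l →
      dt ψ1 = Y.p * dr ψ1 + κ1 * ψ1 + Y.s * Xp ψ2 + ℓ1 →
      oneSubTau * dt ψ2 = -Y.pt * dr ψ2 + κ2 * ψ2 + Y.st * Xm ψ1 + ℓ2 →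
      ψ1 ∈ s.Bd (l + 1) ∧ ψ2 ∈ s.Bd (l + 1) := by
  set c1 := Y.θ * Y.p with hc1
  have hc1m : c1 ∈ CC a := mul_mem Y.θ_mem Y.p_mem
  have hc1s : star c1 = c1 := by rw [hc1, star_mul', Y.star_θ, Y.star_p]
  have hc10 : ∀ x : Pt a, x.ρ = 0 → c1.1 x = 0 := fun x hx => by
    rw [apply_eq_Tr hx, hc1, map_mul, Y.Tr_p, mul_zero]
    rfl
  set σ := Y.θ * Y.s with hσ
  have hσz : ∀ i, dz i σ = 0 := (mul_mem Y.θ_mem Y.s_mem).1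
  have hσs : star σ = σ := by rw [hσ, star_mul', Y.star_θ, Y.star_s]
  set hw := Y.h * oneSubTau with hhw
  have hhwm : hw ∈ CC a := mul_mem Y.h_mem oneSubTau_mem
  have hhws : star hw = hw := by rw [hhw, star_mul', Y.star_h, star_oneSubTau]
  have star_mem : ∀ {c : SF a}, c ∈ CC a → star c ∈ CC a := fun {c} hc =>
    ⟨fun i => by rw [dz_star, hc.1, star_zero], fun n => by
      have : ∀ (n : ℕ) (c : SF a), BddTo n c → BddTo n (star c) := fun n => by
        induction n with
        | zero =>
          rintro c ⟨K, hK⟩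
          exact ⟨K, fun x => by rw [SF.star_apply, norm_star]; exact hK x⟩
        | succ n ih =>
          rintro c ⟨⟨K, hK⟩, hb, hb'⟩
          refine ⟨⟨K, fun x => by rw [SF.star_apply, norm_star]; exact hK x⟩, ?_, ?_⟩
          · rw [dt_star]
            exact ih _ hb
          · rw [dr_star]
            exact ih _ hb'
      exact this n c (hc.2 n)⟩
  have hm1 : dt Y.θ - dr c1 + (Y.θ * κ1 + star (Y.θ * κ1)) ∈ CC a :=
    add_mem (sub_mem (CC.dt_mem Y.θ_mem) (CC.dr_mem hc1m))
      (add_mem (mul_mem Y.θ_mem h1) (star_mem (mul_mem Y.θ_mem h1)))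
  have hm2 : dt hw - dr (-c1) + (Y.h * κ2 + star (Y.h * κ2)) ∈ CC a :=
    add_mem (sub_mem (CC.dt_mem hhwm) (CC.dr_mem (neg_mem hc1m)))
      (add_mem (mul_mem Y.h_mem h2) (star_mem (mul_mem Y.h_mem h2)))
  obtain ⟨K1, hK1, hb1⟩ := exists_lower_order_bound s hm1 Y.θ_mem
  obtain ⟨K2, hK2, hb2⟩ := exists_lower_order_bound s hm2 Y.h_mem
  set K := K1 + K2 with hK
  refine ⟨2 * K + 1, fun l hl ψ1 ψ2 ℓ1 ℓ2 hℓ1 hℓ2 eq1 eq2 => ?_⟩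
  obtain ⟨C1, hC1, hC1'⟩ := Bd.exists_nonneg hℓ1
  obtain ⟨C2, hC2, hC2'⟩ := Bd.exists_nonneg hℓ2
  set E : SF a := s.χ * (Y.θ * (ψ1 * star ψ1)) + s.χ * (hw * (ψ2 * star ψ2)) with hE
  have hEder : ∀ τ ∈ Ioo (0 : ℝ) 1, s.I τ (dt E) ≤
      K * s.NN τ ψ1 + K * s.NN τ ψ2 + K * (C1 + C2) * wt l τ := by
    intro τ hτ
    have hτ' : τ ∈ Ico (0 : ℝ) 1 := ⟨hτ.1.le, hτ.2⟩
    have en1 := energy (s := s) (θ := Y.θ) (ϖ := c1) (u := ψ1)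
      (f := Y.θ * κ1 * ψ1 + σ * Xp ψ2 + Y.θ * ℓ1) hτ Y.star_θ hc1s hc10
      (by rw [eq1]; ring) (fun x _ => by
        have e : (2 * rho * Y.θ - c1 : SF a) = Y.θ * (2 * rho - Y.p) := by rw [hc1]; ring
        rw [e, re_mul_of_star Y.star_θ]
        refine mul_nonneg (by linarith [Y.θ_ge x]) ?_
        have := Y.p_le x
        simp
        linarith)
    have en2 := energy (s := s) (θ := hw) (ϖ := -c1) (u := ψ2)
      (f := Y.h * κ2 * ψ2 + σ * Xm ψ1 + Y.h * ℓ2) hτ hhws (by rw [star_neg, hc1s])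
      (fun x hx => by rw [SF.neg_apply, hc10 x hx, neg_zero])
      (by
        rw [hhw, hc1, hσ, Y.θ_mul_p, Y.θ_mul_s, mul_assoc, eq2]
        ring) (fun x _ => by
        have e : (2 * rho * hw - -c1 : SF a) = Y.h * (2 * rho * oneSubTau + Y.pt) := by
          rw [hc1, Y.θ_mul_p, hhw]
          ring
        rw [e, re_mul_of_star Y.star_h]
        refine mul_nonneg (by linarith [Y.h_ge x]) ?_
        have h3 := Y.pt_nonneg x
        have h4 : (2 * rho * oneSubTau + Y.pt : SF a).1 x =
            ((2 * x.ρ * (1 - x.τ) : ℝ) : ℂ) + Y.pt.1 x := by simp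
        rw [h4, Complex.add_re, Complex.ofReal_re]
        have := mul_nonneg x.hρ.1 (by linarith [x.hτ.2] : 0 ≤ 1 - x.τ)
        linarith)
    have hcancel := I_angular (s := s) hτ' hσz ψ1 ψ2 hσs
    have b1 := hb1 τ hτ' ψ1 ℓ1
    have b2 := hb2 τ hτ' ψ2 ℓ2
    have hsum := add_le_add en1 en2
    rw [← I_add hτ', ← I_add hτ', ← map_add, ← hE] at hsum
    have e : s.χ * ((dt Y.θ - dr c1) * (ψ1 * star ψ1)) +
          s.χ * ((Y.θ * κ1 * ψ1 + σ * Xp ψ2 + Y.θ * ℓ1) * star ψ1 +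
            star (Y.θ * κ1 * ψ1 + σ * Xp ψ2 + Y.θ * ℓ1) * ψ1) +
        (s.χ * ((dt hw - dr (-c1)) * (ψ2 * star ψ2)) +
          s.χ * ((Y.h * κ2 * ψ2 + σ * Xm ψ1 + Y.h * ℓ2) * star ψ2 +
            star (Y.h * κ2 * ψ2 + σ * Xm ψ1 + Y.h * ℓ2) * ψ2)) =
        (s.χ * ((dt Y.θ - dr c1 + (Y.θ * κ1 + star (Y.θ * κ1))) * (ψ1 * star ψ1)) +
          s.χ * ((Y.θ * ℓ1) * star ψ1 + star (Y.θ * ℓ1) * ψ1)) +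
        ((s.χ * ((dt hw - dr (-c1) + (Y.h * κ2 + star (Y.h * κ2))) * (ψ2 * star ψ2)) +
          s.χ * ((Y.h * ℓ2) * star ψ2 + star (Y.h * ℓ2) * ψ2)) +
        (s.χ * ((σ * Xp ψ2) * star ψ1 + star (σ * Xp ψ2) * ψ1) +
          s.χ * ((σ * Xm ψ1) * star ψ2 + star (σ * Xm ψ1) * ψ2))) := by
      simp only [star_add, star_mul']
      ring
    rw [e, I_add hτ', I_add hτ' _ (s.χ * ((σ * Xp ψ2) * star ψ1 + star (σ * Xp ψ2) * ψ1) +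
          s.χ * ((σ * Xm ψ1) * star ψ2 + star (σ * Xm ψ1) * ψ2)), hcancel, add_zero] at hsum
    have n1 := NN_nonneg (s := s) hτ' ψ1
    have n2 := NN_nonneg (s := s) hτ' ψ2
    have n3 := NN_nonneg (s := s) hτ' ℓ1
    have n4 := NN_nonneg (s := s) hτ' ℓ2
    have n5 := hC1' τ hτ'
    have n6 := hC2' τ hτ'
    have hw0 := (wt_pos l hτ').le
    have n7 : K1 * s.NN τ ℓ1 ≤ K * (C1 * wt l τ) :=
      mul_le_mul (by linarith) n5 n3 (by positivity)
    have n8 : K2 * s.NN τ ℓ2 ≤ K * (C2 * wt l τ) :=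
      mul_le_mul (by linarith) n6 n4 (by positivity)
    have n9 : K1 * s.NN τ ψ1 ≤ K * s.NN τ ψ1 := mul_le_mul_of_nonneg_right (by linarith) n1
    have n10 : K2 * s.NN τ ψ2 ≤ K * s.NN τ ψ2 := mul_le_mul_of_nonneg_right (by linarith) n2
    linarith
  have hElow : ∀ τ ∈ Ico (0 : ℝ) 1, 1 / 2 * s.NN τ ψ1 + 1 / 2 * ((1 - τ) * s.NN τ ψ2) ≤
      s.I τ E := by
    intro τ hτ
    rw [← mul_assoc, NN, NN, ← I_smul hτ, ← I_smul hτ, ← I_add hτ]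
    refine I_mono hτ fun x hx _ => ?_
    have ho : (hw.1 x).re = (Y.h.1 x).re * (1 - τ) := by
      rw [hhw, re_mul_of_star Y.star_h, oneSubTau_apply, Complex.ofReal_re, hx]
    simp only [hE, SF.add_apply, Complex.add_re, SF.smul_apply, Complex.re_ofReal_mul]
    rw [re_weight s.star_χ, re_weight s.star_χ, re_mul_normSq, re_mul_normSq, ho]
    have h3 := s.nonneg x
    have h4 : 0 ≤ 1 - τ := by linarith [hτ.2]
    have h5 : 1 / 2 * ((s.χ.1 x).re * ‖ψ1.1 x‖ ^ 2) ≤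
        (s.χ.1 x).re * ((Y.θ.1 x).re * ‖ψ1.1 x‖ ^ 2) := by
      have := mul_le_mul_of_nonneg_right (Y.θ_ge x)
        (mul_nonneg h3 (sq_nonneg ‖ψ1.1 x‖))
      linarith
    have h6 : 1 / 2 * (1 - τ) * ((s.χ.1 x).re * ‖ψ2.1 x‖ ^ 2) ≤
        (s.χ.1 x).re * ((Y.h.1 x).re * (1 - τ) * ‖ψ2.1 x‖ ^ 2) := by
      have := mul_le_mul_of_nonneg_right (Y.h_ge x)
        (mul_nonneg h4 (mul_nonneg h3 (sq_nonneg ‖ψ2.1 x‖)))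
      linarith
    linarith
  obtain ⟨C', hC', hbd⟩ := singular_gronwall (y := fun τ => s.I τ E) (c := -(2 * K)) (l := l)
    (C := K * (C1 + C2)) (by linarith) (by positivity) (continuousOn_I _) (fun τ hτ => by
      have hτ' : τ ∈ Ico (0 : ℝ) 1 := ⟨hτ.1.le, hτ.2⟩
      refine ⟨_, hasDerivAt_I hτ _, ?_⟩
      have h3 := hEder τ hτ
      have h4 := hElow τ hτ'
      have h5 : 0 ≤ 1 - τ := by linarith [hτ.2]
      have h6 : 1 - τ ≤ 1 := by linarith [hτ.1]
      have n1 := NN_nonneg (s := s) hτ' ψ1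
      have hK0 : 0 ≤ K := by positivity
      have hw0 : 0 ≤ K * (C1 + C2) * wt l τ := mul_nonneg (by positivity) (wt_pos l hτ').le
      have h7 := mul_le_mul_of_nonneg_left h3 h5
      have h8 : (1 - τ) * (K * s.NN τ ψ1) ≤ K * s.NN τ ψ1 := by
        nlinarith [mul_nonneg hK0 n1]
      have h9 : (1 - τ) * (K * (C1 + C2) * wt l τ) ≤ K * (C1 + C2) * wt l τ := by nlinarith
      have h10 := mul_le_mul_of_nonneg_left h4 hK0
      nlinarith)
  constructor
  · refine ⟨2 * C', fun τ hτ => ?_⟩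
    have h3 := hbd τ hτ
    have h4 := hElow τ hτ
    have h5 : 0 ≤ (1 - τ) * s.NN τ ψ2 :=
      mul_nonneg (by linarith [hτ.2]) (NN_nonneg hτ _)
    have h6 := mul_le_mul_of_nonneg_left (wt_mono (by linarith : l ≤ l + 1) hτ) hC'
    linarith
  · refine ⟨2 * C', fun τ hτ => ?_⟩
    have h3 := hbd τ hτ
    have h4 := hElow τ hτ
    have n1 := NN_nonneg (s := s) hτ ψ1
    have h5 : 0 < 1 - τ := by linarith [hτ.2]
    refine le_of_mul_le_mul_left ?_ h5
    rw [← one_sub_mul_wt l hτ] at h3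
    linarith

end Slice

/-! ### Polynomial bounds -/

theorem DD_mul_sub_mem_rho (N : Submodule (CC a) (SF a)) {n : ℕ} {c u : SF a} (hc : c ∈ CC a)
    (h : ∀ i < n, DD 0 i u ∈ N) : DD 0 n (c * u) - c * DD 0 n u ∈ N := by
  obtain ⟨k, hk, e⟩ := DD_mul_eq_rho n hc
  rw [e, add_sub_cancel_left]
  exact Submodule.sum_mem _ fun i hi => mul_mem_of_CC (hk i) (h i (Finset.mem_range.1 hi))

theorem DD_mul_dr_eq (n : ℕ) {c : SF a} (hc : c ∈ CC a) :
    ∃ k : ℕ → SF a, (∀ i, k i ∈ CC a) ∧ ∀ u : SF a,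
      DD 0 n (c * dr u) = c * dr (DD 0 n u) + (n : SF a) * dr c * DD 0 n u +
        ∑ i ∈ Finset.range n, k i * DD 0 i u := by
  induction n with
  | zero => exact ⟨fun _ => 0, fun _ => zero_mem _, fun u => by simp⟩
  | succ n ih =>
    obtain ⟨k, hk, h⟩ := ih
    have hn : (n : SF a) ∈ CC a := natCast_mem (CC a) n
    refine ⟨fun i => (if i = n then (n : SF a) * dr (dr c) else 0) +
      (if i < n then dr (k i) else 0) + (if 0 < i then k (i - 1) else 0), fun i => ?_, fun u => ?_⟩
    · refine add_mem (add_mem ?_ ?_) ?_ <;> split_ifs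
      exacts [mul_mem hn (CC.dr_mem (CC.dr_mem hc)), zero_mem _, CC.dr_mem (hk i), zero_mem _,
        hk _, zero_mem _]
    · have hn0 : dr (n : SF a) = 0 := Derivation.map_natCast _ n
      rw [← dr_DD, h, map_add, map_add, map_sum]
      simp only [add_mul, Finset.sum_add_distrib, ite_mul, zero_mul, Derivation.leibniz, dr_DD,
        smul_eq_mul, hn0]
      have e1 : ∑ i ∈ Finset.range (n + 1), (if i = n then (n : SF a) * dr (dr c) * DD 0 i u else 0)
          = (n : SF a) * dr (dr c) * DD 0 n u := by simp
      have e2 : ∑ i ∈ Finset.range (n + 1), (if i < n then dr (k i) * DD 0 i u else 0) =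
          ∑ i ∈ Finset.range n, dr (k i) * DD 0 i u := by
        rw [Finset.sum_range_succ, if_neg (lt_irrefl n), add_zero]
        exact Finset.sum_congr rfl fun i hi => if_pos (Finset.mem_range.1 hi)
      have e3 : ∑ i ∈ Finset.range (n + 1), (if 0 < i then k (i - 1) * DD 0 i u else 0) =
          ∑ i ∈ Finset.range n, k i * DD 0 (i + 1) u := by
        rw [Finset.sum_range_succ']
        simp
      rw [e1, e2, e3]
      have e4 : ∑ i ∈ Finset.range n, DD 0 i u * dr (k i) =
          ∑ i ∈ Finset.range n, dr (k i) * DD 0 i u := by simp only [mul_comm]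
      rw [e4]
      push_cast
      ring

theorem DD_mul_dr_sub_mem_rho (N : Submodule (CC a) (SF a)) {n : ℕ} {c u : SF a} (hc : c ∈ CC a)
    (h : ∀ i < n, DD 0 i u ∈ N) :
    DD 0 n (c * dr u) - c * dr (DD 0 n u) - (n : SF a) * dr c * DD 0 n u ∈ N := by
  obtain ⟨k, hk, e⟩ := DD_mul_dr_eq n hc
  have e' : DD 0 n (c * dr u) - c * dr (DD 0 n u) - (n : SF a) * dr c * DD 0 n u =
      ∑ i ∈ Finset.range n, k i * DD 0 i u := by
    rw [e]
    ring
  rw [e']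
  exact Submodule.sum_mem _ fun i hi => mul_mem_of_CC (hk i) (h i (Finset.mem_range.1 hi))

theorem DD_oneSubTau_mul (n : ℕ) (f : SF a) : DD 0 n (oneSubTau * f) = oneSubTau * DD 0 n f := by
  induction n with
  | zero => rfl
  | succ n ih =>
    rw [← dr_DD, ih, Derivation.leibniz, dr_oneSubTau, smul_zero, add_zero, smul_eq_mul, dr_DD]

theorem DD_oneSubTau_dt (q n : ℕ) (u : SF a) :
    DD q n (oneSubTau * dt u) = oneSubTau * dt (DD q n u) - (q : SF a) * DD q n u := by
  induction q generalizing u with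
  | zero =>
    rw [DD_oneSubTau_mul, DD_dt, dt_DD]
    simp
  | succ q ih =>
    have e : dt (oneSubTau * dt u) = oneSubTau * dt (dt u) - dt u := by
      rw [Derivation.leibniz, dt_oneSubTau, smul_eq_mul, smul_eq_mul]
      ring
    rw [← DD_dt, e, map_sub, ih (dt u), ← DD_dt]
    push_cast
    ring

namespace Slice

variable {s : Slice a}

/-- Each `ρ`-derivative of a solution blows up at most polynomially at `τ = 1`, at a rate that does
not depend on the solution; by the Casimir operator, it does not depend on the number of angular
derivatives either. -/
theorem crude_bound (Y : Sys a) (s : Slice a) (n : ℕ) : ∃ l : ℝ, 0 < l ∧ ∀ i < n,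
    ∀ u0 u1 u2 : SF a, Y.Solves u0 u1 u2 0 0 0 →
      DD 0 i u0 ∈ s.Bw l ∧ DD 0 i u1 ∈ s.Bw l ∧ DD 0 i u2 ∈ s.Bw l := by
  induction n with
  | zero => exact ⟨1, one_pos, fun i hi => absurd hi (Nat.not_lt_zero i)⟩
  | succ n ih =>
    obtain ⟨l, hl, h⟩ := ih
    have hn : (n : SF a) ∈ CC a := natCast_mem (CC a) n
    obtain ⟨Λ, hΛ⟩ := pair_energy Y s (κ1 := Y.v1 + (n : SF a) * dr Y.p)
      (κ2 := Y.v2 - (n : SF a) * dr Y.pt)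
      (add_mem Y.v1_mem (mul_mem hn (CC.dr_mem Y.p_mem)))
      (sub_mem Y.v2_mem (mul_mem hn (CC.dr_mem Y.pt_mem)))
    set L := max l Λ with hL
    have hlL : l ≤ L := le_max_left _ _
    have hlow : ∀ u0 u1 u2 : SF a, Y.Solves u0 u1 u2 0 0 0 →
        DD 0 n u1 ∈ s.Bd (L + 1) ∧ DD 0 n u2 ∈ s.Bd (L + 1) := by
      intro u0 u1 u2 hu
      have l1 := DD_mul_dr_sub_mem_rho (s.Bw l) (n := n) Y.p_mem fun i hi => (h i hi _ _ _ hu).2.1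
      have l2 := DD_mul_sub_mem_rho (s.Bw l) (n := n) Y.v1_mem fun i hi => (h i hi _ _ _ hu).2.1
      have l3 := DD_mul_sub_mem_rho (s.Bw l) (n := n) (u := Xp u2) Y.s_mem fun i hi => by
        rw [DD_Xp]
        exact Xp_mem_Bw (h i hi _ _ _ hu).2.2
      have l4 := DD_mul_dr_sub_mem_rho (s.Bw l) (n := n) Y.pt_mem fun i hi => (h i hi _ _ _ hu).2.2
      have l5 := DD_mul_sub_mem_rho (s.Bw l) (n := n) Y.v2_mem fun i hi => (h i hi _ _ _ hu).2.2
      have l6 := DD_mul_sub_mem_rho (s.Bw l) (n := n) (u := Xm u1) Y.st_mem fun i hi => by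
        rw [DD_Xm]
        exact Xm_mem_Bw (h i hi _ _ _ hu).2.1
      refine hΛ L (le_max_right _ _) _ _ _ _
        (Bw_le_Bd _ (Bw_mono hlL ((s.Bw l).add_mem ((s.Bw l).add_mem l1 l2) l3)))
        (Bw_le_Bd _ (Bw_mono hlL ((s.Bw l).add_mem (sub_mem_of_CC l5 l4) l6))) ?_ ?_
      · have e := congrArg (DD 0 n) hu.e1
        rw [DD_dt, ← dt_DD, map_add, map_add, map_add, map_zero] at e
        rw [e, DD_Xp]
        ring
      · have e := congrArg (DD 0 n) hu.e2
        rw [DD_oneSubTau_mul, DD_dt, ← dt_DD, map_add, map_add, map_add, map_zero,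
          show -Y.pt * dr u2 = -(Y.pt * dr u2) by ring, map_neg] at e
        rw [e, DD_Xm]
        ring
    have hw : ∀ u0 u1 u2 : SF a, Y.Solves u0 u1 u2 0 0 0 →
        DD 0 n u1 ∈ s.Bw (L + 1) ∧ DD 0 n u2 ∈ s.Bw (L + 1) := fun u0 u1 u2 hu =>
      ⟨mem_Bw_of_Cas fun K => by
        rw [← DD_Cas_pow]
        exact (hlow _ _ _ (hu.cas_pow K)).1, mem_Bw_of_Cas fun K => by
        rw [← DD_Cas_pow]
        exact (hlow _ _ _ (hu.cas_pow K)).2⟩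
    have hw0 : ∀ u0 u1 u2 : SF a, Y.Solves u0 u1 u2 0 0 0 → DD 0 n u0 ∈ s.Bw (L + 1) := by
      intro u0 u1 u2 hu w
      have l1 := DD_mul_dr_sub_mem_rho (s.Bw l) (n := n) Y.p_mem fun i hi => (h i hi _ _ _ hu).1
      have l2 := DD_mul_sub_mem_rho (s.Bw l) (n := n) Y.v0_mem fun i hi => (h i hi _ _ _ hu).1
      have l3 : DD 0 n (Y.s * Xp u1) ∈ s.Bw (L + 1) :=
        DD_mul_mem _ Y.s_mem fun q hq i hi => by
          obtain rfl : q = 0 := by omega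
          rw [DD_Xp]
          rcases hi.lt_or_eq with hi | rfl
          · exact Xp_mem_Bw (Bw_mono (by linarith) (h i hi _ _ _ hu).2.1)
          · exact Xp_mem_Bw (hw _ _ _ hu).1
      have hk : Y.v0 + (n : SF a) * dr Y.p ∈ CC a :=
        add_mem Y.v0_mem (mul_mem hn (CC.dr_mem Y.p_mem))
      have hf := Bw_mono (by linarith : L + 1 ≤ L + 1 + 1) ((s.Bw (L + 1)).add_mem (Bw_mono
        (by linarith : l ≤ L + 1) ((s.Bw l).add_mem l1 l2)) l3)
      refine transport_regular (by linarith) Y.p_mem hk Y.star_p Y.Tr_p (fun x _ => Y.p_le x) ?_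
        (hf w)
      rw [dt_ZZ, dr_ZZ, ← ZZ_mul Y.p_mem.1, ← ZZ_mul hk.1, ← map_add, ← map_add]
      congr 1
      have e := congrArg (DD 0 n) hu.e0
      rw [DD_dt, ← dt_DD, map_add, map_add, map_add, map_zero] at e
      rw [e]
      ring
    refine ⟨L + 1, by linarith, fun i hi u0 u1 u2 hu => ?_⟩
    rcases (Nat.lt_succ_iff.1 hi).lt_or_eq with hi | rfl
    · obtain ⟨g0, g1, g2⟩ := h i hi _ _ _ hu
      have hle : l ≤ L + 1 := by linarith
      exact ⟨Bw_mono hle g0, Bw_mono hle g1, Bw_mono hle g2⟩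
    · exact ⟨hw0 _ _ _ hu, hw _ _ _ hu⟩

variable (s) in
/-- All derivatives blow up at most polynomially at `τ = 1`, uniformly in the number of angular
derivatives. -/
def Poly (u : SF a) : Prop := ∀ N : ℕ, ∃ l, ∀ q ≤ N, ∀ n ≤ N, DD q n u ∈ s.Bw l

theorem Poly.add {u v : SF a} (hu : s.Poly u) (hv : s.Poly v) : s.Poly (u + v) := fun N => by
  obtain ⟨l, hl⟩ := hu N
  obtain ⟨l', hl'⟩ := hv N
  refine ⟨max l l', fun q hq n hn => ?_⟩
  rw [map_add]
  exact (s.Bw _).add_mem (Bw_mono (le_max_left _ _) (hl q hq n hn))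
    (Bw_mono (le_max_right _ _) (hl' q hq n hn))

theorem Poly.mul {c u : SF a} (hc : c ∈ CC a) (hu : s.Poly u) : s.Poly (c * u) := fun N => by
  obtain ⟨l, hl⟩ := hu N
  exact ⟨l, fun q hq n hn => DD_mul_mem _ hc fun q' hq' n' hn' =>
    hl q' (hq'.trans hq) n' (hn'.trans hn)⟩

theorem Poly.neg {u : SF a} (hu : s.Poly u) : s.Poly (-u) := by
  have := Poly.mul (neg_mem (one_mem (CC a))) hu
  rwa [show -1 * u = -u by ring] at this

theorem Poly.sub {u v : SF a} (hu : s.Poly u) (hv : s.Poly v) : s.Poly (u - v) := by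
  rw [sub_eq_add_neg]
  exact hu.add hv.neg

theorem Poly.zero : s.Poly 0 := fun N => ⟨0, fun q _ n _ => by rw [map_zero]; exact zero_mem _⟩

theorem Poly.sum {ι : Type*} {S : Finset ι} {u : ι → SF a} (h : ∀ i ∈ S, s.Poly (u i)) :
    s.Poly (∑ i ∈ S, u i) := Finset.sum_induction _ _ (fun _ _ => Poly.add) Poly.zero h

theorem Poly.dt {u : SF a} (hu : s.Poly u) : s.Poly (dt u) := fun N => by
  obtain ⟨l, hl⟩ := hu (N + 1)
  exact ⟨l, fun q hq n hn => by rw [DD_dt]; exact hl _ (by omega) _ (by omega)⟩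

theorem Poly.dr {u : SF a} (hu : s.Poly u) : s.Poly (dr u) := fun N => by
  obtain ⟨l, hl⟩ := hu (N + 1)
  exact ⟨l, fun q hq n hn => by rw [DD_dr]; exact hl _ (by omega) _ (by omega)⟩

theorem Poly.DD {u : SF a} (hu : s.Poly u) (n : ℕ) : s.Poly (DD 0 n u) := by
  induction n with
  | zero => exact hu
  | succ n ih =>
    rw [← dr_DD]
    exact ih.dr

theorem Poly.Xp {u : SF a} (hu : s.Poly u) : s.Poly (Xp u) := fun N => by
  obtain ⟨l, hl⟩ := hu N
  exact ⟨l, fun q hq n hn => by rw [DD_Xp]; exact Xp_mem_Bw (hl _ hq _ hn)⟩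

theorem Poly.Xm {u : SF a} (hu : s.Poly u) : s.Poly (Xm u) := fun N => by
  obtain ⟨l, hl⟩ := hu N
  exact ⟨l, fun q hq n hn => by rw [DD_Xm]; exact Xm_mem_Bw (hl _ hq _ hn)⟩

theorem Poly.Tr {u : SF a} (hu : s.Poly u) : s.Poly (Tr u) := fun N => by
  obtain ⟨l, hl⟩ := hu (N + 1)
  refine ⟨l, fun q hq n hn => ?_⟩
  cases n with
  | zero =>
    rw [← Tr_DD]
    refine Tr_mem_Bw (hl q (by omega) 0 (by omega)) ?_
    rw [dr_DD]
    exact hl _ (by omega) _ (by omega)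
  | succ n =>
    rw [DD_Tr]
    exact zero_mem _

theorem poly_of_solves {Y : Sys a} {u0 u1 u2 : SF a} (h : Y.Solves u0 u1 u2 0 0 0) :
    s.Poly u0 ∧ s.Poly u1 ∧ s.Poly u2 := by
  have key : ∀ Q N : ℕ, ∃ l, ∀ q ≤ Q, ∀ n ≤ N,
      FGauge.DD q n u0 ∈ s.Bw l ∧ FGauge.DD q n u1 ∈ s.Bw l ∧ FGauge.DD q n u2 ∈ s.Bw l := by
    intro Q
    induction Q with
    | zero =>
      intro N
      obtain ⟨l, -, hl⟩ := crude_bound Y s (N + 1)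
      exact ⟨l, fun q hq n hn => by
        obtain rfl : q = 0 := by omega
        exact hl n (by omega) _ _ _ h⟩
    | succ Q ih =>
      intro N
      obtain ⟨l, hl⟩ := ih (N + 1)
      refine ⟨l + 2, fun q hq n hn => ?_⟩
      have hle : s.Bw l ≤ s.Bw (l + 2) := Bw_mono (by linarith)
      rcases hq.lt_or_eq with hq | rfl
      · obtain ⟨g0, g1, g2⟩ := hl q (by omega) n (by omega)
        exact ⟨hle g0, hle g1, hle g2⟩
      · have hX : ∀ {c u : SF a}, c ∈ CC a → (∀ q ≤ Q, ∀ n ≤ N + 1, FGauge.DD q n u ∈ s.Bw l) →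
            FGauge.DD Q n (c * u) ∈ s.Bw l := fun hc hu => DD_mul_mem _ hc
          fun q' hq' n' hn' => hu q' hq' n' (by omega)
        have hR : ∀ {c u : SF a}, c ∈ CC a → (∀ q ≤ Q, ∀ n ≤ N + 1, FGauge.DD q n u ∈ s.Bw l) →
            FGauge.DD Q n (c * FGauge.dr u) ∈ s.Bw l := fun hc hu => DD_mul_mem _ hc
          fun q' hq' n' hn' => by
            rw [DD_dr]
            exact hu q' hq' _ (by omega)
        refine ⟨hle ?_, hle ?_, mem_Bw_of_oneSubTau_mul ?_⟩
        · rw [← DD_dt, h.e0, add_zero, map_add, map_add]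
          exact (s.Bw l).add_mem ((s.Bw l).add_mem
            (hR Y.p_mem fun q hq n hn => (hl q hq n hn).1)
            (hX Y.v0_mem fun q hq n hn => (hl q hq n hn).1))
            (hX Y.s_mem fun q hq n hn => by rw [DD_Xp]; exact Xp_mem_Bw (hl q hq n hn).2.1)
        · rw [← DD_dt, h.e1, add_zero, map_add, map_add]
          exact (s.Bw l).add_mem ((s.Bw l).add_mem
            (hR Y.p_mem fun q hq n hn => (hl q hq n hn).2.1)
            (hX Y.v1_mem fun q hq n hn => (hl q hq n hn).2.1))
            (hX Y.s_mem fun q hq n hn => by rw [DD_Xp]; exact Xp_mem_Bw (hl q hq n hn).2.2)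
        · have e := DD_oneSubTau_dt Q n u2
          rw [dt_DD] at e
          have e' : oneSubTau * FGauge.DD (Q + 1) n u2 = FGauge.DD Q n (oneSubTau * FGauge.dt u2) +
              (Q : SF a) * FGauge.DD Q n u2 := by
            rw [e]
            ring
          rw [e', h.e2, add_zero, map_add, map_add]
          exact (s.Bw l).add_mem ((s.Bw l).add_mem ((s.Bw l).add_mem
            (hR (neg_mem Y.pt_mem) fun q hq n hn => (hl q hq n hn).2.2)
            (hX Y.v2_mem fun q hq n hn => (hl q hq n hn).2.2))
            (hX Y.st_mem fun q hq n hn => by rw [DD_Xm]; exact Xm_mem_Bw (hl q hq n hn).2.1))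
            (mul_mem_of_CC (natCast_mem (CC a) Q) (hl Q le_rfl n (by omega)).2.2)
  refine ⟨fun N => ?_, fun N => ?_, fun N => ?_⟩ <;> obtain ⟨l, hl⟩ := key N N
  · exact ⟨l, fun q hq n hn => (hl q hq n hn).1⟩
  · exact ⟨l, fun q hq n hn => (hl q hq n hn).2.1⟩
  · exact ⟨l, fun q hq n hn => (hl q hq n hn).2.2⟩

end Slice

/-! ### Functions that vanish to high order at `ρ = 0` -/

/-- The kernel of the restriction to `ρ = 0`, as a module over the coefficients. -/
def kerTr (a : ℝ) : Submodule (CC a) (SF a) where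
  carrier := {u | Tr u = 0}
  zero_mem' := map_zero _
  add_mem' {u v} hu hv := by
    change Tr (u + v) = 0
    rw [map_add, show Tr u = 0 from hu, show Tr v = 0 from hv, add_zero]
  smul_mem' c u hu := by
    change Tr (c.1 * u) = 0
    rw [map_mul, show Tr u = 0 from hu, mul_zero]

/-- `u` vanishes to order `p` at `ρ = 0`. -/
def Van (p : ℕ) (u : SF a) : Prop := ∀ i < p, Tr (DD 0 i u) = 0

theorem Van.mul {p : ℕ} {c u : SF a} (hc : c ∈ CC a) (hu : Van p u) : Van p (c * u) :=
  fun i hi => DD_mul_mem (kerTr a) hc fun q hq n hn => by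
    obtain rfl : q = 0 := by omega
    exact hu n (by omega)

theorem Van.sub {p : ℕ} {u v : SF a} (hu : Van p u) (hv : Van p v) : Van p (u - v) :=
  fun i hi => by rw [map_sub, map_sub, hu i hi, hv i hi, sub_zero]

theorem Van.dt {p : ℕ} {u : SF a} (hu : Van p u) : Van p (dt u) := fun i hi => by
  rw [DD_dt, ← dt_DD, Tr_dt, hu i hi, map_zero]

theorem Van.Xp {p : ℕ} {u : SF a} (hu : Van p u) : Van p (Xp u) := fun i hi => by
  rw [DD_Xp, Tr_Xp, hu i hi, map_zero]

theorem Van.Xm {p : ℕ} {u : SF a} (hu : Van p u) : Van p (Xm u) := fun i hi => by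
  rw [DD_Xm, Tr_Xm, hu i hi, map_zero]

theorem Van.mul_dr {p : ℕ} {c u : SF a} (hc : c ∈ CC a) (h0 : Tr c = 0) (hu : Van p u) :
    Van p (c * dr u) := fun i hi => by
  obtain ⟨k, hk, h⟩ := DD_mul_dr_eq i hc
  rw [h, map_add, map_add, map_mul, map_mul, h0, hu i hi, zero_mul, mul_zero, zero_add, zero_add,
    map_sum]
  refine Finset.sum_eq_zero fun j hj => ?_
  rw [map_mul, hu j ((Finset.mem_range.1 hj).trans hi), mul_zero]

theorem Van.Tr_DD {p : ℕ} {u : SF a} (hu : Van p u) (q : ℕ) {n : ℕ} (hn : n < p) :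
    Tr (DD q n u) = 0 := by
  rw [DD_split, FGauge.Tr_DD, hu n hn, map_zero]

theorem le_mul_rho {c : SF a} (h0 : Tr c = 0) {K : ℝ} {x : Pt a}
    (hb : ∀ y : Pt a, y.τ = x.τ → y.ρ ≤ x.ρ → ‖(dr c).1 y‖ ≤ K) : ‖c.1 x‖ ≤ K * x.ρ := by
  have ha : (0 : ℝ) ∈ Icc 0 x.ρ := ⟨le_rfl, x.hρ.1⟩
  have hsub : ∀ r ∈ Icc 0 x.ρ, r ∈ Ico 0 a := fun r hr => ⟨hr.1, hr.2.trans_lt x.hρ.2⟩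
  have h := (convex_Icc (0 : ℝ) x.ρ).norm_image_sub_le_of_norm_hasDerivWithin_le
    (f := fun r => zeroExt c.1 x.τ r x.g) (f' := fun r => zeroExt (dr c).1 x.τ r x.g) (C := K)
    (fun r hr => by
      rw [zeroExt_of_mem _ x.hτ (hsub r hr)]
      exact (hasDerivWithinAt_zeroExt_rho c ⟨x.τ, r, x.g, x.hτ, hsub r hr⟩).mono fun _ h => h.1)
    (fun r hr => by
      rw [zeroExt_of_mem _ x.hτ (hsub r hr)]
      exact hb _ rfl hr.2) ha ⟨x.hρ.1, le_rfl⟩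
  rw [zeroExt_of_mem _ x.hτ x.hρ, zeroExt_of_mem _ x.hτ (hsub 0 ha)] at h
  have e : c.1 ⟨x.τ, 0, x.g, x.hτ, hsub 0 ha⟩ = 0 := by
    rw [apply_eq_Tr rfl, h0]
    rfl
  rw [e, sub_zero, sub_zero, Real.norm_of_nonneg x.hρ.1] at h
  exact h

theorem exists_le_mul_rho {c : SF a} (hc : c ∈ CC a) (h0 : Tr c = 0) :
    ∃ K : ℝ, 0 ≤ K ∧ ∀ x, ‖c.1 x‖ ≤ K * x.ρ := by
  obtain ⟨K, hK, hb⟩ := CC.bound (CC.dr_mem hc)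
  exact ⟨K, hK, fun x => le_mul_rho h0 fun y _ _ => hb y⟩

/-! ### Improving the rate of blow up -/

/-- The derivatives `∂_τ^q ∂_ρ^n u` with `q ≤ m`, `q + n ≤ P` belong to `N`. -/
def Reg (N : Submodule (CC a) (SF a)) (m P : ℕ) (u : SF a) : Prop :=
  ∀ q n, q ≤ m → q + n ≤ P → DD q n u ∈ N

theorem Reg.mono {N N' : Submodule (CC a) (SF a)} (h : N ≤ N') {m P : ℕ} {u : SF a}
    (hu : Reg N m P u) : Reg N' m P u := fun q n hq hn => h (hu q n hq hn)

theorem Reg.mul {N : Submodule (CC a) (SF a)} {m P : ℕ} {c u : SF a} (hc : c ∈ CC a)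
    (hu : Reg N m P u) : Reg N m P (c * u) := fun q n hq hn =>
  DD_mul_mem N hc fun q' hq' n' hn' => hu q' n' (by omega) (by omega)

theorem DD_mul_dr_sub_mem (N : Submodule (CC a) (SF a)) {q n : ℕ} {c u : SF a} (hc : c ∈ CC a)
    (h : ∀ q' n', q' ≤ q → q' + n' ≤ q + n → DD q' n' u ∈ N) :
    DD q n (c * dr u) - c * dr (DD q n u) ∈ N := by
  obtain ⟨k, hk, e⟩ := DD_mul_eq_rho n hc
  have h1 : DD q 0 (c * DD 0 n (dr u)) - c * DD q 0 (DD 0 n (dr u)) ∈ N :=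
    DD_mul_sub_mem_tau N hc fun q' hq' => by
      rw [← DD_split, DD_dr]
      exact h _ _ hq'.le (by omega)
  have h2 : DD q 0 (∑ i ∈ Finset.range n, k i * DD 0 i (dr u)) ∈ N := by
    rw [map_sum]
    refine Submodule.sum_mem _ fun i hi => DD_mul_mem N (hk i) fun q' hq' n' hn' => ?_
    obtain rfl : n' = 0 := by omega
    rw [← DD_split, DD_dr]
    have := Finset.mem_range.1 hi
    exact h _ _ hq' (by omega)
  have e2 : DD q n (c * dr u) - c * dr (DD q n u) =
      (DD q 0 (c * DD 0 n (dr u)) - c * DD q 0 (DD 0 n (dr u))) +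
        DD q 0 (∑ i ∈ Finset.range n, k i * DD 0 i (dr u)) := by
    rw [DD_split q n (c * dr u), e, map_add, dr_DD, ← DD_split q n (dr u), DD_dr q n]
    ring
  rw [e2]
  exact N.add_mem h1 h2

/-- The equation satisfied by a derivative of a solution of the singular transport equation. -/
theorem exists_singular_eq (Y : Sys a) (n : ℕ) :
    ∃ k : ℕ → SF a, (∀ i, k i ∈ CC a) ∧ ∀ (N : Submodule (CC a) (SF a)) (q : ℕ) (u f : SF a),
      oneSubTau * dt u = -Y.pt * dr u + Y.v2 * u + f →
      (∀ q' < q, ∀ n' ≤ n + 1, DD q' n' u ∈ N) → DD q n f ∈ N →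
      ∃ f' ∈ N, oneSubTau * dt (DD q n u) = -Y.pt * dr (DD q n u) +
        ((q : SF a) + Y.v2 - (n : SF a) * dr Y.pt) * DD q n u +
        (f' + ∑ i ∈ Finset.range n, k i * DD q i u) := by
  obtain ⟨k1, hk1, e1⟩ := DD_mul_dr_eq n Y.pt_mem
  obtain ⟨k2, hk2, e2⟩ := DD_mul_eq_rho n Y.v2_mem
  refine ⟨fun i => k2 i - k1 i, fun i => sub_mem (hk2 i) (hk1 i),
    fun N q u f heq hlow hf => ?_⟩
  have hn : (n : SF a) * dr Y.pt ∈ CC a := mul_mem (natCast_mem (CC a) n) (CC.dr_mem Y.pt_mem)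
  have m1 := DD_mul_sub_mem_tau N (q := q) (c := Y.pt) (u := dr (DD 0 n u)) Y.pt_mem
    fun q' hq' => by
      rw [dr_DD, ← DD_split]
      exact hlow q' hq' _ le_rfl
  have m2 := DD_mul_sub_mem_tau N (q := q) (u := DD 0 n u) hn fun q' hq' => by
    rw [← DD_split]
    exact hlow q' hq' _ (by omega)
  have m3 := DD_mul_sub_mem_tau N (q := q) (u := DD 0 n u) Y.v2_mem fun q' hq' => by
    rw [← DD_split]
    exact hlow q' hq' _ (by omega)
  have m4 : ∑ i ∈ Finset.range n, (DD q 0 ((k2 i - k1 i) * DD 0 i u) -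
      (k2 i - k1 i) * DD q i u) ∈ N := Submodule.sum_mem _ fun i hi => by
    rw [DD_split q i]
    refine DD_mul_sub_mem_tau N (sub_mem (hk2 i) (hk1 i)) fun q' hq' => ?_
    rw [← DD_split]
    have := Finset.mem_range.1 hi
    exact hlow q' hq' _ (by omega)
  refine ⟨_, N.add_mem (N.add_mem (N.add_mem (neg_mem_of_CC (N.add_mem m1 m2)) m3) m4) hf, ?_⟩
  have h1 : DD q n (oneSubTau * dt u) = DD q 0 (DD 0 n (-Y.pt * dr u + Y.v2 * u)) + DD q n f := by
    rw [heq, map_add, ← DD_split]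
  have h2 : DD 0 n (-Y.pt * dr u + Y.v2 * u) = -(Y.pt * dr (DD 0 n u)) -
      (n : SF a) * dr Y.pt * DD 0 n u + Y.v2 * DD 0 n u +
      ∑ i ∈ Finset.range n, (k2 i - k1 i) * DD 0 i u := by
    rw [show -Y.pt * dr u = -(Y.pt * dr u) by ring, map_add, map_neg, e1, e2]
    simp only [sub_mul, Finset.sum_sub_distrib]
    ring
  rw [DD_oneSubTau_dt, h2, map_add, map_add, map_sub, map_neg, map_sum] at h1
  have h3 : DD q 0 (dr (DD 0 n u)) = dr (DD q n u) := by
    rw [dr_DD, ← DD_split, dr_DD]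
  have h4 : DD q 0 (DD 0 n u) = DD q n u := (DD_split q n u).symm
  rw [h3, h4, Finset.sum_sub_distrib]
  linear_combination h1

namespace Slice

variable {s : Slice a}

theorem mem_of_van {l : ℝ} {p q : ℕ} {u : SF a} (hu : Van p u) (h : DD q p u ∈ s.Bw l) :
    ∀ n ≤ p, DD q n u ∈ s.Bw l := by
  intro n hn
  induction hn using Nat.decreasingInduction with
  | self => exact h
  | of_succ n hn ih =>
    refine hardy_Bw (hu.Tr_DD q hn) ?_
    rwa [dr_DD]

theorem NN_ZZ_le_of_van {p q : ℕ} {u : SF a} (hu : Van p u) (hb : 4 * s.b ^ 2 ≤ 1)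
    (w : List (Fin 3)) {τ : ℝ} (hτ : τ ∈ Ico (0 : ℝ) 1) {n : ℕ} (hn : n < p) :
    s.NN τ (ZZ w (DD q n u)) ≤ 4 * s.b ^ 2 * s.NN τ (ZZ w (DD q p u)) := by
  have h0 : 0 ≤ 4 * s.b ^ 2 := by positivity
  have step : ∀ n < p, s.NN τ (ZZ w (DD q n u)) ≤ 4 * s.b ^ 2 * s.NN τ (ZZ w (DD q (n + 1) u)) :=
    fun n hn => by
      have := hardy (s := s) hτ (v := ZZ w (DD q n u)) (by rw [Tr_ZZ, hu.Tr_DD q hn, map_zero])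
      rwa [dr_ZZ, dr_DD] at this
  have key : ∀ n ≤ p, s.NN τ (ZZ w (DD q n u)) ≤ s.NN τ (ZZ w (DD q p u)) := by
    intro n hn
    induction hn using Nat.decreasingInduction with
    | self => exact le_rfl
    | of_succ n hn ih =>
      have h1 := step n hn
      have h2 := NN_nonneg (s := s) hτ (ZZ w (DD q (n + 1) u))
      nlinarith
  exact (step n hn).trans (mul_le_mul_of_nonneg_left (key _ hn) h0)

theorem NN_sum_le {τ : ℝ} (hτ : τ ∈ Ico (0 : ℝ) 1) (n : ℕ) (f : ℕ → SF a) :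
    s.NN τ (∑ i ∈ Finset.range n, f i) ≤ 2 ^ n * ∑ i ∈ Finset.range n, s.NN τ (f i) := by
  induction n with
  | zero => simp [NN_zero hτ]
  | succ n ih =>
    rw [Finset.sum_range_succ, Finset.sum_range_succ]
    have h1 := NN_add_le (s := s) hτ (∑ i ∈ Finset.range n, f i) (f n)
    have h2 := NN_nonneg (s := s) hτ (f n)
    have h3 : (1 : ℝ) ≤ 2 ^ n := one_le_pow₀ one_le_two
    rw [pow_succ]
    nlinarith

theorem improve_regular {Y : Sys a} {l : ℝ} (hl : 0 < l) {m P : ℕ} {u u' v F : SF a}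
    (hv : v ∈ CC a) (heq : dt u = Y.p * dr u + v * u + Y.s * Xp u' + F)
    (hu : Reg (s.Bw (l + 1)) m P u) (hu' : Reg (s.Bw (l + 1)) m P u')
    (hF : Reg (s.Bw (l + 1)) m P F) : Reg (s.Bw l) m P u := by
  intro q n hq hn
  have m1 := DD_mul_dr_sub_mem (s.Bw (l + 1)) (q := q) (n := n) (u := u) Y.p_mem
    fun q' n' hq' hn' => hu q' n' (by omega) (by omega)
  have m2 := hu.mul hv q n hq hn
  have m3 : DD q n (Y.s * Xp u') ∈ s.Bw (l + 1) := Reg.mul Y.s_mem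
    (fun q n hq hn => by rw [DD_Xp]; exact Xp_mem_Bw (hu' q n hq hn)) q n hq hn
  refine transport_regular_Bw hl Y.p_mem Y.star_p Y.Tr_p (fun x _ => Y.p_le x) ?_
    ((s.Bw (l + 1)).add_mem ((s.Bw (l + 1)).add_mem ((s.Bw (l + 1)).add_mem m1 m2) m3)
      (hF q n hq hn))
  rw [dt_DD, ← DD_dt, heq, map_add, map_add, map_add]
  ring

/-- The slice is so short that, in the equation for `∂_τ^q ∂_ρ^n φ₂`, the damping dominates the
lower order terms. -/
def Short (Y : Sys a) (m p : ℕ) (s : Slice a) : Prop :=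
  (∀ q ≤ m, ∀ n, p ≤ n → ∀ x : Pt a, x.ρ ≤ s.b →
    n ≤ p + m → ((dr Y.pt).1 x).re + 2 * (((q : SF a) + Y.v2 - (n : SF a) * dr Y.pt).1 x).re ≤
      -(5 / 2)) ∧
  ∀ (N : Submodule (CC a) (SF a)) (q : ℕ) (u f : SF a), Van p u →
      oneSubTau * dt u = -Y.pt * dr u + Y.v2 * u + f →
      (∀ q' < q, ∀ n' ≤ p + 1, DD q' n' u ∈ N) → DD q p f ∈ N →
      ∃ f' ∈ N, ∃ g : SF a, oneSubTau * dt (DD q p u) = -Y.pt * dr (DD q p u) +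
        ((q : SF a) + Y.v2 - (p : SF a) * dr Y.pt) * DD q p u + (f' + g) ∧
        ∀ w, ∀ τ ∈ Ico (0 : ℝ) 1, s.NN τ (ZZ w g) ≤ 1 / 4 * s.NN τ (ZZ w (DD q p u))

theorem exists_short (Y : Sys a) {m p : ℕ} (hp : m + 2 < p) :
    ∃ b₀ > 0, ∀ s : Slice a, s.b ≤ b₀ → Short Y m p s := by
  obtain ⟨k, hk, hsing⟩ := exists_singular_eq Y p
  have hKex : ∃ K : ℝ, 0 ≤ K ∧ ∀ i < p, ∀ x, ‖(k i).1 x‖ ≤ K := by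
    choose K hK0 hK using fun i => CC.bound (hk i)
    exact ⟨∑ i ∈ Finset.range p, K i, Finset.sum_nonneg fun i _ => hK0 i, fun i hi x =>
      (hK i x).trans (Finset.single_le_sum (fun i _ => hK0 i) (Finset.mem_range.2 hi))⟩
  obtain ⟨K, hK0, hK⟩ := hKex
  obtain ⟨K1, hK1, hb1⟩ := exists_le_mul_rho (c := dr Y.pt - 1)
    (sub_mem (CC.dr_mem Y.pt_mem) (one_mem _)) (by rw [map_sub, Y.Tr_dr_pt, map_one, sub_self])
  obtain ⟨K2, hK2, hb2⟩ := exists_le_mul_rho (c := Y.v2 - 1)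
    (sub_mem Y.v2_mem (one_mem _)) (by rw [map_sub, Y.Tr_v2, map_one, sub_self])
  set A : ℝ := 2 ^ p * p * K ^ 2 with hA
  set B : ℝ := 2 * (p + m) * K1 + 2 * K2 with hB
  have hA0 : 0 ≤ A := by positivity
  have hB0 : 0 ≤ B := by positivity
  set b₀ : ℝ := 1 / (2 + 16 * A + 2 * B) with hb₀
  have hD : 0 < 2 + 16 * A + 2 * B := by positivity
  have hb₀pos : 0 < b₀ := by positivity
  refine ⟨b₀, hb₀pos, fun s hs => ?_⟩
  have hsb := s.b_pos
  have hmul : s.b * (2 + 16 * A + 2 * B) ≤ 1 := by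
    have := mul_le_mul_of_nonneg_right hs hD.le
    rwa [hb₀, one_div, inv_mul_cancel₀ hD.ne'] at this
  have hbA : 0 ≤ s.b * A := by positivity
  have hbB : 0 ≤ s.b * B := by positivity
  have hb_half : s.b ≤ 1 / 2 := by nlinarith
  refine ⟨fun q hq n hn x hx hnm => ?_, fun N q u f hu heq hlow hf => ?_⟩
  · have e1 := (Complex.abs_re_le_norm _).trans (hb1 x)
    have e2 := (Complex.abs_re_le_norm _).trans (hb2 x)
    rw [SF.sub_apply, Complex.sub_re, SF.one_apply, Complex.one_re] at e1 e2
    have hv : (((q : SF a) + Y.v2 - (n : SF a) * dr Y.pt).1 x).re =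
        q + (Y.v2.1 x).re - n * ((dr Y.pt).1 x).re := by
      have : ((q : SF a) + Y.v2 - (n : SF a) * dr Y.pt).1 x =
          ((q : ℝ) : ℂ) + Y.v2.1 x - ((n : ℝ) : ℂ) * (dr Y.pt).1 x := by
        have h1 : ((n : SF a)).1 x = (n : ℂ) := by simp
        have h2 : ((q : SF a)).1 x = (q : ℂ) := by simp
        rw [SF.sub_apply, SF.add_apply, SF.mul_apply, h1, h2]
        push_cast
        rfl
      rw [this, Complex.sub_re, Complex.add_re, Complex.ofReal_re, Complex.re_ofReal_mul]
    rw [hv]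
    have f1 := abs_le.1 e1
    have f2 := abs_le.1 e2
    have r1 : K1 * x.ρ ≤ K1 * s.b := mul_le_mul_of_nonneg_left hx hK1
    have r2 : K2 * x.ρ ≤ K2 * s.b := mul_le_mul_of_nonneg_left hx hK2
    have hnp : (n : ℝ) ≤ p + m := by exact_mod_cast hnm
    have hqn : (q : ℝ) + 3 ≤ n := by
      have : q + 3 ≤ n := by omega
      exact_mod_cast this
    have hn1 : (1 : ℝ) ≤ n := by
      have : (0 : ℝ) ≤ q := Nat.cast_nonneg q
      linarith
    have g1 : (2 * (n : ℝ) - 1) * (1 - ((dr Y.pt).1 x).re) ≤ (2 * n - 1) * (K1 * s.b) :=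
      mul_le_mul_of_nonneg_left (by linarith) (by linarith)
    have g2 : (2 * (n : ℝ) - 1) * (K1 * s.b) ≤ (2 * (p + m)) * (K1 * s.b) :=
      mul_le_mul_of_nonneg_right (by linarith) (by positivity)
    have g3 : s.b * B = (2 * (p + m)) * (K1 * s.b) + 2 * (K2 * s.b) := by
      rw [hB]
      ring
    nlinarith
  · obtain ⟨f', hf', e⟩ := hsing N q u f heq hlow hf
    refine ⟨f', hf', _, e, fun w τ hτ => ?_⟩
    have hb4 : 4 * s.b ^ 2 ≤ 1 := by nlinarith
    rw [map_sum]
    refine (NN_sum_le hτ p _).trans ?_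
    have h1 : ∀ i ∈ Finset.range p, s.NN τ (ZZ w (k i * DD q i u)) ≤
        K ^ 2 * (4 * s.b ^ 2 * s.NN τ (ZZ w (DD q p u))) := fun i hi => by
      rw [ZZ_mul (hk i).1]
      have hi' := Finset.mem_range.1 hi
      exact (NN_mul_le hτ (hK i hi')).trans
        (mul_le_mul_of_nonneg_left (NN_ZZ_le_of_van hu hb4 w hτ hi') (sq_nonneg K))
    have h2 := mul_le_mul_of_nonneg_left (Finset.sum_le_sum h1) (by positivity : (0 : ℝ) ≤ 2 ^ p)
    rw [Finset.sum_const, Finset.card_range, nsmul_eq_mul] at h2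
    refine h2.trans ?_
    have h3 := NN_nonneg (s := s) hτ (ZZ w (DD q p u))
    have h4 : (2 : ℝ) ^ p * (p * (K ^ 2 * (4 * s.b ^ 2 * s.NN τ (ZZ w (DD q p u))))) =
        (4 * A * s.b ^ 2) * s.NN τ (ZZ w (DD q p u)) := by
      rw [hA]
      ring
    rw [h4]
    refine mul_le_mul_of_nonneg_right ?_ h3
    nlinarith

theorem improve_singular {Y : Sys a} {m p : ℕ} (hs : Short Y m p s) {l : ℝ} (hl : 0 ≤ l)
    {u u' G : SF a} (hu : Van p u)
    (heq : oneSubTau * dt u = -Y.pt * dr u + Y.v2 * u + Y.st * Xm u' + G)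
    (hu' : Reg (s.Bw l) m (p + m) u') (hG : Reg (s.Bw l) m (p + m) G) :
    Reg (s.Bw l) m (p + m) u := by
  have hf : Reg (s.Bw l) m (p + m) (Y.st * Xm u' + G) := fun q n hq hn => by
    rw [map_add]
    exact (s.Bw l).add_mem (Reg.mul Y.st_mem
      (fun q n hq hn => by rw [DD_Xm]; exact Xm_mem_Bw (hu' q n hq hn)) q n hq hn) (hG q n hq hn)
  rw [add_assoc] at heq
  have hκ : ∀ q n : ℕ, (q : SF a) + Y.v2 - (n : SF a) * dr Y.pt ∈ CC a := fun q n =>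
    sub_mem (add_mem (natCast_mem (CC a) q) Y.v2_mem)
      (mul_mem (natCast_mem (CC a) n) (CC.dr_mem Y.pt_mem))
  intro q
  induction q using Nat.strong_induction_on with
  | _ q ihq =>
    have hp' : q ≤ m → DD q p u ∈ s.Bw l := fun hq => by
      obtain ⟨f', hf', g, e, hg⟩ := hs.2 (s.Bw l) q u _ hu heq
        (fun q' hq' n' hn' => ihq q' hq' n' (by omega) (by omega)) (hf q p hq (by omega))
      exact transport_singular_Bw hl Y.pt_mem (hκ q p) Y.star_pt Y.Tr_pt
        (fun x _ => Y.pt_nonneg x) (fun x hx => hs.1 q hq p le_rfl x hx (by omega)) e hf' hg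
    intro n
    induction n using Nat.strong_induction_on with
    | _ n ihn =>
      intro hq hn
      rcases le_or_gt n p with h | h
      · exact mem_of_van hu (hp' hq) n h
      · obtain ⟨k, hk, hsing⟩ := exists_singular_eq Y n
        obtain ⟨f', hf', e⟩ := hsing (s.Bw l) q u _ heq
          (fun q' hq' n' hn' => ihq q' hq' n' (by omega) (by omega)) (hf q n hq hn)
        rw [← add_zero (f' + _)] at e
        refine transport_singular_Bw hl Y.pt_mem (hκ q n) Y.star_pt Y.Tr_pt
          (fun x _ => Y.pt_nonneg x) (fun x hx => hs.1 q hq n h.le x hx (by omega)) e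
          ((s.Bw l).add_mem hf' (Submodule.sum_mem _ fun i hi => mul_mem_of_CC (hk i) ?_)) ?_
        · have := Finset.mem_range.1 hi
          exact ihn i this hq (by omega)
        · intro w τ hτ
          rw [map_zero, NN_zero hτ]
          have := NN_nonneg (s := s) hτ (ZZ w (DD q n u))
          positivity

/-- If the sources blow up at most at the rate `l`, so do the derivatives of the solution, provided
the solution vanishes to order `p` at `ρ = 0` and has at most polynomial growth. -/
theorem reg_of_poly {Y : Sys a} {m p : ℕ} (hs : Short Y m p s) {l : ℝ} (hl : 0 < l)
    {u0 u1 u2 F0 F1 G : SF a} (h : Y.Solves u0 u1 u2 F0 F1 G) (hv : Van p u2)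
    (h0 : s.Poly u0) (h1 : s.Poly u1) (h2 : s.Poly u2)
    (hF0 : Reg (s.Bw l) m (p + m) F0) (hF1 : Reg (s.Bw l) m (p + m) F1)
    (hG : Reg (s.Bw l) m (p + m) G) :
    Reg (s.Bw l) m (p + m) u0 ∧ Reg (s.Bw l) m (p + m) u1 ∧ Reg (s.Bw l) m (p + m) u2 := by
  have hstart : ∃ L : ℕ, Reg (s.Bw (l + L)) m (p + m) u0 ∧ Reg (s.Bw (l + L)) m (p + m) u1 ∧
      Reg (s.Bw (l + L)) m (p + m) u2 := by
    obtain ⟨l0, hl0⟩ := h0 (p + m)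
    obtain ⟨l1, hl1⟩ := h1 (p + m)
    obtain ⟨l2, hl2⟩ := h2 (p + m)
    obtain ⟨L, hL⟩ := exists_nat_ge (max l0 (max l1 l2))
    have g0 : l0 ≤ l + L := by linarith [le_max_left l0 (max l1 l2)]
    have g1 : l1 ≤ l + L := by
      linarith [le_max_right l0 (max l1 l2), le_max_left l1 l2]
    have g2 : l2 ≤ l + L := by
      linarith [le_max_right l0 (max l1 l2), le_max_right l1 l2]
    exact ⟨L, fun q n hq hn => Bw_mono g0 (hl0 q (by omega) n (by omega)),
      fun q n hq hn => Bw_mono g1 (hl1 q (by omega) n (by omega)),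
      fun q n hq hn => Bw_mono g2 (hl2 q (by omega) n (by omega))⟩
  obtain ⟨L, hL⟩ := hstart
  induction L with
  | zero => simpa using hL
  | succ L ih =>
    apply ih
    obtain ⟨r0, r1, r2⟩ := hL
    have e : l + ((L + 1 : ℕ) : ℝ) = (l + L) + 1 := by push_cast; ring
    rw [e] at r0 r1 r2
    have hL0 : 0 < l + L := by positivity
    have hle : s.Bw l ≤ s.Bw (l + L + 1) := Bw_mono (by linarith [Nat.cast_nonneg (α := ℝ) L])
    have hle' : s.Bw l ≤ s.Bw (l + L) := Bw_mono (by linarith [Nat.cast_nonneg (α := ℝ) L])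
    have n1 := improve_regular hL0 Y.v1_mem h.e1 r1 r2 (hF1.mono hle)
    exact ⟨improve_regular hL0 Y.v0_mem h.e0 r0 r1 (hF0.mono hle), n1,
      improve_singular hs hL0.le hv h.e2 n1 (hG.mono hle')⟩

/-! ### The Taylor part and the remainder -/

theorem reg_of_bounded {m p : ℕ} {F : SF a} (hF : s.Poly F) (hv : Van p F)
    (hb : ∀ q j, q + j ≤ m → DD q (p + j) F ∈ s.Bd 0) {ε : ℝ} (hε : 0 < ε) :
    Reg (s.Bw ε) m (p + m) F := by
  obtain ⟨l, hl⟩ := hF (p + m)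
  have htop : ∀ q j, q + j ≤ m → DD q (p + j) F ∈ s.Bw ε := fun q j h =>
    mem_Bw_of_bounded (hb q j h) (hl q (by omega) _ (by omega)) hε
  intro q n hq hn
  rcases le_or_gt n p with h | h
  · exact mem_of_van hv (htop q 0 hq) n h
  · obtain ⟨j, rfl⟩ := Nat.exists_eq_add_of_lt h
    exact htop q (j + 1) (by omega)

end Slice

/-- The Taylor polynomial of degree less than `p` in `ρ`. -/
def taylor (p : ℕ) (u : SF a) : SF a :=
  ∑ l ∈ Finset.range p, ((1 / (l.factorial : ℂ)) • rho ^ l) * Tr (DD 0 l u)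

theorem rho_pow_mem (l : ℕ) : ((1 / (l.factorial : ℂ)) • (rho : SF a) ^ l) ∈ CC a :=
  (CC a).smul_mem (pow_mem rho_mem l) _

theorem dr_rho_pow (l : ℕ) : dr ((1 / ((l + 1).factorial : ℂ)) • (rho : SF a) ^ (l + 1)) =
    (1 / (l.factorial : ℂ)) • rho ^ l := by
  rw [Derivation.map_smul, Derivation.leibniz_pow, dr_rho, Nat.add_sub_cancel, smul_eq_mul, mul_one,
    ← Nat.cast_smul_eq_nsmul ℂ, smul_smul, Nat.factorial_succ]
  congr 1
  have h1 : (l.factorial : ℂ) ≠ 0 := by exact_mod_cast l.factorial_ne_zero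
  have h2 : ((l : ℂ) + 1) ≠ 0 := by exact_mod_cast l.succ_ne_zero
  push_cast
  field_simp

theorem dr_taylor (p : ℕ) (u : SF a) : dr (taylor (p + 1) u) = taylor p (dr u) := by
  rw [taylor, taylor, map_sum, Finset.sum_range_succ']
  have h : ∀ (c v : SF a), dr (c * Tr v) = dr c * Tr v := fun c v => by
    rw [Derivation.leibniz, dr_Tr, smul_zero, zero_add, smul_eq_mul, mul_comm]
  simp only [h, dr_rho_pow, pow_zero]
  have h1 : dr ((1 / ((0 : ℕ).factorial : ℂ)) • (1 : SF a)) = 0 := by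
    rw [Derivation.map_smul, Derivation.map_one_eq_zero, smul_zero]
  rw [h1, zero_mul, add_zero]
  simp only [DD_dr]

theorem DD_taylor (p : ℕ) (u : SF a) : DD 0 p (taylor p u) = 0 := by
  induction p generalizing u with
  | zero => simp [taylor]
  | succ p ih => rw [← DD_dr, dr_taylor, ih]

theorem Tr_taylor (p : ℕ) (u : SF a) : Tr (taylor (p + 1) u) = Tr u := by
  rw [taylor, Finset.sum_range_succ', map_add, map_sum, Finset.sum_eq_zero]
  · simp [Tr_Tr]
  · intro i _
    rw [map_mul, map_smul, map_pow, Tr_rho, zero_pow i.succ_ne_zero, smul_zero, zero_mul]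

theorem van_sub_taylor (p : ℕ) (u : SF a) : Van p (u - taylor p u) := by
  induction p generalizing u with
  | zero => exact fun i hi => absurd hi (Nat.not_lt_zero i)
  | succ p ih =>
    intro i hi
    cases i with
    | zero => rw [DD_zero, map_sub, Tr_taylor, sub_self]
    | succ i =>
      rw [← DD_dr, map_sub, dr_taylor]
      exact ih (dr u) i (by omega)

theorem Slice.Poly.taylor {s : Slice a} {u : SF a} (h : s.Poly u) (p : ℕ) :
    s.Poly (taylor p u) :=
  Slice.Poly.sum fun l _ => Slice.Poly.mul (rho_pow_mem l) (h.DD l).Tr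

/-- The contribution of a pair of functions to the divided equation for `∂_τ φ₀`. -/
def Sys.src0 (Y : Sys a) (u0 u1 : SF a) : SF a := dt u0 - (Y.p * dr u0 + Y.v0 * u0 + Y.s * Xp u1)
/-- The contribution of a pair of functions to the divided equation for `∂_τ φ₁`. -/
def Sys.src1 (Y : Sys a) (u1 u2 : SF a) : SF a := dt u1 - (Y.p * dr u1 + Y.v1 * u1 + Y.s * Xp u2)
/-- The contribution of a pair of functions to the divided equation for `(1 - τ) ∂_τ φ₂`. -/
def Sys.src2 (Y : Sys a) (u1 u2 : SF a) : SF a :=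
  oneSubTau * dt u2 - (-Y.pt * dr u2 + Y.v2 * u2 + Y.st * Xm u1)

/-- If the contributions of the Taylor part of a solution to the equations, multiplied by
non-vanishing coefficients, have bounded derivatives, then the derivatives of the remainder are
square integrable over the slices, up to an arbitrarily small power of `1 - τ`. -/
theorem Slice.reg_remainder {Y : Sys a} {s : Slice a} {m p : ℕ} (hs : s.Short Y m p)
    {u0 u1 u2 : SF a} (h : Y.Solves u0 u1 u2 0 0 0) {d d' e e' : SF a} (hd : d ∈ CC a) (hd' : d' ∈ CC a)
    (hdd : d' * d = 1) (he : e ∈ CC a) (he' : e' ∈ CC a) (hee : e' * e = 1)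
    (hb0 : ∀ q j, q + j ≤ m →
      DD q (p + j) (d * Y.src0 (taylor p u0) (taylor p u1)) ∈ s.Bd 0)
    (hb1 : ∀ q j, q + j ≤ m →
      DD q (p + j) (d * Y.src1 (taylor p u1) (taylor p u2)) ∈ s.Bd 0)
    (hb2 : ∀ q j, q + j ≤ m →
      DD q (p + j) (e * Y.src2 (taylor p u1) (taylor p u2)) ∈ s.Bd 0) {ε : ℝ} (hε : 0 < ε) :
    Reg (s.Bw ε) m (p + m) (u0 - taylor p u0) ∧ Reg (s.Bw ε) m (p + m) (u1 - taylor p u1) ∧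
      Reg (s.Bw ε) m (p + m) (u2 - taylor p u2) := by
  obtain ⟨p0, p1, p2⟩ := poly_of_solves (s := s) h
  set t0 := FGauge.taylor p u0 with ht0
  set t1 := FGauge.taylor p u1 with ht1
  set t2 := FGauge.taylor p u2 with ht2
  have q0 : s.Poly t0 := p0.taylor p
  have q1 : s.Poly t1 := p1.taylor p
  have q2 : s.Poly t2 := p2.taylor p
  have w0 : Van p (u0 - t0) := van_sub_taylor p u0
  have w1 : Van p (u1 - t1) := van_sub_taylor p u1
  have w2 : Van p (u2 - t2) := van_sub_taylor p u2
  have hnpt : -Y.pt ∈ CC a := neg_mem Y.pt_mem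
  have hneg : (-1 : SF a) ∈ CC a := neg_mem (one_mem _)
  -- the remainder solves the system with the negative of the contribution of the Taylor part
  have hsol : Y.Solves (u0 - t0) (u1 - t1) (u2 - t2) (-1 * Y.src0 t0 t1) (-1 * Y.src1 t1 t2)
      (-1 * Y.src2 t1 t2) := by
    constructor
    · simp only [map_sub, Sys.src0, h.e0]
      ring
    · simp only [map_sub, Sys.src1, h.e1]
      ring
    · have := h.e2
      simp only [map_sub, Sys.src2, mul_sub, this]
      ring
  have y0 : s.Poly (Y.src0 t0 t1) := q0.dt.sub (((Poly.mul Y.p_mem q0.dr).add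
    (Poly.mul Y.v0_mem q0)).add (Poly.mul Y.s_mem q1.Xp))
  have y1 : s.Poly (Y.src1 t1 t2) := q1.dt.sub (((Poly.mul Y.p_mem q1.dr).add
    (Poly.mul Y.v1_mem q1)).add (Poly.mul Y.s_mem q2.Xp))
  have y2 : s.Poly (Y.src2 t1 t2) := (Poly.mul oneSubTau_mem q2.dt).sub
    (((Poly.mul hnpt q2.dr).add (Poly.mul Y.v2_mem q2)).add (Poly.mul Y.st_mem q1.Xm))
  have z0 : Van p (Y.src0 t0 t1) := by
    have e := ((w0.dt.sub (w0.mul_dr Y.p_mem Y.Tr_p)).sub (w0.mul Y.v0_mem)).sub (w1.Xp.mul Y.s_mem)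
    have e2 : dt (u0 - t0) - Y.p * dr (u0 - t0) - Y.v0 * (u0 - t0) - Y.s * FGauge.Xp (u1 - t1) =
        -1 * Y.src0 t0 t1 := by
      rw [hsol.e0]
      ring
    rw [e2] at e
    have := e.mul hneg
    rwa [show -1 * (-1 * Y.src0 t0 t1) = Y.src0 t0 t1 by ring] at this
  have z1 : Van p (Y.src1 t1 t2) := by
    have e := ((w1.dt.sub (w1.mul_dr Y.p_mem Y.Tr_p)).sub (w1.mul Y.v1_mem)).sub (w2.Xp.mul Y.s_mem)
    have e2 : dt (u1 - t1) - Y.p * dr (u1 - t1) - Y.v1 * (u1 - t1) - Y.s * FGauge.Xp (u2 - t2) =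
        -1 * Y.src1 t1 t2 := by
      rw [hsol.e1]
      ring
    rw [e2] at e
    have := e.mul hneg
    rwa [show -1 * (-1 * Y.src1 t1 t2) = Y.src1 t1 t2 by ring] at this
  have z2 : Van p (Y.src2 t1 t2) := by
    have e := (((w2.dt.mul oneSubTau_mem).sub
      (w2.mul_dr hnpt (by rw [map_neg, Y.Tr_pt, neg_zero]))).sub (w2.mul Y.v2_mem)).sub
        (w1.Xm.mul Y.st_mem)
    have e2 : oneSubTau * dt (u2 - t2) - -Y.pt * dr (u2 - t2) - Y.v2 * (u2 - t2) -
        Y.st * FGauge.Xm (u1 - t1) = -1 * Y.src2 t1 t2 := by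
      rw [hsol.e2]
      ring
    rw [e2] at e
    have := e.mul hneg
    rwa [show -1 * (-1 * Y.src2 t1 t2) = Y.src2 t1 t2 by ring] at this
  have key : ∀ {c c' F : SF a}, c ∈ CC a → c' ∈ CC a → c' * c = 1 → s.Poly F → Van p F →
      (∀ q j, q + j ≤ m → FGauge.DD q (p + j) (c * F) ∈ s.Bd 0) →
      Reg (s.Bw ε) m (p + m) (-1 * F) := by
    intro c c' F hc hc' hcc hF hv hb
    have h1 := (reg_of_bounded (Poly.mul hc hF) (hv.mul hc) hb hε).mul (mul_mem hneg hc')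
    rwa [show -1 * c' * (c * F) = (c' * c) * (-1 * F) by ring, hcc, one_mul] at h1
  exact reg_of_poly hs hε hsol w2 (p0.sub q0) (p1.sub q1) (p2.sub q2)
    (key hd hd' hdd y0 z0 hb0) (key hd hd' hdd y1 z1 hb1) (key he he' hee y2 z2 hb2)

/-! ### Analytic functions as coefficients -/

/-- Functions of `(τ, ρ)` that are analytic on `[-1, 1] × [0, A)`. -/
def Ana (A : ℝ) (f : ℝ × ℝ → ℝ) : Prop := AnalyticOnNhd ℝ f (Icc (-1) 1 ×ˢ Ico 0 A)

/-- `∂_τ` of a function of `(τ, ρ)`. -/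
def pd1 (f : ℝ × ℝ → ℝ) : ℝ × ℝ → ℝ := fun y => fderiv ℝ f y (1, 0)

/-- `∂_ρ` of a function of `(τ, ρ)`. -/
def pd2 (f : ℝ × ℝ → ℝ) : ℝ × ℝ → ℝ := fun y => fderiv ℝ f y (0, 1)

theorem mem_Icc_of_Ico {τ : ℝ} (h : τ ∈ Ico (0 : ℝ) 1) : τ ∈ Icc (-1 : ℝ) 1 :=
  ⟨by linarith [h.1], h.2.le⟩

namespace Ana

variable {A : ℝ} {f : ℝ × ℝ → ℝ}

theorem pd1 (h : Ana A f) : Ana A (pd1 f) :=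
  (ContinuousLinearMap.apply ℝ ℝ ((1, 0) : ℝ × ℝ)).comp_analyticOnNhd h.fderiv

theorem pd2 (h : Ana A f) : Ana A (pd2 f) :=
  (ContinuousLinearMap.apply ℝ ℝ ((0, 1) : ℝ × ℝ)).comp_analyticOnNhd h.fderiv

theorem contDiffOn (h : Ana A f) (ha : a ≤ A) : ContDiffOn ℝ ∞ f (Ico 0 1 ×ˢ Ico 0 a) :=
  fun y hy => (h y ⟨mem_Icc_of_Ico hy.1, hy.2.1, hy.2.2.trans_le ha⟩).contDiffAt.contDiffWithinAt

theorem hasDerivAt1 (h : Ana A f) {τ ρ : ℝ} (hτ : τ ∈ Icc (-1 : ℝ) 1) (hρ : ρ ∈ Ico 0 A) :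
    HasDerivAt (fun t => f (t, ρ)) (FGauge.pd1 f (τ, ρ)) τ :=
  (h (τ, ρ) ⟨hτ, hρ⟩).differentiableAt.hasFDerivAt.comp_hasDerivAt τ
    ((hasDerivAt_id τ).prodMk (hasDerivAt_const τ ρ))

theorem hasDerivAt2 (h : Ana A f) {τ ρ : ℝ} (hτ : τ ∈ Icc (-1 : ℝ) 1) (hρ : ρ ∈ Ico 0 A) :
    HasDerivAt (fun r => f (τ, r)) (FGauge.pd2 f (τ, ρ)) ρ :=
  (h (τ, ρ) ⟨hτ, hρ⟩).differentiableAt.hasFDerivAt.comp_hasDerivAt ρ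
    ((hasDerivAt_const ρ τ).prodMk (hasDerivAt_id ρ))

theorem exists_bound (h : Ana A f) (ha : a < A) :
    ∃ K : ℝ, ∀ τ ∈ Icc (-1 : ℝ) 1, ∀ ρ ∈ Icc 0 a, ‖f (τ, ρ)‖ ≤ K := by
  obtain ⟨K, hK⟩ := (isCompact_Icc.prod isCompact_Icc :
    IsCompact (Icc (-1 : ℝ) 1 ×ˢ Icc 0 a)).exists_bound_of_continuousOn
    (f := f) (h.continuousOn.mono fun y hy => ⟨hy.1, hy.2.1, hy.2.2.trans_lt ha⟩)
  exact ⟨K, fun τ hτ ρ hρ => hK (τ, ρ) ⟨hτ, hρ⟩⟩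

theorem dt_rad (h : Ana A f) (ha : a ≤ A) :
    dt (rad f (h.contDiffOn ha)) = rad (FGauge.pd1 f) (h.pd1.contDiffOn ha) := by
  ext x
  exact dt_rad_apply _ (h.hasDerivAt1 (mem_Icc_of_Ico x.hτ)
    ⟨x.hρ.1, x.hρ.2.trans_le ha⟩).hasDerivWithinAt

theorem dr_rad (h : Ana A f) (ha : a ≤ A) :
    dr (rad f (h.contDiffOn ha)) = rad (FGauge.pd2 f) (h.pd2.contDiffOn ha) := by
  ext x
  exact dr_rad_apply _ (h.hasDerivAt2 (mem_Icc_of_Ico x.hτ)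
    ⟨x.hρ.1, x.hρ.2.trans_le ha⟩).hasDerivWithinAt

theorem rad_mem (h : Ana A f) (ha : a < A) : rad f (h.contDiffOn ha.le) ∈ CC a := by
  refine ⟨dz_rad _, fun n => ?_⟩
  induction n generalizing f with
  | zero =>
    obtain ⟨K, hK⟩ := h.exists_bound ha
    exact ⟨K, fun x => by
      rw [rad_apply, Complex.norm_real]
      exact hK _ (mem_Icc_of_Ico x.hτ) _ ⟨x.hρ.1, x.hρ.2.le⟩⟩
  | succ n ih =>
    obtain ⟨K, hK⟩ := h.exists_bound ha
    refine ⟨⟨K, fun x => by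
      rw [rad_apply, Complex.norm_real]
      exact hK _ (mem_Icc_of_Ico x.hτ) _ ⟨x.hρ.1, x.hρ.2.le⟩⟩, ?_, ?_⟩
    · rw [h.dt_rad ha.le]
      exact ih h.pd1
    · rw [h.dr_rad ha.le]
      exact ih h.pd2

end Ana

/-- Differentiation under the integral sign for an analytic integrand. -/
theorem hasDerivAt_integral_of_analytic {g : ℝ × ℝ → ℝ} {x₀ : ℝ}
    (h : ∀ s ∈ Icc (0 : ℝ) 1, AnalyticAt ℝ g (x₀, s)) :
    HasDerivAt (fun x => ∫ s in (0 : ℝ)..1, g (x, s))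
      (∫ s in (0 : ℝ)..1, fderiv ℝ g (x₀, s) (1, 0)) x₀ := by
  obtain ⟨U, V, hU, -, hxU, hV, hUV⟩ := generalized_tube_lemma (isCompact_singleton (x := x₀))
    (isCompact_Icc (a := (0 : ℝ)) (b := 1)) (isOpen_analyticAt ℝ g) (fun y hy => by
      obtain ⟨h1, h2⟩ := hy
      rw [mem_singleton_iff] at h1
      have := h y.2 h2
      rwa [← h1] at this)
  have hx₀ : x₀ ∈ U := hxU rfl
  obtain ⟨δ, hδ, hball⟩ := Metric.nhds_basis_closedBall.mem_iff.1 (hU.mem_nhds hx₀)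
  have hAn : ∀ x ∈ Metric.closedBall x₀ δ, ∀ s ∈ Icc (0 : ℝ) 1, AnalyticAt ℝ g (x, s) :=
    fun x hx s hs => hUV ⟨hball hx, hV hs⟩
  have hcont : ∀ x ∈ Metric.closedBall x₀ δ, ContinuousOn (fun s => g (x, s)) (Icc 0 1) :=
    fun x hx s hs => ((hAn x hx s hs).continuousAt.comp
      (continuousAt_const.prodMk continuousAt_id)).continuousWithinAt
  have hcont' : ContinuousOn (fun y : ℝ × ℝ => fderiv ℝ g y (1, 0))
      (Metric.closedBall x₀ δ ×ˢ Icc 0 1) := fun y hy =>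
    ((hAn y.1 hy.1 y.2 hy.2).fderiv.continuousAt.clm_apply continuousAt_const).continuousWithinAt
  obtain ⟨K, hK⟩ := ((isCompact_closedBall x₀ δ).prod
    (isCompact_Icc (a := (0 : ℝ)) (b := 1))).exists_bound_of_continuousOn hcont'
  have hmem : x₀ ∈ Metric.closedBall x₀ δ := Metric.mem_closedBall_self hδ.le
  have hI : uIoc (0 : ℝ) 1 ⊆ Icc 0 1 := by
    rw [uIoc_of_le zero_le_one]
    exact Ioc_subset_Icc_self
  have hmeas : ∀ {φ : ℝ → ℝ}, ContinuousOn φ (Icc 0 1) →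
      AEStronglyMeasurable φ (volume.restrict (uIoc (0 : ℝ) 1)) := fun hφ =>
    (hφ.mono hI).aestronglyMeasurable measurableSet_uIoc
  refine (intervalIntegral.hasDerivAt_integral_of_dominated_loc_of_deriv_le
    (F := fun x s => g (x, s)) (F' := fun x s => fderiv ℝ g (x, s) (1, 0))
    (Metric.closedBall_mem_nhds x₀ hδ) ?_ ?_ ?_ (bound := fun _ => K) ?_ ?_ ?_).2
  · filter_upwards [Metric.closedBall_mem_nhds x₀ hδ] with x hx
    exact hmeas (hcont x hx)
  · exact ContinuousOn.intervalIntegrable (by rw [uIcc_of_le zero_le_one]; exact hcont x₀ hmem)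
  · exact hmeas (hcont'.comp (continuousOn_const.prodMk continuousOn_id) fun s hs => ⟨hmem, hs⟩)
  · exact Filter.Eventually.of_forall fun s hs x hx => hK (x, s) ⟨hx, hI hs⟩
  · exact intervalIntegrable_const
  · exact Filter.Eventually.of_forall fun s hs x hx =>
      (hAn x hx s (hI hs)).differentiableAt.hasFDerivAt.comp_hasDerivAt x
        ((hasDerivAt_id x).prodMk (hasDerivAt_const x s))

/-- The averages `∫₀¹ s^q k (1 - s (1 - τ), ρ) ds`. They arise from the division by `1 - τ` of a
function that vanishes at `τ = 1`. -/
def avg (q : ℕ) (k : ℝ × ℝ → ℝ) (y : ℝ × ℝ) : ℝ :=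
  ∫ s in (0 : ℝ)..1, s ^ q * k (1 - s * (1 - y.1), y.2)

theorem avg_mem {s τ : ℝ} (hs : s ∈ Icc (0 : ℝ) 1) (hτ : τ ∈ Ico (0 : ℝ) 1) :
    1 - s * (1 - τ) ∈ Icc (-1 : ℝ) 1 := by
  have h1 : 0 ≤ 1 - τ := by linarith [hτ.2]
  have h2 : 1 - τ ≤ 1 := by linarith [hτ.1]
  constructor <;> nlinarith [hs.1, hs.2, mul_nonneg hs.1 h1]

section avg

variable {A : ℝ} {k : ℝ × ℝ → ℝ}

theorem hasDerivAt_avg1 (h : Ana A k) (q : ℕ) {τ ρ : ℝ} (hτ : τ ∈ Ico (0 : ℝ) 1)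
    (hρ : ρ ∈ Ico 0 A) :
    HasDerivAt (fun t => avg q k (t, ρ)) (avg (q + 1) (pd1 k) (τ, ρ)) τ := by
  have hk : ∀ s ∈ Icc (0 : ℝ) 1, AnalyticAt ℝ k (1 - s * (1 - τ), ρ) := fun s hs =>
    h _ ⟨avg_mem hs hτ, hρ⟩
  have hg : ∀ s ∈ Icc (0 : ℝ) 1, AnalyticAt ℝ
      (fun y : ℝ × ℝ => y.2 ^ q * k (1 - y.2 * (1 - y.1), ρ)) (τ, s) := fun s hs => by
    refine (analyticAt_snd.pow q).mul ?_
    refine AnalyticAt.fun_comp (f := fun y : ℝ × ℝ => ((1 - y.2 * (1 - y.1), ρ) : ℝ × ℝ))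
      (hk s hs) ((analyticAt_const.sub (analyticAt_snd.mul
        (analyticAt_const.sub analyticAt_fst))).prod analyticAt_const)
  have h1 := hasDerivAt_integral_of_analytic hg
  refine h1.congr_deriv (intervalIntegral.integral_congr fun s hs => ?_)
  rw [uIcc_of_le zero_le_one] at hs
  have h2 := (hg s hs).differentiableAt.hasFDerivAt.comp_hasDerivAt τ
    ((hasDerivAt_id τ).prodMk (hasDerivAt_const τ s))
  have h3 : HasDerivAt (fun t : ℝ => 1 - s * (1 - t)) s τ := by
    have := (((hasDerivAt_id τ).const_sub 1).const_mul s).const_sub 1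
    simpa using this
  have h4 := ((h.hasDerivAt1 (avg_mem hs hτ) hρ).comp τ h3).const_mul (s ^ q)
  have h5 := h2.unique h4
  exact h5.trans (by simp only []; ring)

theorem hasDerivAt_avg2 (h : Ana A k) (q : ℕ) {τ ρ : ℝ} (hτ : τ ∈ Ico (0 : ℝ) 1)
    (hρ : ρ ∈ Ico 0 A) :
    HasDerivAt (fun r => avg q k (τ, r)) (avg q (pd2 k) (τ, ρ)) ρ := by
  have hk : ∀ s ∈ Icc (0 : ℝ) 1, AnalyticAt ℝ k (1 - s * (1 - τ), ρ) := fun s hs =>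
    h _ ⟨avg_mem hs hτ, hρ⟩
  have hg : ∀ s ∈ Icc (0 : ℝ) 1, AnalyticAt ℝ
      (fun y : ℝ × ℝ => y.2 ^ q * k (1 - y.2 * (1 - τ), y.1)) (ρ, s) := fun s hs => by
    refine (analyticAt_snd.pow q).mul ?_
    refine AnalyticAt.fun_comp (f := fun y : ℝ × ℝ => ((1 - y.2 * (1 - τ), y.1) : ℝ × ℝ))
      (hk s hs) ((analyticAt_const.sub (analyticAt_snd.mul analyticAt_const)).prod analyticAt_fst)
  have h1 := hasDerivAt_integral_of_analytic hg
  refine h1.congr_deriv (intervalIntegral.integral_congr fun s hs => ?_)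
  rw [uIcc_of_le zero_le_one] at hs
  have h2 := (hg s hs).differentiableAt.hasFDerivAt.comp_hasDerivAt ρ
    ((hasDerivAt_id ρ).prodMk (hasDerivAt_const ρ s))
  exact h2.unique ((h.hasDerivAt2 (avg_mem hs hτ) hρ).const_mul (s ^ q))

theorem bddTo_avg (ha : a < A) (n q : ℕ) (h : Ana A k) {u : SF a}
    (hu : ∀ x, u.1 x = avg q k (x.τ, x.ρ)) : BddTo n u := by
  have hb : ∀ {q : ℕ} {k : ℝ × ℝ → ℝ}, Ana A k → ∀ {u : SF a},
      (∀ x, u.1 x = avg q k (x.τ, x.ρ)) → ∃ K : ℝ, ∀ x, ‖u.1 x‖ ≤ K := by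
    intro q k h u hu
    obtain ⟨K, hK⟩ := h.exists_bound ha
    refine ⟨K, fun x => ?_⟩
    rw [hu, Complex.norm_real, avg]
    refine (intervalIntegral.norm_integral_le_of_norm_le_const (C := K) fun s hs => ?_).trans ?_
    · rw [uIoc_of_le zero_le_one] at hs
      have hs' : s ∈ Icc (0 : ℝ) 1 := ⟨hs.1.le, hs.2⟩
      rw [norm_mul, norm_pow, Real.norm_of_nonneg hs'.1]
      have h1 := hK _ (avg_mem hs' x.hτ) _ ⟨x.hρ.1, x.hρ.2.le⟩
      have h2 : s ^ q ≤ 1 := pow_le_one₀ hs'.1 hs'.2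
      have h3 : 0 ≤ s ^ q := pow_nonneg hs'.1 q
      nlinarith [norm_nonneg (k (1 - s * (1 - x.τ), x.ρ))]
    · simp
  induction n generalizing q k u with
  | zero => exact hb h hu
  | succ n ih =>
    refine ⟨hb h hu, ih (q + 1) h.pd1 fun x => ?_, ih q h.pd2 fun x => ?_⟩
    · exact dt_apply_eq (φ := fun t => (avg q k (t, x.ρ) : ℂ))
        (hasDerivAt_avg1 h q x.hτ ⟨x.hρ.1, x.hρ.2.trans ha⟩).hasDerivWithinAt.ofReal_comp
        fun t ht => hu _
    · exact dr_apply_eq (φ := fun r => (avg q k (x.τ, r) : ℂ))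
        (hasDerivAt_avg2 h q x.hτ ⟨x.hρ.1, x.hρ.2.trans ha⟩).hasDerivWithinAt.ofReal_comp
        fun t ht => hu _

end avg

/-! ### The Schwarzschild background -/

theorem eq_zero_of_linear {y k : ℝ → ℝ} (hk : ContinuousOn k (Icc 0 1))
    (hy : ∀ τ ∈ Icc (0 : ℝ) 1, HasDerivAt y (-k τ * y τ) τ) (h0 : y 0 = 0) :
    ∀ τ ∈ Icc (0 : ℝ) 1, y τ = 0 := by
  obtain ⟨K, hK⟩ := isCompact_Icc.exists_bound_of_continuousOn hk
  refine eq_zero_of_abs_deriv_le_mul_abs_self_of_eq_zero_right (K := K)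
    (fun τ hτ => (hy τ hτ).continuousAt.continuousWithinAt)
    (fun τ hτ => (hy τ ⟨hτ.1, hτ.2.le⟩).hasDerivWithinAt) h0 fun τ hτ => ?_
  rw [norm_mul, norm_neg]
  exact mul_le_mul_of_nonneg_right (hK τ ⟨hτ.1, hτ.2.le⟩) (norm_nonneg _)

theorem eq_of_deriv_zero {y : ℝ → ℝ} (hy : ∀ τ ∈ Icc (0 : ℝ) 1, HasDerivAt y 0 τ) :
    ∀ τ ∈ Icc (0 : ℝ) 1, y τ = y 0 := fun τ hτ => by
  have := eq_zero_of_linear (y := fun t => y t - y 0) (k := fun _ => 0) continuousOn_const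
    (fun t ht => by
      have := (hy t ht).sub_const (y 0)
      simpa using this) (sub_self _) τ hτ
  linarith

namespace Background.IsSchwarzschild

variable {u : Background} {M A : ℝ}

theorem mem_of_unit {τ : ℝ} (h : τ ∈ Icc (0 : ℝ) 1) : τ ∈ Icc (-1 : ℝ) 1 :=
  ⟨by linarith [h.1], h.2⟩

theorem continuousOn_χr (hu : u.IsSchwarzschild M A) {ρ : ℝ} (hρ : ρ ∈ Ico 0 A) :
    ContinuousOn (fun t => u.χr t ρ) (Icc 0 1) := fun τ hτ =>
  (hu.eq_χr τ (mem_of_unit hτ) ρ hρ).continuousAt.continuousWithinAt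

/-- On `ρ = 0` the background is that of Minkowski space. -/
theorem base (hu : u.IsSchwarzschild M A) (hA : 0 < A) {τ : ℝ} (hτ : τ ∈ Icc (0 : ℝ) 1) :
    u.χr τ 0 = 0 ∧ u.χt τ 0 = 0 ∧ u.f τ 0 = 1 ∧ u.ξ τ 0 = 1 ∧ u.c0 τ 0 = -τ ∧ u.c1 τ 0 = 0 ∧
      u.c τ 0 = 1 := by
  have h0 : (0 : ℝ) ∈ Ico 0 A := ⟨le_rfl, hA⟩
  have hΘ : ∀ t, Θ M t 0 = 0 := fun t => by simp [Θ]
  have hdΘ : ∀ t, dΘ M t 0 = 0 := fun t => by simp [dΘ]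
  have hd1 : dOne M 0 = 0 := by simp [dOne]
  have cr := hu.continuousOn_χr h0
  have ct : ContinuousOn (fun t => u.χt t 0) (Icc 0 1) := fun t ht =>
    (hu.eq_χt t (mem_of_unit ht) 0 h0).continuousAt.continuousWithinAt
  have Lr := eq_zero_of_linear cr (fun t ht => (hu.eq_Lr t (mem_of_unit ht) 0 h0).congr_deriv
    (by rw [hdΘ]; ring)) (by rw [hu.init_Lr 0 h0]; ring)
  have Lt := eq_zero_of_linear ct (fun t ht => (hu.eq_Lt t (mem_of_unit ht) 0 h0).congr_deriv
    (by rw [hdΘ]; ring)) (by rw [hu.init_Lt 0 h0]; ring)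
  have Lx := eq_zero_of_linear cr (fun t ht => (hu.eq_Lx t (mem_of_unit ht) 0 h0).congr_deriv
    (by rw [hd1]; ring)) (hu.init_Lx 0 h0)
  have χr := eq_zero_of_linear cr (fun t ht => (hu.eq_χr t (mem_of_unit ht) 0 h0).congr_deriv
    (by rw [hΘ, Lr t ht]; ring)) (hu.init_χr 0 h0)
  have χt := eq_zero_of_linear ct (fun t ht => (hu.eq_χt t (mem_of_unit ht) 0 h0).congr_deriv
    (by rw [hΘ, Lt t ht]; ring)) (hu.init_χt 0 h0)
  have f : ∀ t ∈ Icc (0 : ℝ) 1, u.f t 0 = 1 := fun t ht => by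
    rw [eq_of_deriv_zero (y := fun t => u.f t 0) (fun t ht =>
      (hu.eq_f t (mem_of_unit ht) 0 h0).congr_deriv (by rw [χr t ht, Lx t ht]; ring)) t ht,
      hu.init_f 0 h0]
    ring
  have ξ : u.ξ τ 0 = 1 := by
    rw [eq_of_deriv_zero (y := fun t => u.ξ t 0) (fun t ht =>
      (hu.eq_ξ t (mem_of_unit ht) 0 h0).congr_deriv (by rw [χt t ht]; ring)) τ hτ,
      hu.init_ξ 0 h0]
    ring
  have c : u.c τ 0 = 1 := by
    rw [eq_of_deriv_zero (y := fun t => u.c t 0) (fun t ht =>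
      (hu.eq_c t (mem_of_unit ht) 0 h0).congr_deriv (by rw [χt t ht]; ring)) τ hτ,
      hu.init_c 0 h0]
    ring
  have c1 := eq_zero_of_linear cr (fun t ht => hu.eq_c1 t (mem_of_unit ht) 0 h0)
    (by rw [hu.init_c1 0 h0, omegaS]; ring) τ hτ
  have c0 : u.c0 τ 0 + τ = 0 := by
    have := eq_of_deriv_zero (y := fun t => u.c0 t 0 + t) (fun t ht =>
      ((hu.eq_c0 t (mem_of_unit ht) 0 h0).add (hasDerivAt_id t)).congr_deriv
        (by rw [χr t ht, f t ht]; ring)) τ hτ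
    rw [this, hu.init_c0 0 h0]
    ring
  exact ⟨χr τ hτ, χt τ hτ, f τ hτ, ξ, by linarith, c1, c⟩

/-- Null infinity is `τ = 1`: the outgoing null direction is tangent to it. This follows from the
relation `Θ f + c⁰ ∂_τ Θ + c¹ ∂_ρ Θ = β`, which is propagated by the equations. -/
theorem c0_one (hu : u.IsSchwarzschild M A) (hM : 0 ≤ M) {ρ : ℝ} (hρ : ρ ∈ Ico 0 A) :
    u.c0 1 ρ = -1 := by
  have h1 : (1 : ℝ) ∈ Icc (0 : ℝ) 1 := ⟨zero_le_one, le_rfl⟩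
  rcases hρ.1.eq_or_lt with h | hpos
  · subst h
    exact (hu.base hρ.2 h1).2.2.2.2.1
  set s := 1 + ρ * M / 2 with hs
  have hs0 : 0 < s := by positivity
  -- `α (1 - τ²)` is `Θ` and `α'` stands for the derivative of `α`
  set α := ρ / s ^ 3 with hα
  set α' := (1 - ρ * M) / s ^ 4 with hα'
  have hω : omegaS M ρ * α' = α * (1 - ρ * M) := by
    rw [omegaS, ← hs, hα, hα']
    field_simp
  have hα0 : α ≠ 0 := by positivity
  have hd1 : dOne M ρ = 2 * α := by rw [dOne, ← hs, hα]; ring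
  have hΘ : ∀ t, Θ M t ρ = α * (1 - t ^ 2) := fun t => rfl
  have hdΘ : ∀ t, dΘ M t ρ = α * (-2 * t) := fun t => rfl
  have cr := hu.continuousOn_χr hρ
  have hq : ∀ (c : ℝ) (t : ℝ), HasDerivAt (fun t : ℝ => c * (1 - t ^ 2)) (c * (-2 * t)) t :=
    fun c t => by
      have := (((hasDerivAt_id t).pow 2).const_sub 1).const_mul c
      exact this.congr_deriv (by simp)
  have hl : ∀ (c : ℝ) (t : ℝ), HasDerivAt (fun t : ℝ => c * (-2 * t)) (-2 * c) t :=
    fun c t => (((hasDerivAt_id t).const_mul (-2)).const_mul c).congr_deriv (by ring)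
  have V := eq_zero_of_linear (y := fun t => 2 * α * u.Lr t ρ + α * (-2 * t) * u.Lx t ρ +
      2 * α * u.f t ρ - 2 * α' * u.c1 t ρ) cr (fun t ht =>
    (((((hu.eq_Lr t (mem_of_unit ht) ρ hρ).const_mul (2 * α)).add
      ((hl α t).mul (hu.eq_Lx t (mem_of_unit ht) ρ hρ))).add
      ((hu.eq_f t (mem_of_unit ht) ρ hρ).const_mul (2 * α))).sub
      ((hu.eq_c1 t (mem_of_unit ht) ρ hρ).const_mul (2 * α'))).congr_deriv
        (by rw [hdΘ, hd1]; ring)) (by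
    rw [hu.init_Lr ρ hρ, hu.init_Lx ρ hρ, hu.init_f ρ hρ, hu.init_c1 ρ hρ]
    linear_combination -2 * hω)
  have W := eq_zero_of_linear (y := fun t => -(2 * α) * u.χr t ρ + α * (1 - t ^ 2) * u.Lx t ρ +
      -2 * α * u.c0 t ρ + α' * (-2 * t) * u.c1 t ρ) cr (fun t ht =>
    (((((hu.eq_χr t (mem_of_unit ht) ρ hρ).const_mul (-(2 * α))).add
      ((hq α t).mul (hu.eq_Lx t (mem_of_unit ht) ρ hρ))).add
      ((hu.eq_c0 t (mem_of_unit ht) ρ hρ).const_mul (-2 * α))).add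
      ((hl α' t).mul (hu.eq_c1 t (mem_of_unit ht) ρ hρ))).congr_deriv
        (by rw [hΘ, hd1]; linear_combination V t ht)) (by
    rw [hu.init_χr ρ hρ, hu.init_Lx ρ hρ, hu.init_c0 ρ hρ]
    ring)
  have X := eq_zero_of_linear (y := fun t => α * (1 - t ^ 2) * u.f t ρ + α * (-2 * t) * u.c0 t ρ +
      α' * (1 - t ^ 2) * u.c1 t ρ - 2 * α) cr (fun t ht =>
    (((((hq α t).mul (hu.eq_f t (mem_of_unit ht) ρ hρ)).add
      ((hl α t).mul (hu.eq_c0 t (mem_of_unit ht) ρ hρ))).add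
      ((hq α' t).mul (hu.eq_c1 t (mem_of_unit ht) ρ hρ))).sub_const (2 * α)).congr_deriv
        (by linear_combination W t ht)) (by
    rw [hu.init_f ρ hρ, hu.init_c0 ρ hρ, hu.init_c1 ρ hρ]
    linear_combination hω) 1 h1
  have e : α * (u.c0 1 ρ + 1) = 0 := by linear_combination -(1 / 2) * X
  have := (mul_eq_zero.1 e).resolve_left hα0
  linarith

theorem ana_c0 (hu : u.IsSchwarzschild M A) : Ana A fun y => u.c0 y.1 y.2 :=
  hu.analytic _ (by simp)
theorem ana_c1 (hu : u.IsSchwarzschild M A) : Ana A fun y => u.c1 y.1 y.2 :=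
  hu.analytic _ (by simp)
theorem ana_c (hu : u.IsSchwarzschild M A) : Ana A fun y => u.c y.1 y.2 :=
  hu.analytic _ (by simp)
theorem ana_f (hu : u.IsSchwarzschild M A) : Ana A fun y => u.f y.1 y.2 :=
  hu.analytic _ (by simp)
theorem ana_ξ (hu : u.IsSchwarzschild M A) : Ana A fun y => u.ξ y.1 y.2 :=
  hu.analytic _ (by simp)
theorem ana_χr (hu : u.IsSchwarzschild M A) : Ana A fun y => u.χr y.1 y.2 :=
  hu.analytic _ (by simp)
theorem ana_χt (hu : u.IsSchwarzschild M A) : Ana A fun y => u.χt y.1 y.2 :=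
  hu.analytic _ (by simp)

theorem avg_eq (hu : u.IsSchwarzschild M A) (hM : 0 ≤ M) {τ ρ : ℝ} (hτ : τ ∈ Ico (0 : ℝ) 1)
    (hρ : ρ ∈ Ico 0 A) :
    (1 + u.c0 τ ρ) / (1 - τ) = avg 0 (fun y => u.χr y.1 y.2 * u.c0 y.1 y.2 + u.f y.1 y.2) (τ, ρ) := by
  have h1 : 1 - τ ≠ 0 := by linarith [hτ.2]
  rw [div_eq_iff h1, avg, mul_comm, ← intervalIntegral.integral_const_mul]
  have hd : ∀ s ∈ uIcc (0 : ℝ) 1, HasDerivAt (fun s => u.c0 (1 - s * (1 - τ)) ρ)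
      ((1 - τ) * (s ^ 0 * (u.χr (1 - s * (1 - τ)) ρ * u.c0 (1 - s * (1 - τ)) ρ +
        u.f (1 - s * (1 - τ)) ρ))) s := fun s hs => by
    rw [uIcc_of_le zero_le_one] at hs
    have h2 : HasDerivAt (fun s : ℝ => 1 - s * (1 - τ)) (-(1 - τ)) s :=
      (((hasDerivAt_id s).mul_const (1 - τ)).const_sub 1).congr_deriv (by simp)
    have h3 := (hu.eq_c0 _ (avg_mem hs hτ) ρ hρ).comp s h2
    exact h3.congr_deriv (by ring)
  rw [intervalIntegral.integral_eq_sub_of_hasDerivAt hd ?_]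
  · have := hu.c0_one hM hρ
    simp only [one_mul, zero_mul, sub_zero, sub_sub_cancel]
    rw [this]
    ring
  · refine ContinuousOn.intervalIntegrable fun s hs => ?_
    rw [uIcc_of_le zero_le_one] at hs
    have hm := avg_mem hs hτ
    have hin : ContinuousAt (fun s : ℝ => ((1 - s * (1 - τ), ρ) : ℝ × ℝ)) s := by fun_prop
    have hpt : ((1 - s * (1 - τ), ρ) : ℝ × ℝ) ∈ Icc (-1 : ℝ) 1 ×ˢ Ico 0 A := ⟨hm, hρ⟩
    have cχ : ContinuousAt (fun s : ℝ => u.χr (1 - s * (1 - τ)) ρ) s :=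
      (hu.ana_χr _ hpt).continuousAt.comp (f := fun s : ℝ => ((1 - s * (1 - τ), ρ) : ℝ × ℝ)) hin
    have c0 : ContinuousAt (fun s : ℝ => u.c0 (1 - s * (1 - τ)) ρ) s :=
      (hu.ana_c0 _ hpt).continuousAt.comp (f := fun s : ℝ => ((1 - s * (1 - τ), ρ) : ℝ × ℝ)) hin
    have cf : ContinuousAt (fun s : ℝ => u.f (1 - s * (1 - τ)) ρ) s :=
      (hu.ana_f _ hpt).continuousAt.comp (f := fun s : ℝ => ((1 - s * (1 - τ), ρ) : ℝ × ℝ)) hin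
    exact (continuousAt_const.mul ((continuousAt_id.pow 0).mul
      ((cχ.mul c0).add cf))).continuousWithinAt

end Background.IsSchwarzschild

theorem eq_of_dt_zero {u : SF a} (h : dt u = 0) (x : Pt a) :
    u.1 x = u.1 ⟨0, x.ρ, x.g, ⟨le_rfl, one_pos⟩, x.hρ⟩ := by
  have h0 : (0 : ℝ) ∈ Ico (0 : ℝ) 1 := ⟨le_rfl, one_pos⟩
  have h1 := (convex_Ico (0 : ℝ) 1).norm_image_sub_le_of_norm_hasDerivWithin_le
    (f := fun t => zeroExt u.1 t x.ρ x.g) (f' := fun _ => 0) (C := 0)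
    (fun t ht => by
      have := (hasDerivWithinAt_zeroExt_tau u ⟨t, x.ρ, x.g, ht, x.hρ⟩).mono
        (fun _ h => h.1 : Ico (0 : ℝ) 1 ⊆ Ici 0)
      rwa [h] at this)
    (fun t ht => by simp) h0 x.hτ
  rw [zeroExt_of_mem _ x.hτ x.hρ, zeroExt_of_mem _ h0 x.hρ, zero_mul] at h1
  exact sub_eq_zero.1 (norm_le_zero_iff.1 h1)

theorem Tr_rad_apply {f : ℝ × ℝ → ℝ} (hf : ContDiffOn ℝ ∞ f (Ico 0 1 ×ˢ Ico 0 a)) (x : Pt a) :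
    (Tr (rad f hf)).1 x = f (x.τ, 0) := rfl

/-! ### The divided system on the Schwarzschild background -/

/-- `Y` is the Maxwell system on the background `u`, divided by the coefficients `θ = 1 - c⁰` of
`∂_τ φ₀`, `∂_τ φ₁` and by the regular factor `h` of the coefficient `1 + c⁰ = (1 - τ) h` of
`∂_τ φ₂`. -/
structure IsDivided (u : Background) (Y : Sys a) : Prop where
  θ_apply : ∀ x, Y.θ.1 x = ((1 - u.c0 x.τ x.ρ : ℝ) : ℂ)
  p_apply : ∀ x, (Y.θ * Y.p).1 x = ((u.c1 x.τ x.ρ : ℝ) : ℂ)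
  s_apply : ∀ x, (Y.θ * Y.s).1 x = ((-u.c x.τ x.ρ : ℝ) : ℂ)
  v0_apply : ∀ x, (Y.θ * Y.v0).1 x = ((-(1 + u.fk x.τ x.ρ 0) : ℝ) : ℂ)
  v1_apply : ∀ x, (Y.θ * Y.v1).1 x = ((-(u.fk x.τ x.ρ 1) : ℝ) : ℂ)
  h_apply : ∀ x, (Y.h * oneSubTau).1 x = ((1 + u.c0 x.τ x.ρ : ℝ) : ℂ)
  v2_apply : ∀ x, (Y.h * Y.v2).1 x = ((1 - u.gk x.τ x.ρ 1 : ℝ) : ℂ)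
  θ_inv : ∃ d ∈ CC a, d * Y.θ = 1
  h_inv : ∃ d ∈ CC a, d * Y.h = 1

/-- The background is close to Minkowski space near `ρ = 0`. -/
def NearFlat (u : Background) (a : ℝ) : Prop := ∀ τ ∈ Ico (0 : ℝ) 1, ∀ ρ ∈ Ico 0 a,
  |u.c0 τ ρ + τ| ≤ 1 / 4 ∧ |u.c1 τ ρ - ρ| ≤ 1 / 4 * ρ ∧ |(1 + u.c0 τ ρ) / (1 - τ) - 1| ≤ 1 / 4

namespace Background.IsSchwarzschild

variable {u : Background} {M A : ℝ}

theorem contDiffOn_h (hu : u.IsSchwarzschild M A) (ha : a < A) :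
    ContDiffOn ℝ ∞ (fun y : ℝ × ℝ => (1 + u.c0 y.1 y.2) / (1 - y.1)) (Ico 0 1 ×ˢ Ico 0 a) :=
  (contDiffOn_const.add (hu.ana_c0.contDiffOn ha.le)).div
    (contDiffOn_const.sub contDiffOn_fst) fun y hy => by linarith [hy.1.2]

theorem h_mem (hu : u.IsSchwarzschild M A) (hM : 0 ≤ M) (ha : a < A) :
    rad _ (hu.contDiffOn_h ha) ∈ CC a :=
  ⟨dz_rad _, fun n => bddTo_avg ha n 0 ((hu.ana_χr.mul hu.ana_c0).add hu.ana_f) fun x => by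
    rw [rad_apply, hu.avg_eq hM x.hτ ⟨x.hρ.1, x.hρ.2.trans ha⟩]
    rfl⟩

theorem Tr_dr_c1 (hu : u.IsSchwarzschild M A) (ha : a < A) :
    Tr (dr (rad _ (hu.ana_c1.contDiffOn ha.le))) = (1 : SF a) := by
  set C1 : SF a := rad _ (hu.ana_c1.contDiffOn ha.le) with hC1
  set X : SF a := rad _ (hu.ana_χr.contDiffOn ha.le) with hX
  have hmem : ∀ x : Pt a, x.τ ∈ Icc (0 : ℝ) 1 := fun x => ⟨x.hτ.1, x.hτ.2.le⟩
  have hA : ∀ x : Pt a, 0 < A := fun x => (x.hρ.1.trans_lt x.hρ.2).trans ha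
  have hdt : dt C1 = -X * C1 := by
    ext x
    rw [hC1, dt_rad_apply _ (hu.eq_c1 x.τ (mem_Icc_of_Ico x.hτ) x.ρ
      ⟨x.hρ.1, x.hρ.2.trans ha⟩).hasDerivWithinAt]
    simp [hX]
  have hT1 : Tr C1 = 0 := by
    ext x
    rw [hC1, Tr_rad_apply, (hu.base (hA x) (hmem x)).2.2.2.2.2.1]
    rfl
  have hTX : Tr X = 0 := by
    ext x
    rw [hX, Tr_rad_apply, (hu.base (hA x) (hmem x)).1]
    rfl
  have hz : dt (Tr (dr C1)) = 0 := by
    have e : dr (-X * C1) = -(X * dr C1) - C1 * dr X := by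
      rw [Derivation.leibniz, map_neg, smul_eq_mul, smul_eq_mul]
      ring
    rw [← Tr_dt, dt_dr, hdt, e, map_sub, map_neg, map_mul, map_mul, hT1, hTX]
    ring
  ext x
  rw [eq_of_dt_zero hz x, Tr_apply]
  have hω : HasDerivWithinAt (fun r => ((omegaS M r : ℝ) : ℂ)) ((1 : ℝ) : ℂ) (Ici 0) 0 := by
    have h1 : HasDerivAt (fun r : ℝ => r * (1 + r * M / 2)) 1 0 := by
      have := (hasDerivAt_id (0 : ℝ)).mul
        ((((hasDerivAt_id (0 : ℝ)).mul_const M).div_const 2).const_add 1)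
      exact this.congr_deriv (by simp)
    exact h1.hasDerivWithinAt.ofReal_comp
  have h2 := dr_apply_eq (f := C1)
    (x := (⟨0, x.ρ, x.g, ⟨le_rfl, one_pos⟩, x.hρ⟩ : Pt a).base) hω fun r hr => by
      change ((u.c1 0 r : ℝ) : ℂ) = _
      rw [hu.init_c1 r ⟨hr.1, hr.2.trans ha⟩]
  rw [h2]
  simp

theorem exists_nearFlat (hu : u.IsSchwarzschild M A) (hM : 0 ≤ M) (ha0 : 0 < a) (ha : a < A) :
    ∃ a₀ ∈ Ioc 0 a, NearFlat u a₀ := by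
  have hmem : ∀ x : Pt a, x.τ ∈ Icc (0 : ℝ) 1 := fun x => ⟨x.hτ.1, x.hτ.2.le⟩
  have hA := ha0.trans ha
  set C0 : SF a := rad _ (hu.ana_c0.contDiffOn ha.le) with hC0
  set C1 : SF a := rad _ (hu.ana_c1.contDiffOn ha.le) with hC1
  set H : SF a := rad _ (hu.contDiffOn_h ha) with hH
  have hC0m : C0 ∈ CC a := hu.ana_c0.rad_mem ha
  have hC1m : C1 ∈ CC a := hu.ana_c1.rad_mem ha
  obtain ⟨K0, hK0, b0⟩ := exists_le_mul_rho (c := C0 + (1 - oneSubTau))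
    (add_mem hC0m (sub_mem (one_mem _) oneSubTau_mem)) (by
      ext x
      rw [Tr_apply, SF.add_apply, ← Tr_apply, hC0, Tr_rad_apply,
        (hu.base hA (hmem x)).2.2.2.2.1]
      simp [Pt.base])
  obtain ⟨K1, hK1, b1⟩ := exists_le_mul_rho (c := dr C1 - 1)
    (sub_mem (CC.dr_mem hC1m) (one_mem _)) (by
      rw [map_sub, hC1, hu.Tr_dr_c1 ha, map_one, sub_self])
  obtain ⟨K2, hK2, b2⟩ := exists_le_mul_rho (c := H - 1)
    (sub_mem (hu.h_mem hM ha) (one_mem _)) (by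
      ext x
      have h1 : (1 : ℝ) - x.τ ≠ 0 := by linarith [x.hτ.2]
      rw [Tr_apply, SF.sub_apply, ← Tr_apply, hH, Tr_rad_apply]
      simp only [(hu.base hA (hmem x)).2.2.2.2.1]
      rw [← sub_eq_add_neg, div_self h1]
      simp)
  set K := 4 * (K0 + K1 + K2 + 1) with hK
  have hKpos : 0 < K := by positivity
  refine ⟨min a (1 / K), ⟨lt_min ha0 (by positivity), min_le_left _ _⟩, fun τ hτ ρ hρ => ?_⟩
  have hρa : ρ ∈ Ico 0 a := ⟨hρ.1, hρ.2.trans_le (min_le_left _ _)⟩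
  have hρK : ρ * K ≤ 1 := by
    have := hρ.2.le.trans (min_le_right a (1 / K))
    rwa [le_div_iff₀ hKpos] at this
  set x : Pt a := ⟨τ, ρ, 1, hτ, hρa⟩ with hx
  have p0 := mul_nonneg hK0 hρ.1
  have p1 := mul_nonneg hK1 hρ.1
  have p2 := mul_nonneg hK2 hρ.1
  have hsum : K0 * ρ + K1 * ρ + K2 * ρ + ρ ≤ 1 / 4 := by
    have : ρ * K = 4 * (K0 * ρ + K1 * ρ + K2 * ρ + ρ) := by rw [hK]; ring
    linarith
  have c1 : ‖(C1 - rho).1 x‖ ≤ (K1 * ρ) * ρ := by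
    refine le_mul_rho (c := C1 - rho) (x := x) ?_ fun y hy hyρ => ?_
    · ext y
      rw [Tr_apply, SF.sub_apply, ← Tr_apply, hC1, Tr_rad_apply,
        (hu.base hA (hmem y)).2.2.2.2.2.1]
      simp [Pt.base]
    · rw [map_sub, dr_rho]
      exact (b1 y).trans (mul_le_mul_of_nonneg_left hyρ hK1)
  have r0 : ‖(C0 + (1 - oneSubTau)).1 x‖ = |u.c0 τ ρ + τ| := by
    rw [← Real.norm_eq_abs, ← Complex.norm_real]
    congr 1
    simp [hC0, hx]
  have r1 : ‖(C1 - rho).1 x‖ = |u.c1 τ ρ - ρ| := by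
    rw [← Real.norm_eq_abs, ← Complex.norm_real]
    congr 1
    simp [hC1, hx]
  have r2 : ‖(H - 1).1 x‖ = |(1 + u.c0 τ ρ) / (1 - τ) - 1| := by
    rw [← Real.norm_eq_abs, ← Complex.norm_real]
    congr 1
    simp [hH, hx]
  refine ⟨?_, ?_, ?_⟩
  · rw [← r0]
    exact (b0 x).trans (by change K0 * ρ ≤ _; linarith [hρ.1])
  · rw [← r1]
    exact c1.trans (mul_le_mul_of_nonneg_right (by linarith [hρ.1]) hρ.1)
  · rw [← r2]
    exact (b2 x).trans (by change K2 * ρ ≤ _; linarith [hρ.1])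

theorem exists_sys (hu : u.IsSchwarzschild M A) (hM : 0 ≤ M) (ha0 : 0 < a) (ha : a < A)
    (hflat : NearFlat u a) : ∃ Y : Sys a, IsDivided u Y := by
  have hmem : ∀ x : Pt a, x.τ ∈ Icc (0 : ℝ) 1 := fun x => ⟨x.hτ.1, x.hτ.2.le⟩
  have hA := ha0.trans ha
  have hθpos : ∀ τ ∈ Ico (0 : ℝ) 1, ∀ ρ ∈ Ico 0 a, 3 / 4 ≤ 1 - u.c0 τ ρ := fun τ hτ ρ hρ => by
    have := (abs_le.1 (hflat τ hτ ρ hρ).1).2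
    linarith [hτ.1]
  have hhpos : ∀ τ ∈ Ico (0 : ℝ) 1, ∀ ρ ∈ Ico 0 a, 3 / 4 ≤ (1 + u.c0 τ ρ) / (1 - τ) :=
    fun τ hτ ρ hρ => by
      have := (abs_le.1 (hflat τ hτ ρ hρ).2.2).1
      linarith
  have hθd : ContDiffOn ℝ ∞ (fun y : ℝ × ℝ => 1 - u.c0 y.1 y.2) (Ico 0 1 ×ˢ Ico 0 a) :=
    contDiffOn_const.sub (hu.ana_c0.contDiffOn ha.le)
  have hθi := hθd.inv fun y hy => by linarith [hθpos y.1 hy.1 y.2 hy.2]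
  have hhi := (hu.contDiffOn_h ha).inv fun y hy => by
    linarith [hhpos y.1 hy.1 y.2 hy.2]
  have aW0 : Ana A fun y => -(1 + u.fk y.1 y.2 0) :=
    (analyticOnNhd_const.add ((((hu.ana_χt.sub (hu.ana_ξ.sub hu.ana_f)).add hu.ana_f).add
      hu.ana_χr).sub analyticOnNhd_const)).neg
  have aW1 : Ana A fun y => -(u.fk y.1 y.2 1) :=
    (analyticOnNhd_const.mul (hu.ana_χt.sub (hu.ana_ξ.sub hu.ana_f))).neg
  have aW2 : Ana A fun y => 1 - u.gk y.1 y.2 1 :=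
    analyticOnNhd_const.sub ((((hu.ana_χt.add (hu.ana_ξ.sub hu.ana_f)).sub hu.ana_f).add
      hu.ana_χr).add analyticOnNhd_const)
  have aC : Ana A fun y => -u.c y.1 y.2 := hu.ana_c.neg
  have aθ : Ana A fun y => 1 - u.c0 y.1 y.2 := analyticOnNhd_const.sub hu.ana_c0
  set θ : SF a := rad _ hθd with hθ
  set H : SF a := rad _ (hu.contDiffOn_h ha) with hH
  set θi : SF a := rad _ hθi with hθi'
  set Hi : SF a := rad _ hhi with hHi
  set C1 : SF a := rad _ (hu.ana_c1.contDiffOn ha.le) with hC1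
  set C : SF a := rad _ (aC.contDiffOn ha.le) with hC
  set W0 : SF a := rad _ (aW0.contDiffOn ha.le) with hW0
  set W1 : SF a := rad _ (aW1.contDiffOn ha.le) with hW1
  set W2 : SF a := rad _ (aW2.contDiffOn ha.le) with hW2
  have hθm : θ ∈ CC a := aθ.rad_mem ha
  have hHm : H ∈ CC a := hu.h_mem hM ha
  have iθ : θ * θi = 1 := by
    ext x
    have h0 : (1 - u.c0 x.τ x.ρ) ≠ 0 := by linarith [hθpos x.τ x.hτ x.ρ x.hρ]
    rw [SF.mul_apply, SF.one_apply, hθ, hθi', rad_apply, rad_apply, ← Complex.ofReal_mul]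
    simp only [Pi.inv_apply]
    rw [mul_inv_cancel₀ h0, Complex.ofReal_one]
  have iH : H * Hi = 1 := by
    ext x
    have h0 : (1 + u.c0 x.τ x.ρ) / (1 - x.τ) ≠ 0 := by linarith [hhpos x.τ x.hτ x.ρ x.hρ]
    rw [SF.mul_apply, SF.one_apply, hH, hHi, rad_apply, rad_apply, ← Complex.ofReal_mul]
    simp only [Pi.inv_apply]
    rw [mul_inv_cancel₀ h0, Complex.ofReal_one]
  have inv_bd : ∀ z : ℝ, 3 / 4 ≤ z → ‖((z⁻¹ : ℝ) : ℂ)‖ ≤ 2 := fun z hz => by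
    rw [Complex.norm_real, Real.norm_of_nonneg (by positivity)]
    rw [inv_le_comm₀ (by linarith) two_pos]
    linarith
  have hθim : θi ∈ CC a := CC.inv_mem hθm iθ (dz_rad _)
    ⟨2, fun x => inv_bd _ (hθpos x.τ x.hτ x.ρ x.hρ)⟩
  have hHim : Hi ∈ CC a := CC.inv_mem hHm iH (dz_rad _)
    ⟨2, fun x => inv_bd _ (hhpos x.τ x.hτ x.ρ x.hρ)⟩
  have hC1m : C1 ∈ CC a := hu.ana_c1.rad_mem ha
  have hCm : C ∈ CC a := aC.rad_mem ha
  have tC1 : Tr C1 = 0 := by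
    ext x
    rw [hC1, Tr_rad_apply, (hu.base hA (hmem x)).2.2.2.2.2.1]
    rfl
  have tH : Tr H = 1 := by
    ext x
    have h1 : (1 : ℝ) - x.τ ≠ 0 := by linarith [x.hτ.2]
    rw [hH, Tr_rad_apply]
    simp only [(hu.base hA (hmem x)).2.2.2.2.1]
    rw [← sub_eq_add_neg, div_self h1]
    simp
  have tHi : Tr Hi = 1 := by
    have := congrArg Tr iH
    rwa [map_mul, tH, one_mul, map_one] at this
  have hc1 : ∀ x : Pt a, 0 ≤ u.c1 x.τ x.ρ ∧ u.c1 x.τ x.ρ ≤ 5 / 4 * x.ρ := fun x => by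
    have := abs_le.1 (hflat x.τ x.hτ x.ρ x.hρ).2.1
    have h0 := x.hρ.1
    constructor <;> linarith [this.1, this.2]
  have reθi : ∀ (x : Pt a) (c : SF a), ((θi * c).1 x).re =
      (1 - u.c0 x.τ x.ρ)⁻¹ * (c.1 x).re := fun x c => by
    rw [re_mul_of_star (star_rad _)]
    rfl
  have reHi : ∀ (x : Pt a) (c : SF a), ((Hi * c).1 x).re =
      ((1 + u.c0 x.τ x.ρ) / (1 - x.τ))⁻¹ * (c.1 x).re := fun x c => by
    rw [re_mul_of_star (star_rad _)]
    rfl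
  refine ⟨{
    p := θi * C1
    pt := Hi * C1
    s := θi * C
    st := Hi * C
    θ := θ
    h := H
    v0 := θi * W0
    v1 := θi * W1
    v2 := Hi * W2
    p_mem := mul_mem hθim hC1m
    pt_mem := mul_mem hHim hC1m
    s_mem := mul_mem hθim hCm
    st_mem := mul_mem hHim hCm
    θ_mem := hθm
    h_mem := hHm
    v0_mem := mul_mem hθim (aW0.rad_mem ha)
    v1_mem := mul_mem hθim (aW1.rad_mem ha)
    v2_mem := mul_mem hHim (aW2.rad_mem ha)
    star_p := by rw [star_mul', star_rad, star_rad]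
    star_pt := by rw [star_mul', star_rad, star_rad]
    star_s := by rw [star_mul', star_rad, star_rad]
    star_θ := star_rad _
    star_h := star_rad _
    θ_mul_p := by rw [← mul_assoc, ← mul_assoc, iθ, iH]
    θ_mul_s := by rw [← mul_assoc, ← mul_assoc, iθ, iH]
    Tr_p := by rw [map_mul, tC1, mul_zero]
    Tr_pt := by rw [map_mul, tC1, mul_zero]
    Tr_dr_pt := by
      rw [Derivation.leibniz, map_add, smul_eq_mul, smul_eq_mul, map_mul, map_mul, tC1, tHi,
        hC1, hu.Tr_dr_c1 ha]
      ring
    Tr_v2 := by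
      rw [map_mul, tHi, one_mul]
      ext x
      obtain ⟨h1, h2, h3, h4, -⟩ := hu.base hA (hmem x)
      rw [hW2, Tr_rad_apply]
      have : u.gk x.τ 0 1 = 0 := by
        change u.χt x.τ 0 + (u.ξ x.τ 0 - u.f x.τ 0) - u.f x.τ 0 + u.χr x.τ 0 + 1 = 0
        rw [h1, h2, h3, h4]
        ring
      simp [this]
    p_le := fun x => by
      rw [reθi]
      change (1 - u.c0 x.τ x.ρ)⁻¹ * u.c1 x.τ x.ρ ≤ _
      have h1 := hθpos x.τ x.hτ x.ρ x.hρ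
      rw [inv_mul_le_iff₀ (by linarith)]
      have := (hc1 x).2
      nlinarith [x.hρ.1]
    pt_nonneg := fun x => by
      rw [reHi]
      exact mul_nonneg (inv_nonneg.2 (by linarith [hhpos x.τ x.hτ x.ρ x.hρ])) (hc1 x).1
    θ_ge := fun x => (by linarith [hθpos x.τ x.hτ x.ρ x.hρ] : 1 / 2 ≤ 1 - u.c0 x.τ x.ρ)
    h_ge := fun x => (by linarith [hhpos x.τ x.hτ x.ρ x.hρ] :
      1 / 2 ≤ (1 + u.c0 x.τ x.ρ) / (1 - x.τ)) }, ?_⟩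
  constructor
  · exact fun x => rfl
  · intro x
    change (θ * (θi * C1)).1 x = _
    rw [← mul_assoc, iθ, one_mul]
    rfl
  · intro x
    change (θ * (θi * C)).1 x = _
    rw [← mul_assoc, iθ, one_mul]
    rfl
  · intro x
    change (θ * (θi * W0)).1 x = _
    rw [← mul_assoc, iθ, one_mul]
    rfl
  · intro x
    change (θ * (θi * W1)).1 x = _
    rw [← mul_assoc, iθ, one_mul]
    rfl
  · intro x
    have h1 : (1 : ℝ) - x.τ ≠ 0 := by linarith [x.hτ.2]
    change (H * oneSubTau).1 x = _
    rw [SF.mul_apply, oneSubTau_apply, hH, rad_apply, ← Complex.ofReal_mul, div_mul_cancel₀ _ h1]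
  · intro x
    change (H * (Hi * W2)).1 x = _
    rw [← mul_assoc, iH, one_mul]
    rfl
  · exact ⟨θi, hθim, by rw [mul_comm, iθ]⟩
  · exact ⟨Hi, hHim, by rw [mul_comm, iH]⟩

end Background.IsSchwarzschild

/-! ### Cut-off slices and the outgoing characteristic -/

theorem exists_slice (μ : Measure SU2) [hμ : μ.IsHaarMeasure] [hμ' : IsProbabilityMeasure μ] {r : ℝ}
    (hr : 0 < r) (hra : 2 * r < a) : ∃ s : Slice a, s.μ = μ ∧ s.b = 2 * r ∧
      ∀ x : Pt a, x.ρ * Real.exp (2 * x.τ) ≤ r → s.χ.1 x = 1 := by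
  have hf : ContDiff ℝ ∞ fun y : ℝ × ℝ =>
      Real.smoothTransition (2 - y.2 * Real.exp (2 * y.1) / r) :=
    Real.smoothTransition.contDiff.comp (contDiff_const.sub
      ((contDiff_snd.mul (Real.contDiff_exp.comp (contDiff_const.mul contDiff_fst))).div_const r))
  have hσ : ∀ y, HasDerivAt Real.smoothTransition (deriv Real.smoothTransition y) y := fun y =>
    ((Real.smoothTransition.contDiff (n := 1)).differentiable one_ne_zero y).hasDerivAt
  have h1 : ∀ x : Pt a, (dt (rad _ hf.contDiffOn)).1 x =
      ((deriv Real.smoothTransition (2 - x.ρ * Real.exp (2 * x.τ) / r) *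
        -(x.ρ * (Real.exp (2 * x.τ) * 2) / r) : ℝ) : ℂ) := fun x => by
    refine dt_rad_apply _ (HasDerivAt.hasDerivWithinAt ?_)
    have h2 : HasDerivAt (fun t : ℝ => 2 - x.ρ * Real.exp (2 * t) / r)
        (-(x.ρ * (Real.exp (2 * x.τ) * 2) / r)) x.τ := by
      have := ((((hasDerivAt_id x.τ).const_mul 2).exp.const_mul x.ρ).div_const r).const_sub 2
      simpa using this
    exact (hσ _).comp x.τ h2
  have h2 : ∀ x : Pt a, (dr (rad _ hf.contDiffOn)).1 x =
      ((deriv Real.smoothTransition (2 - x.ρ * Real.exp (2 * x.τ) / r) *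
        -(Real.exp (2 * x.τ) / r) : ℝ) : ℂ) := fun x => by
    refine dr_rad_apply _ (HasDerivAt.hasDerivWithinAt ?_)
    have h2 : HasDerivAt (fun y : ℝ => 2 - y * Real.exp (2 * x.τ) / r)
        (-(Real.exp (2 * x.τ) / r)) x.ρ := by
      have := (((hasDerivAt_id x.ρ).mul_const (Real.exp (2 * x.τ))).div_const r).const_sub 2
      simpa using this
    exact (hσ _).comp x.ρ h2
  refine ⟨{
    μ := μ
    haar := hμ
    prob := hμ'
    b := 2 * r
    b_pos := by linarith
    b_lt := hra
    χ := rad _ hf.contDiffOn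
    star_χ := star_rad _
    dz_χ := dz_rad _
    nonneg := fun x => Real.smoothTransition.nonneg _
    le_one := fun x => Real.smoothTransition.le_one _
    vanish := fun x hx => ?_
    dt_χ := ?_
    dr_nonpos := fun x => ?_ }, rfl, rfl, fun x hx => ?_⟩
  · have h : (1 : ℝ) ≤ Real.exp (2 * x.τ) := Real.one_le_exp (by linarith [x.hτ.1])
    rw [rad_apply]
    simp only [hx]
    rw [Real.smoothTransition.zero_of_nonpos, Complex.ofReal_zero]
    have : 2 * r * Real.exp (2 * x.τ) / r = 2 * Real.exp (2 * x.τ) := by field_simp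
    linarith
  · ext x
    rw [h1, SF.mul_apply, h2, SF.mul_apply, rho_apply]
    have : (2 : SF a).1 x = 2 := rfl
    rw [this]
    push_cast
    ring
  · rw [h2, Complex.ofReal_re, mul_neg]
    exact neg_nonpos.2 (mul_nonneg Real.smoothTransition.monotone.deriv_nonneg (by positivity))
  · rw [rad_apply, Real.smoothTransition.one_of_one_le, Complex.ofReal_one]
    have : x.ρ * Real.exp (2 * x.τ) / r ≤ 1 := by rwa [div_le_one hr]
    linarith

namespace Background.IsSchwarzschild

variable {u : Background} {M A : ℝ}

theorem c0_le (hu : u.IsSchwarzschild M A) (hM : 0 ≤ M) (ha : a < A) (hflat : NearFlat u a)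
    {τ ρ : ℝ} (hτ : τ ∈ Icc (0 : ℝ) 1) (hρ : ρ ∈ Ico 0 a) : u.c0 τ ρ ≤ 1 / 4 := by
  rcases hτ.2.lt_or_eq with h | h
  · have := (abs_le.1 (hflat τ ⟨hτ.1, h⟩ ρ hρ).1).2
    linarith [hτ.1]
  · rw [h, hu.c0_one hM ⟨hρ.1, hρ.2.trans ha⟩]
    norm_num

theorem abs_c1_sub_le (hu : u.IsSchwarzschild M A) (ha : a < A) (hflat : NearFlat u a)
    {τ ρ : ℝ} (hτ : τ ∈ Icc (0 : ℝ) 1) (hρ : ρ ∈ Ico 0 a) : |u.c1 τ ρ - ρ| ≤ 1 / 4 * ρ := by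
  have hcl : closure (Ico (0 : ℝ) 1) = Icc 0 1 := closure_Ico zero_ne_one
  have hc : ContinuousOn (fun t => |u.c1 t ρ - ρ|) (closure (Ico (0 : ℝ) 1)) := by
    rw [hcl]
    have h1 : ContinuousOn (fun t => u.c1 t ρ) (Icc 0 1) := fun t ht =>
      (hu.eq_c1 t (mem_of_unit ht) ρ ⟨hρ.1, hρ.2.trans ha⟩).continuousAt.continuousWithinAt
    exact (h1.sub continuousOn_const).abs
  exact le_on_closure (fun t ht => (hflat t ht ρ hρ).2.1) hc continuousOn_const (hcl ▸ hτ)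

/-- The vector field of the outgoing characteristics is extended to the plane by clamping its
argument to `[0, 1] × [0, ρs]`; near flat space it points into this rectangle except at `τ = 1`, so
that its integral curve from `(0, ρs)` leaves the rectangle through null infinity. -/
theorem exists_characteristic (hu : u.IsSchwarzschild M A) (hM : 0 ≤ M) (ha : a < A)
    (hflat : NearFlat u a) {ρs : ℝ} (hρs : ρs ∈ Ioo 0 a) :
    ∃ (S : ℝ) (τc ρc : ℝ → ℝ), IsOutgoingCharacteristic u A ρs S τc ρc ∧
      ∀ s ∈ Icc 0 S, ρc s ≤ ρs := by
  set R : Set (ℝ × ℝ) := Icc 0 1 ×ˢ Icc 0 ρs with hR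
  set V : ℝ × ℝ → ℝ × ℝ := fun y => (1 - u.c0 y.1 y.2, -u.c1 y.1 y.2) with hV
  set cl : ℝ × ℝ → ℝ × ℝ := fun y => (max 0 (min 1 y.1), max 0 (min ρs y.2)) with hcl
  have hVd : ContDiffOn ℝ 1 V R := by
    have hs : R ⊆ Icc (-1) 1 ×ˢ Ico 0 A := fun y hy =>
      ⟨mem_of_unit hy.1, hy.2.1, hy.2.2.trans_lt (hρs.2.trans ha)⟩
    exact fun y hy => (contDiffAt_const.sub (hu.ana_c0 y (hs hy)).contDiffAt).contDiffWithinAt.prodMk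
      (hu.ana_c1 y (hs hy)).contDiffAt.neg.contDiffWithinAt
  have hRc : IsCompact R := isCompact_Icc.prod isCompact_Icc
  obtain ⟨K, hK⟩ := hVd.exists_lipschitzOnWith one_ne_zero
    ((convex_Icc 0 1).prod (convex_Icc 0 ρs)) hRc
  obtain ⟨L, hL⟩ := hRc.exists_bound_of_continuousOn hVd.continuousOn
  have hclR : ∀ y, cl y ∈ R := fun y =>
    ⟨⟨le_max_left _ _, max_le zero_le_one (min_le_left _ _)⟩,
      le_max_left _ _, max_le hρs.1.le (min_le_left _ _)⟩
  have hcl_lip : LipschitzWith 1 cl := by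
    have := ((LipschitzWith.prod_fst.const_min 1).const_max 0).prodMk
      ((LipschitzWith.prod_snd (α := ℝ) (β := ℝ).const_min ρs).const_max 0)
    simpa using this
  have hW : LipschitzWith K (V ∘ cl) := by
    have := hK.comp (hcl_lip.lipschitzOnWith (s := univ)) fun y _ => hclR y
    rwa [mul_one, lipschitzOnWith_univ] at this
  have hL0 : 0 ≤ L := (norm_nonneg _).trans (hL _ (hclR 0))
  obtain ⟨γ, hγ0, hγ⟩ := (IsPicardLindelof.of_time_independent (f := V ∘ cl) (tmin := 0)
    (tmax := 2) (t₀ := ⟨0, le_rfl, zero_le_two⟩) (x₀ := (0, ρs)) (a := ⟨L * 2, by positivity⟩) (r := 0)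
    (L := ⟨L, hL0⟩) (fun y _ => hL _ (hclR y)) hW.lipschitzOnWith (by
      simp
      exact le_rfl)).exists_eq_forall_mem_Icc_hasDerivWithinAt₀
  change γ 0 = _ at hγ0
  set x : ℝ → ℝ := fun s => (γ s).1 with hx
  set y : ℝ → ℝ := fun s => (γ s).2 with hy
  have hx0 : x 0 = 0 := by rw [hx]; simp only [hγ0]
  have hy0 : y 0 = ρs := by rw [hy]; simp only [hγ0]
  have dx : ∀ s ∈ Icc (0 : ℝ) 2, HasDerivWithinAt x (1 - u.c0 (cl (γ s)).1 (cl (γ s)).2)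
      (Icc 0 2) s := fun s hs => (hγ s hs).fst
  have dy : ∀ s ∈ Icc (0 : ℝ) 2, HasDerivWithinAt y (-u.c1 (cl (γ s)).1 (cl (γ s)).2)
      (Icc 0 2) s := fun s hs => (hγ s hs).snd
  have hclρ : ∀ s, (cl (γ s)).2 ∈ Ico 0 a := fun s =>
    ⟨(hclR _).2.1, (hclR _).2.2.trans_lt hρs.2⟩
  have bx : ∀ s, 3 / 4 ≤ 1 - u.c0 (cl (γ s)).1 (cl (γ s)).2 := fun s => by
    linarith [hu.c0_le hM ha hflat (hclR (γ s)).1 (hclρ s)]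
  have byy : ∀ s, 0 ≤ u.c1 (cl (γ s)).1 (cl (γ s)).2 ∧
      u.c1 (cl (γ s)).1 (cl (γ s)).2 ≤ 5 / 4 * (cl (γ s)).2 := fun s => by
    have h1 := abs_le.1 (hu.abs_c1_sub_le ha hflat (hclR (γ s)).1 (hclρ s))
    have h2 := (hclρ s).1
    constructor <;> linarith [h1.1, h1.2]
  have cx : ContinuousOn x (Icc 0 2) := fun s hs => (dx s hs).continuousWithinAt
  have cy : ContinuousOn y (Icc 0 2) := fun s hs => (dy s hs).continuousWithinAt
  have hmono : MonotoneOn (fun s => x s - 3 / 4 * s) (Icc 0 2) := by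
    refine monotoneOn_of_hasDerivWithinAt_nonneg (convex_Icc 0 2)
      (cx.sub (continuousOn_const.mul continuousOn_id))
      (f' := fun s => (1 - u.c0 (cl (γ s)).1 (cl (γ s)).2) - 3 / 4 * 1) (fun s hs => ?_)
      fun s _ => by linarith [bx s]
    exact ((dx s (interior_subset hs)).mono interior_subset).sub
      ((hasDerivWithinAt_id s _).const_mul _)
  have hanti : AntitoneOn y (Icc 0 2) :=
    antitoneOn_of_hasDerivWithinAt_nonpos (convex_Icc 0 2) cy
      (fun s hs => (dy s (interior_subset hs)).mono interior_subset)
      fun s _ => neg_nonpos.2 (byy s).1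
  have m0 : (0 : ℝ) ∈ Icc (0 : ℝ) 2 := ⟨le_rfl, zero_le_two⟩
  have m2 : (2 : ℝ) ∈ Icc (0 : ℝ) 2 := ⟨zero_le_two, le_rfl⟩
  have hyle : ∀ s ∈ Icc (0 : ℝ) 2, y s ≤ ρs := fun s hs => hy0 ▸ hanti m0 hs hs.1
  have hypos : ∀ s ∈ Icc (0 : ℝ) 2, 0 < y s := by
    have hB : ∀ s : ℝ, HasDerivAt (fun s => -(ρs * Real.exp (-2 * s)))
        (2 * (ρs * Real.exp (-2 * s))) s := fun s => by
      have := (((hasDerivAt_id s).const_mul (-2)).exp.const_mul ρs).neg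
      refine this.congr_deriv ?_
      simp only [id, mul_one]
      ring
    have h := image_le_of_deriv_right_lt_deriv_boundary' (f := fun s => -y s)
      (f' := fun s => u.c1 (cl (γ s)).1 (cl (γ s)).2) cy.neg
      (fun s hs => ((dy s ⟨hs.1, hs.2.le⟩).neg.congr_deriv (neg_neg _)).mono_of_mem_nhdsWithin
        (Icc_mem_nhdsGE_of_mem hs))
      (B := fun s => -(ρs * Real.exp (-2 * s))) (by simp [hy0])
      (fun s _ => (hB s).continuousAt.continuousWithinAt) (fun s _ => (hB s).hasDerivWithinAt)
      (fun s hs e => by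
        have e1 : y s = ρs * Real.exp (-2 * s) := neg_injective e
        have hp : 0 < y s := e1 ▸ mul_pos hρs.1 (Real.exp_pos _)
        have e2 : (cl (γ s)).2 = y s := by
          change max 0 (min ρs (y s)) = y s
          rw [min_eq_right (hyle s ⟨hs.1, hs.2.le⟩), max_eq_right hp.le]
        refine (byy s).2.trans_lt ?_
        rw [e2, ← e1]
        linarith)
    intro s hs
    have := h hs
    have hp := mul_pos hρs.1 (Real.exp_pos (-2 * s))
    linarith
  have hx2 : 1 ≤ x 2 := by
    have := hmono m0 m2 zero_le_two
    simp only [hx0] at this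
    linarith
  obtain ⟨S, hS, hxS⟩ := intermediate_value_Icc zero_le_two cx ⟨hx0.trans_le zero_le_one, hx2⟩
  have hSpos : 0 < S := by
    rcases hS.1.lt_or_eq with h | h
    · exact h
    · rw [← h, hx0] at hxS
      exact absurd hxS zero_ne_one
  have hsub : ∀ s ∈ Icc 0 S, s ∈ Icc (0 : ℝ) 2 := fun s hs => ⟨hs.1, hs.2.trans hS.2⟩
  have hx01 : ∀ s ∈ Icc 0 S, x s ∈ Icc (0 : ℝ) 1 := fun s hs => by
    have h1 := hmono m0 (hsub s hs) hs.1
    have h2 := hmono (hsub s hs) hS hs.2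
    simp only [hx0, hxS] at h1 h2
    constructor <;> linarith [hs.1, hs.2]
  have hcle : ∀ s ∈ Icc 0 S, cl (γ s) = (x s, y s) := fun s hs => by
    change (max 0 (min 1 (x s)), max 0 (min ρs (y s))) = _
    rw [min_eq_right (hx01 s hs).2, max_eq_right (hx01 s hs).1,
      min_eq_right (hyle s (hsub s hs)), max_eq_right (hypos s (hsub s hs)).le]
  refine ⟨S, x, y, ⟨hSpos, hx0, hy0, hxS, fun s hs => ⟨hx01 s hs, hypos s (hsub s hs),
    ((hyle s (hsub s hs)).trans_lt hρs.2).trans ha⟩, fun s hs => ?_, fun s hs => ?_⟩,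
    fun s hs => hyle s (hsub s hs)⟩
  · have := (dx s (hsub s hs)).mono hsub
    rw [hcle s hs] at this
    refine this.congr_deriv ?_
    simp only [Background.a]
    ring
  · have := (dy s (hsub s hs)).mono hsub
    rw [hcle s hs] at this
    refine this.congr_deriv ?_
    simp only [Background.b]
    ring

end Background.IsSchwarzschild

/-! ### Fields as functions on the slab -/

theorem SmoothOnSlab.exists_restr {A : ℝ} {φ : Field} (h : SmoothOnSlab A φ) (ha : a ≤ A) :
    ∃ u : SF a, restr a φ = u.1 := by
  obtain ⟨F, hF, e⟩ := h
  have hs : slab a ⊆ Ico 0 1 ×ˢ Ico 0 A ×ˢ univ := fun z hz =>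
    ⟨hz.1, ⟨hz.2.1.1, hz.2.1.2.trans_le ha⟩, hz.2.2⟩
  exact ⟨⟨restr a φ, F, hF.mono hs, fun x =>
    e x.τ x.hτ x.ρ ⟨x.hρ.1, x.hρ.2.trans_le ha⟩ x.g⟩, rfl⟩

theorem restr_dTau_eq {φ : Field} {u : SF a} (h : restr a φ = u.1) :
    restr a (dTau φ) = (dt u).1 := by
  obtain ⟨F, hF⟩ := exists_rep u
  funext x
  rw [restr_dTau (F := F) (by rwa [h]), (rep_dt hF).2]

theorem restr_dRho_eq {φ : Field} {u : SF a} (h : restr a φ = u.1) :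
    restr a (dRho φ) = (dr u).1 := by
  obtain ⟨F, hF⟩ := exists_rep u
  funext x
  rw [restr_dRho (F := F) (by rwa [h]), (rep_dr hF).2]

theorem restr_Z_eq (i : Fin 3) {φ : Field} {u : SF a} (h : restr a φ = u.1) :
    restr a (Z i φ) = (dz i u).1 := by
  obtain ⟨F, hF⟩ := exists_rep u
  funext x
  rw [restr_Z (F := F) (by rwa [h]), (rep_dz i hF).2]

theorem restr_Xplus_eq {φ : Field} {u : SF a} (h : restr a φ = u.1) :
    restr a (Xplus φ) = (Xp u).1 := by
  funext x
  have h0 := congrFun (restr_Z_eq 0 h) x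
  have h1 := congrFun (restr_Z_eq 1 h) x
  rw [Xp_eq, SF.sub_apply, SF.neg_apply, SF.smul_apply, ← h0, ← h1]
  rfl

theorem restr_Xminus_eq {φ : Field} {u : SF a} (h : restr a φ = u.1) :
    restr a (Xminus φ) = (Xm u).1 := by
  funext x
  have h0 := congrFun (restr_Z_eq 0 h) x
  have h1 := congrFun (restr_Z_eq 1 h) x
  rw [Xm_eq, SF.add_apply, SF.neg_apply, SF.smul_apply, ← h0, ← h1]
  rfl

theorem restr_iterate {op : Field → Field} {L : Module.End ℂ (SF a)}
    (hop : ∀ {φ : Field} {u : SF a}, restr a φ = u.1 → restr a (op φ) = (L u).1) (n : ℕ)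
    {φ : Field} {u : SF a} (h : restr a φ = u.1) : restr a (op^[n] φ) = ((L ^ n) u).1 := by
  induction n generalizing φ u with
  | zero => exact h
  | succ n ih =>
    rw [Function.iterate_succ_apply, pow_succ, Module.End.mul_apply]
    exact ih (hop h)

theorem restr_dRho_iterate (n : ℕ) {φ : Field} {u : SF a} (h : restr a φ = u.1) :
    restr a (dRho^[n] φ) = (DD 0 n u).1 :=
  restr_iterate (L := rL) restr_dRho_eq n h

theorem zL_pow (i : Fin 3) (n : ℕ) : (zL i : Module.End ℂ (SF a)) ^ n =
    ZZ (List.replicate n i) := by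
  simp [ZZ]

/-- The angular word `Z₁^{α₁} Z₂^{α₂} Z₃^{α₃}`. -/
def word (α : Fin 3 → ℕ) : List (Fin 3) :=
  List.replicate (α 0) 0 ++ (List.replicate (α 1) 1 ++ List.replicate (α 2) 2)

theorem restr_D (q j : ℕ) (α : Fin 3 → ℕ) {φ : Field} {u : SF a} (h : restr a φ = u.1) :
    restr a (D q j α φ) = (DD q j (ZZ (word α) u)).1 := by
  have h2 := restr_iterate (L := zL 2) (restr_Z_eq 2) (α 2) h
  have h1 := restr_iterate (L := zL 1) (restr_Z_eq 1) (α 1) h2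
  have h0 := restr_iterate (L := zL 0) (restr_Z_eq 0) (α 0) h1
  have hr := restr_iterate (L := rL) restr_dRho_eq j h0
  have ht := restr_iterate (L := tL) restr_dTau_eq q hr
  rw [zL_pow, zL_pow, zL_pow, ← ZZ_append, ← ZZ_append,
    List.append_assoc] at ht
  exact ht

theorem HasExpansion.apply_zero {A : ℝ} {p : ℕ} {φ : Fin 3 → Field} (h : HasExpansion A p φ)
    (hp : 0 < p) (hA : 0 < A) {k : Fin 3} (hk : (1 - ((k : ℕ) : ℤ)).natAbs = 1) {τ : ℝ}
    (hτ : τ ∈ Ico (0 : ℝ) 1) (g : SU2) : φ k τ 0 g = 0 := by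
  rw [h k τ hτ 0 ⟨le_rfl, hA⟩ g, taylorPart, hk]
  obtain ⟨n, rfl⟩ := Nat.exists_eq_succ_of_ne_zero hp.ne'
  rw [Function.iterate_succ_apply', J, intervalIntegral.integral_same, add_zero]
  refine Finset.sum_eq_zero fun l hl => ?_
  rw [Complex.ofReal_zero, zero_pow (by have := (Finset.mem_Ico.1 hl).1; omega), mul_zero]

theorem restr_taylorPart {p : ℕ} (hp : 0 < p) {φ : Fin 3 → Field} {u : Fin 3 → SF a}
    (h : ∀ k, restr a (φ k) = (u k).1) (h0 : Tr (u 0) = 0) (h2 : Tr (u 2) = 0) (k : Fin 3) :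
    restr a (taylorPart p φ k) = (taylor p (u k)).1 := by
  funext x
  have hT : (taylor p (u k)).1 x = ∑ l ∈ Finset.range p,
      (1 / (l.factorial : ℂ)) * coeff l (φ k) x.τ x.g * (x.ρ : ℂ) ^ l := by
    let ev : SF a →+ ℂ := ⟨⟨fun f => f.1 x, rfl⟩, fun _ _ => rfl⟩
    have := map_sum ev (fun l => ((1 / (l.factorial : ℂ)) • rho ^ l) * Tr (DD 0 l (u k)))
      (Finset.range p)
    refine this.trans (Finset.sum_congr rfl fun l _ => ?_)
    change (((1 / (l.factorial : ℂ)) • rho ^ l) * Tr (DD 0 l (u k))).1 x = _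
    have e1 : ((rho : SF a) ^ l).1 x = (x.ρ : ℂ) ^ l := rfl
    have e2 : (Tr (DD 0 l (u k))).1 x = coeff l (φ k) x.τ x.g :=
      (congrFun (restr_dRho_iterate l (h k)) x.base).symm
    rw [SF.mul_apply, SF.smul_apply, e1, e2]
    ring
  have hz : (1 - ((k : ℕ) : ℤ)).natAbs = 1 → coeff 0 (φ k) x.τ x.g = 0 := fun hk => by
    have e : coeff 0 (φ k) x.τ x.g = (Tr (u k)).1 x := congrFun (h k) x.base
    rw [e]
    fin_cases k
    · exact congrArg (fun f : SF a => f.1 x) h0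
    · simp at hk
    · exact congrArg (fun f : SF a => f.1 x) h2
  rw [hT]
  change ∑ l ∈ Finset.Ico (1 - ((k : ℕ) : ℤ)).natAbs p,
    (1 / (l.factorial : ℂ)) * coeff l (φ k) x.τ x.g * (x.ρ : ℂ) ^ l = _
  have hk : (1 - ((k : ℕ) : ℤ)).natAbs = 0 ∨ (1 - ((k : ℕ) : ℤ)).natAbs = 1 := by
    fin_cases k <;> simp
  rcases hk with hk | hk
  · rw [hk, Finset.range_eq_Ico]
  · rw [hk, Finset.range_eq_Ico, Finset.sum_eq_sum_Ico_succ_bot hp, hz hk]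
    simp

/-! ### The Maxwell operators -/

section Maxwell

variable {u : Background} {Y : Sys a} {φ : Fin 3 → Field} {f : Fin 3 → SF a}

theorem restr_maxwellA_zero (hY : IsDivided u Y) (h : ∀ k, restr a (φ k) = (f k).1) :
    restr a (maxwellA u 0 φ) = (Y.θ * Y.src0 (f 0) (f 1)).1 := by
  funext x
  have e : Y.θ * Y.src0 (f 0) (f 1) = Y.θ * dt (f 0) - (Y.θ * Y.p) * dr (f 0)
      - (Y.θ * Y.v0) * f 0 - (Y.θ * Y.s) * Xp (f 1) := by
    rw [Sys.src0]
    ring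
  rw [e, SF.sub_apply, SF.sub_apply, SF.sub_apply, SF.mul_apply Y.θ, SF.mul_apply (Y.θ * Y.p),
    SF.mul_apply (Y.θ * Y.v0), SF.mul_apply (Y.θ * Y.s), hY.θ_apply, hY.p_apply, hY.v0_apply,
    hY.s_apply, ← restr_dTau_eq (h 0),
    ← restr_dRho_eq (h 0), ← restr_Xplus_eq (h 1), ← h 0]
  simp only [restr, maxwellA, Background.a, Background.b, Background.cc, Fin.val_zero,
    Fin.castSucc_zero, Fin.succ_zero_eq_one]
  push_cast
  ring

theorem restr_maxwellA_one (hY : IsDivided u Y) (h : ∀ k, restr a (φ k) = (f k).1) :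
    restr a (maxwellA u 1 φ) = (Y.θ * Y.src1 (f 1) (f 2)).1 := by
  funext x
  have e : Y.θ * Y.src1 (f 1) (f 2) = Y.θ * dt (f 1) - (Y.θ * Y.p) * dr (f 1)
      - (Y.θ * Y.v1) * f 1 - (Y.θ * Y.s) * Xp (f 2) := by
    rw [Sys.src1]
    ring
  rw [e, SF.sub_apply, SF.sub_apply, SF.sub_apply, SF.mul_apply Y.θ, SF.mul_apply (Y.θ * Y.p),
    SF.mul_apply (Y.θ * Y.v1), SF.mul_apply (Y.θ * Y.s), hY.θ_apply, hY.p_apply, hY.v1_apply,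
    hY.s_apply, ← restr_dTau_eq (h 1),
    ← restr_dRho_eq (h 1), ← restr_Xplus_eq (h 2), ← h 1]
  simp only [restr, maxwellA, Background.a, Background.b, Background.cc, Fin.val_one,
    Fin.castSucc_one, Fin.succ_one_eq_two]
  push_cast
  ring

theorem restr_maxwellB_one (hY : IsDivided u Y) (h : ∀ k, restr a (φ k) = (f k).1) :
    restr a (maxwellB u 1 φ) = (Y.h * Y.src2 (f 1) (f 2)).1 := by
  funext x
  have e : Y.h * Y.src2 (f 1) (f 2) = (Y.h * oneSubTau) * dt (f 2) + (Y.θ * Y.p) * dr (f 2)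
      - (Y.h * Y.v2) * f 2 - (Y.θ * Y.s) * Xm (f 1) := by
    rw [Sys.src2, Y.θ_mul_p, Y.θ_mul_s]
    ring
  rw [e, SF.sub_apply, SF.sub_apply, SF.add_apply, SF.mul_apply (Y.h * oneSubTau),
    SF.mul_apply (Y.θ * Y.p), SF.mul_apply (Y.h * Y.v2), SF.mul_apply (Y.θ * Y.s), hY.h_apply,
    hY.p_apply, hY.v2_apply, hY.s_apply, ← restr_dTau_eq (h 2),
    ← restr_dRho_eq (h 2), ← restr_Xminus_eq (h 1), ← h 2]
  simp only [restr, maxwellB, Background.a, Background.b, Background.cc, Fin.val_one,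
    Fin.castSucc_one, Fin.succ_one_eq_two]
  push_cast
  ring

theorem IsMaxwellSolution.solves {A : ℝ} (hφ : IsMaxwellSolution u A φ) (ha : a ≤ A)
    (hY : IsDivided u Y) (h : ∀ k, restr a (φ k) = (f k).1) :
    Y.Solves (f 0) (f 1) (f 2) 0 0 0 := by
  obtain ⟨d, -, hd⟩ := hY.θ_inv
  obtain ⟨d', -, hd'⟩ := hY.h_inv
  have hz : ∀ x : Pt a, x.ρ ∈ Ico 0 A := fun x => ⟨x.hρ.1, x.hρ.2.trans_le ha⟩
  have e0 : Y.θ * Y.src0 (f 0) (f 1) = 0 := by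
    ext x
    rw [← restr_maxwellA_zero hY h]
    exact (hφ 0 x.τ x.hτ x.ρ (hz x) x.g).1
  have e1 : Y.θ * Y.src1 (f 1) (f 2) = 0 := by
    ext x
    rw [← restr_maxwellA_one hY h]
    exact (hφ 1 x.τ x.hτ x.ρ (hz x) x.g).1
  have e2 : Y.h * Y.src2 (f 1) (f 2) = 0 := by
    ext x
    rw [← restr_maxwellB_one hY h]
    exact (hφ 1 x.τ x.hτ x.ρ (hz x) x.g).2
  have cancel : ∀ {d θ v : SF a}, d * θ = 1 → θ * v = 0 → v = 0 := fun {d θ v} h1 h2 => by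
    rw [← one_mul v, ← h1, mul_assoc, h2, mul_zero]
  refine ⟨?_, ?_, ?_⟩
  · rw [add_zero]
    exact sub_eq_zero.1 (cancel hd e0)
  · rw [add_zero]
    exact sub_eq_zero.1 (cancel hd e1)
  · rw [add_zero]
    exact sub_eq_zero.1 (cancel hd' e2)

end Maxwell

/-! ### Integrals over the region -/

theorem Slice.mem_Bd_of_bounded (s : Slice a) {u : SF a} {B : ℝ} (h : ∀ x, ‖u.1 x‖ ≤ B) :
    u ∈ s.Bd 0 := by
  have h1 : ∀ τ ∈ Ico (0 : ℝ) 1, s.I τ 1 = s.I 0 1 := fun τ hτ => by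
    rw [Slice.I, Slice.I, sliceInt, sliceInt]
    congr 2
    funext y
    by_cases hy : y.1 ∈ Ico 0 a
    · rw [zeroExt_of_mem _ hτ hy, zeroExt_of_mem _ ⟨le_rfl, one_pos⟩ hy]
      rfl
    · rw [zeroExt, zeroExt, dif_neg fun h => hy h.2, dif_neg fun h => hy h.2]
  refine ⟨B ^ 2 * s.I 0 1, fun τ hτ => ?_⟩
  have hw : wt 0 τ = 1 := by simp [wt]
  rw [hw, mul_one, ← h1 τ hτ, Slice.NN, ← Slice.I_smul hτ]
  refine Slice.I_mono hτ fun x _ _ => ?_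
  rw [re_mul_normSq, SF.smul_apply, SF.one_apply, mul_one, Complex.ofReal_re]
  have h2 : ‖u.1 x‖ ^ 2 ≤ B ^ 2 := pow_le_pow_left₀ (norm_nonneg _) (h x) 2
  nlinarith [s.nonneg x, s.le_one x, sq_nonneg ‖u.1 x‖]

theorem Slice.lintegral_le_NN (s : Slice a) {r : ℝ} (hr : r ≤ s.b) {τ : ℝ}
    (hτ : τ ∈ Ico (0 : ℝ) 1) (hχ : ∀ x : Pt a, x.ρ ≤ r → s.χ.1 x = 1) (f : SF a) :
    ∫⁻ y in Icc 0 r ×ˢ univ, ‖zeroExt f.1 τ y.1 y.2‖ₑ ^ 2 ∂(volume.prod s.μ) ≤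
      ENNReal.ofReal (s.NN τ f) := by
  have hi := integrable_slice s.μ s.b_lt hτ (s.χ * (f * star f))
  have hNN : s.NN τ f =
      ∫ y, (zeroExt (s.χ * (f * star f)).1 τ y.1 y.2).re ∂(sliceMeasure s.μ s.b) := by
    rw [Slice.NN, Slice.I, sliceInt]
    exact (Complex.reCLM.integral_comp_comm hi).symm
  have hnn : 0 ≤ᵐ[sliceMeasure s.μ s.b]
      fun y => (zeroExt (s.χ * (f * star f)).1 τ y.1 y.2).re := by
    filter_upwards [ae_sliceMeasure s.μ s.b] with y hy
    rw [zeroExt_of_mem _ hτ ⟨hy.1, hy.2.trans_lt s.b_lt⟩, re_mul_normSq]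
    exact mul_nonneg (s.nonneg _) (sq_nonneg _)
  have hre : Integrable (fun y : ℝ × SU2 => (zeroExt (s.χ * (f * star f)).1 τ y.1 y.2).re)
      (sliceMeasure s.μ s.b) := hi.re
  rw [hNN, ofReal_integral_eq_lintegral_ofReal hre hnn,
    sliceMeasure_eq]
  refine le_trans (le_of_eq ?_) (lintegral_mono_set (prod_mono (Icc_subset_Icc_right hr) le_rfl))
  refine setLIntegral_congr_fun (measurableSet_Icc.prod MeasurableSet.univ) fun y hy => ?_
  have hya : y.1 ∈ Ico 0 a := ⟨hy.1.1, (hy.1.2.trans hr).trans_lt s.b_lt⟩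
  rw [zeroExt_of_mem _ hτ hya, zeroExt_of_mem _ hτ hya, re_mul_normSq, hχ _ hy.1.2, Complex.one_re,
    one_mul, ENNReal.ofReal_pow (norm_nonneg _), ofReal_norm]

theorem lintegral_wt_half_lt_top (C : ℝ) :
    ∫⁻ τ in Ico (0 : ℝ) 1, ENNReal.ofReal (C * wt (1 / 2) τ) < ⊤ := by
  have h1 : IntervalIntegrable (fun x : ℝ => x ^ (-(1 / 2) : ℝ)) volume 0 1 :=
    intervalIntegral.intervalIntegrable_rpow' (by norm_num)
  have h2 : IntervalIntegrable (fun x : ℝ => wt (1 / 2) x) volume 0 1 := by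
    have := (h1.comp_sub_left 1).symm
    simp only [sub_zero, sub_self] at this
    exact this
  have h3 := ((intervalIntegrable_iff_integrableOn_Ico_of_le zero_le_one).1 h2).const_mul C
  exact h3.lintegral_lt_top

theorem Slice.lintegral_lt_top (s : Slice a) {r : ℝ} (hr : r ≤ s.b)
    (hχ : ∀ x : Pt a, x.ρ ≤ r → s.χ.1 x = 1) {f : SF a} (hf : f ∈ s.Bd (1 / 2)) :
    ∫⁻ z in Ico 0 1 ×ˢ Icc 0 r ×ˢ univ, ‖zeroExt f.1 z.1 z.2.1 z.2.2‖ₑ ^ 2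
      ∂(volume.prod (volume.prod s.μ)) < ⊤ := by
  obtain ⟨C, hC⟩ := hf
  have hm : AEMeasurable (fun z : ℝ × ℝ × SU2 => ‖zeroExt f.1 z.1 z.2.1 z.2.2‖ₑ ^ 2)
      ((volume.prod (volume.prod s.μ)).restrict (Ico 0 1 ×ˢ Icc 0 r ×ˢ univ)) := by
    refine AEMeasurable.pow_const (AEStronglyMeasurable.enorm ?_) 2
    exact ((continuousOn_zeroExt f).mono fun z hz =>
      ⟨hz.1, ⟨hz.2.1.1, (hz.2.1.2.trans hr).trans_lt s.b_lt⟩, hz.2.2⟩).aestronglyMeasurable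
      (measurableSet_Ico.prod (measurableSet_Icc.prod MeasurableSet.univ))
  rw [← Measure.prod_restrict] at hm ⊢
  rw [lintegral_prod _ hm]
  refine lt_of_le_of_lt (setLIntegral_mono' measurableSet_Ico fun τ hτ => ?_)
    (lintegral_wt_half_lt_top C)
  exact (s.lintegral_le_NN hr hτ hχ f).trans (ENNReal.ofReal_le_ofReal (hC τ hτ))

/-- The region `𝒩_t` is contained, up to the null set `τ = 1`, in `0 ≤ τ < 1`, `0 ≤ ρ ≤ ρ_*`. -/
theorem lintegral_regionN_le (μ : Measure SU2) [IsProbabilityMeasure μ] {S r t : ℝ} {τc ρc : ℝ → ℝ}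
    (hρc : ∀ s ∈ Icc 0 S, ρc s ≤ r) (ht : t ≤ 1) (F : ℝ × ℝ × SU2 → ℝ≥0∞) :
    ∫⁻ z in regionN S τc ρc t, F z ∂(volume.prod (volume.prod μ)) ≤
      ∫⁻ z in Ico 0 1 ×ˢ Icc 0 r ×ˢ univ, F z ∂(volume.prod (volume.prod μ)) := by
  have hsub : regionN S τc ρc t ⊆ (Ico 0 1 ×ˢ Icc 0 r ×ˢ univ) ∪ ({1} ×ˢ univ) := by
    rintro z ⟨h0, h1, h2, s, hs, -, h3⟩
    rcases (h1.trans ht).lt_or_eq with h | h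
    · exact Or.inl ⟨⟨h0, h⟩, ⟨h2, h3.trans (hρc s hs)⟩, mem_univ _⟩
    · exact Or.inr ⟨h, mem_univ _⟩
  refine (lintegral_mono_set hsub).trans ((lintegral_union_le _ _ _).trans ?_)
  rw [setLIntegral_measure_zero ({1} ×ˢ univ) _
    (by rw [Measure.prod_prod, Real.volume_singleton, zero_mul]), add_zero]

theorem SourcesBounded.mem_Bd {u : Background} {ρ₁ : ℝ} {m p : ℕ} {φ : Fin 3 → Field}
    (h : SourcesBounded u ρ₁ m p φ) (ha : a ≤ ρ₁) (s : Slice a) {k : Fin 2} {q j : ℕ}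
    (hqj : q + j ≤ m) :
    (∀ f : SF a, restr a (maxwellA u k (taylorPart p φ)) = f.1 → DD q (p + j) f ∈ s.Bd 0) ∧
      ∀ f : SF a, restr a (maxwellB u k (taylorPart p φ)) = f.1 → DD q (p + j) f ∈ s.Bd 0 := by
  obtain ⟨B, hB⟩ := h k q j 0 (by simpa using hqj)
  have hx : ∀ x : Pt a, x.ρ ∈ Icc 0 ρ₁ := fun x => ⟨x.hρ.1, x.hρ.2.le.trans ha⟩
  refine ⟨fun f hf => s.mem_Bd_of_bounded (B := B) fun x => ?_,
    fun f hf => s.mem_Bd_of_bounded (B := B) fun x => ?_⟩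
  · have e := congrFun (restr_D q (p + j) 0 hf) x
    change _ = (DD q (p + j) f).1 x at e
    rw [← e]
    exact (hB x.τ x.hτ x.ρ (hx x) x.g).1
  · have e := congrFun (restr_D q (p + j) 0 hf) x
    change _ = (DD q (p + j) f).1 x at e
    rw [← e]
    exact (hB x.τ x.hτ x.ρ (hx x) x.g).2

theorem DD_add_right (q j p : ℕ) (f : SF a) : DD q (j + p) f = DD q j (DD 0 p f) := by
  simp only [DD, pow_add, pow_zero, one_mul, Module.End.mul_apply]

/-- All derivatives `D^{q,j,α} ∂_ρ^p φ_k`, `q + j + |α| ≤ m`, are square integrable over the slices,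
with at most a factor `(1 - τ)^(-1/2)`. -/
theorem mem_Bd_half {u : Background} {A ρ₁ : ℝ} {Y : Sys a} {s : Slice a} {m p : ℕ}
    (hY : IsDivided u Y) (hs : s.Short Y m p) (hp : 0 < p) (ha : a ≤ ρ₁) (haA : a ≤ A)
    (hA : 0 < A) {φ : Fin 3 → Field} {f : Fin 3 → SF a} (hf : ∀ k, restr a (φ k) = (f k).1)
    (hφ : IsMaxwellSolution u A φ) (hexp : HasExpansion A p φ) (hsrc : SourcesBounded u ρ₁ m p φ)
    (k : Fin 3) {q j : ℕ} (hqj : q + j ≤ m) (w : List (Fin 3)) :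
    DD q j (ZZ w (DD 0 p (f k))) ∈ s.Bd (1 / 2) := by
  have htr : ∀ k : Fin 3, (1 - ((k : ℕ) : ℤ)).natAbs = 1 → Tr (f k) = 0 := fun k hk => by
    ext x
    rw [Tr_apply, ← hf k]
    exact hexp.apply_zero hp hA hk x.hτ x.g
  have hT := restr_taylorPart hp hf (htr 0 (by simp)) (htr 2 (by simp))
  obtain ⟨d, hd, hdd⟩ := hY.θ_inv
  obtain ⟨e, he, hee⟩ := hY.h_inv
  have t0 := restr_maxwellA_zero (f := fun k => taylor p (f k)) hY hT
  have t1 := restr_maxwellA_one (f := fun k => taylor p (f k)) hY hT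
  have t2 := restr_maxwellB_one (f := fun k => taylor p (f k)) hY hT
  have hreg := Slice.reg_remainder hs (hφ.solves haA hY hf) Y.θ_mem hd hdd Y.h_mem he hee
    (fun q j hqj => (hsrc.mem_Bd ha s hqj).1 _ t0)
    (fun q j hqj => (hsrc.mem_Bd ha s hqj).1 _ t1)
    (fun q j hqj => (hsrc.mem_Bd ha s hqj).2 _ t2) (ε := 1 / 2) one_half_pos
  have hk : Reg (s.Bw (1 / 2)) m (p + m) (f k - taylor p (f k)) := by
    obtain rfl | rfl | rfl : k = 0 ∨ k = 1 ∨ k = 2 := by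
      fin_cases k <;> simp
    exacts [hreg.1, hreg.2.1, hreg.2.2]
  have e1 : DD q j (ZZ w (DD 0 p (f k))) = ZZ w (DD q (j + p) (f k - taylor p (f k))) := by
    rw [DD_add_right, map_sub, DD_taylor, sub_zero, DD_ZZ]
  rw [e1]
  exact hk q (j + p) (by omega) (by omega) w

theorem lintegral_density_lt_top {s : Slice a} {r : ℝ} (hr : r ≤ s.b)
    (hχ : ∀ x : Pt a, x.ρ ≤ r → s.χ.1 x = 1) {m p : ℕ} {φ : Field} {f : SF a}
    (hf : restr a φ = f.1)
    (h : ∀ q j, q + j ≤ m → ∀ w, DD q j (ZZ w (DD 0 p f)) ∈ s.Bd (1 / 2)) :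
    ∫⁻ z in Ico 0 1 ×ˢ Icc 0 r ×ˢ univ, density m p φ z.1 z.2.1 z.2.2
      ∂(volume.prod (volume.prod s.μ)) < ⊤ := by
  set E : Set (ℝ × ℝ × SU2) := Ico 0 1 ×ˢ Icc 0 r ×ˢ univ with hE
  have hEm : MeasurableSet E :=
    measurableSet_Ico.prod (measurableSet_Icc.prod MeasurableSet.univ)
  have hEs : ∀ z ∈ E, z.2.1 ∈ Ico 0 a := fun z hz =>
    ⟨hz.2.1.1, (hz.2.1.2.trans hr).trans_lt s.b_lt⟩
  have e : ∫⁻ z in E, density m p φ z.1 z.2.1 z.2.2 ∂(volume.prod (volume.prod s.μ)) =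
      ∫⁻ z in E, ∑ i ∈ indices m,
        ‖zeroExt (DD i.1 i.2.1 (ZZ (word i.2.2) (DD 0 p f))).1 z.1 z.2.1 z.2.2‖ₑ ^ 2
        ∂(volume.prod (volume.prod s.μ)) := by
    refine setLIntegral_congr_fun hEm fun z hz => ?_
    refine Finset.sum_congr rfl fun i _ => ?_
    rw [zeroExt_of_mem _ hz.1 (hEs z hz), ← restr_D i.1 i.2.1 i.2.2 (restr_dRho_iterate p hf)]
    rfl
  rw [e, lintegral_finsetSum']
  · refine ENNReal.sum_lt_top.2 fun i hi => s.lintegral_lt_top hr hχ (h _ _ ?_ _)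
    have := (Finset.mem_filter.1 hi).2
    omega
  · intro i _
    refine AEMeasurable.pow_const (AEStronglyMeasurable.enorm ?_) 2
    exact ((continuousOn_zeroExt _).mono fun z hz => ⟨hz.1, hEs z hz, hz.2.2⟩).aestronglyMeasurable
      hEm

end

end FGauge

theorem theorem1 {M a : ℝ} (hM : 0 ≤ M)
    (u : FGauge.Background) (hu : u.IsSchwarzschild M a)
    (μ : Measure FGauge.SU2) [μ.IsHaarMeasure] [IsProbabilityMeasure μ]
    {m p : ℕ} (hm : 0 < m) (hp : m + 2 < p) {ρ₁ : ℝ} (hρ₁ : ρ₁ ∈ Ioo 0 a) :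
    ∃ ρs ∈ Ioo 0 a, ∃ (S : ℝ) (τc ρc : ℝ → ℝ),
      FGauge.IsOutgoingCharacteristic u a ρs S τc ρc ∧
      ∃ C₁ : ℝ≥0, ∀ φ : Fin 3 → FGauge.Field,
        (∀ k, FGauge.SmoothOnSlab a (φ k)) →
        FGauge.IsMaxwellSolution u a φ →
        FGauge.HasExpansion a p φ →
        FGauge.SourcesBounded u ρ₁ m p φ →
        ∃ C₂ : ℝ≥0, ∀ t ∈ Icc (0 : ℝ) 1, ∀ k : Fin 3,
          ∫⁻ z in FGauge.regionN S τc ρc t, FGauge.density m p (φ k) z.1 z.2.1 z.2.2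
              ∂(volume.prod (volume.prod μ)) ≤
            C₁ * ∑ k' : Fin 3, ∫⁻ y in Icc 0 ρs ×ˢ univ,
              FGauge.density m p (φ k') 0 y.1 y.2 ∂(volume.prod μ) + C₂ := by
  obtain ⟨a₀, ha₀, hflat⟩ := hu.exists_nearFlat hM hρ₁.1 hρ₁.2
  have haA : a₀ < a := ha₀.2.trans_lt hρ₁.2
  obtain ⟨Y, hY⟩ := hu.exists_sys hM ha₀.1 haA hflat
  obtain ⟨b₀, hb₀, hshort⟩ := FGauge.Slice.exists_short Y hp
  set r : ℝ := min b₀ a₀ / 4 with hr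
  have hr0 : 0 < r := div_pos (lt_min hb₀ ha₀.1) four_pos
  have hrb : 2 * r ≤ b₀ := by
    have := min_le_left b₀ a₀
    linarith
  have hra : 2 * r < a₀ := by
    have := min_le_right b₀ a₀
    linarith
  obtain ⟨s, rfl, hsb, hχ⟩ := FGauge.exists_slice μ hr0 hra
  have hs := hshort s (hsb.trans_le hrb)
  -- the cut-off is `1` for `ρ e^{2τ} ≤ r`, hence on the region below the characteristic
  have hρs : r * Real.exp (-2) ≤ r :=
    mul_le_of_le_one_right hr0.le (Real.exp_le_one_iff.2 (by norm_num))
  have hρs0 : 0 < r * Real.exp (-2) := mul_pos hr0 (Real.exp_pos _)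
  have hχ' : ∀ x : FGauge.Pt a₀, x.ρ ≤ r * Real.exp (-2) → s.χ.1 x = 1 := fun x hx => hχ x (by
    have h1 : Real.exp (2 * x.τ) ≤ Real.exp 2 := Real.exp_le_exp.2 (by linarith [x.hτ.2])
    have h2 : r * Real.exp (-2) * Real.exp 2 = r := by
      rw [mul_assoc, ← Real.exp_add]
      simp
    rw [← h2]
    exact mul_le_mul hx h1 (Real.exp_pos _).le hρs0.le)
  obtain ⟨S, τc, ρc, hchar, hρc⟩ := hu.exists_characteristic hM haA hflat
    (ρs := r * Real.exp (-2)) ⟨hρs0, by linarith⟩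
  -- the left hand side is bounded by a constant that depends on `φ`, so any `C₁` will do
  refine ⟨r * Real.exp (-2), ⟨hρs0, by linarith⟩, S, τc, ρc, hchar, 1,
    fun φ hφs hφ hexp hsrc => ?_⟩
  choose f hf using fun k => (hφs k).exists_restr haA.le
  have hfin := fun k => FGauge.lintegral_density_lt_top (s := s) (p := p) (m := m)
    (by linarith) hχ' (hf k) fun q j hqj w => FGauge.mem_Bd_half hY hs (by omega) ha₀.2 haA.le
      (hρ₁.1.trans hρ₁.2) hf hφ hexp hsrc k hqj w
  obtain ⟨C₂, hC₂, -⟩ := ENNReal.lt_iff_exists_coe.1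
    (ENNReal.sum_lt_top.2 fun k (_ : k ∈ Finset.univ) => hfin k)
  refine ⟨C₂, fun t ht k => le_add_left ?_⟩
  rw [← hC₂]
  exact (FGauge.lintegral_regionN_le s.μ hρc ht.2 _).trans
    (Finset.single_le_sum (f := fun k => ∫⁻ z in Ico 0 1 ×ˢ Icc 0 (r * Real.exp (-2)) ×ˢ univ,
      FGauge.density m p (φ k) z.1 z.2.1 z.2.2 ∂(volume.prod (volume.prod s.μ)))
      (fun _ _ => zero_le) (Finset.mem_univ k))
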